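/- **Conventions.** An action operad $\Lambda$ is an operad of sets with a group structure on each $\Lambda(n)$ and a map of operads $\pi:\Lambda\to\Sigma$ to the symmetric groups consisting of group homomorphisms, such that $\mu(g;f_1,\dots,f_n)\,\mu(g';f_1',\dots,f_n')=\mu(gg';f_{\pi(g')(1)}f_1',\dots,f_{\pi(g')(n)}f_n')$ whenever this makes sense. Maps of action operads are operad maps over $\Sigma$ that are levelwise group homomorphisms. A collection over the symmetric groups is a set each of whose elements $x$ has an arity $|x|$ and a permutation $\sigma_x\in\Sigma_{|x|}$; $F$ denotes the free action operad functor, left adjoint to the forgetful functor from action operads to such collections. A presentation $(\mathbf g,\mathbf r,s_1,s_2,p)$ of $\Lambda$ consists of collections $\mathbf g,\mathbf r$, maps of action operads $s_1,s_2:F\mathbf r\to F\mathbf g$, and a coequalizer $p:F\mathbf g\to\Lambda$ of $s_1,s_2$. A club is a category $K$ over the category $P$ of natural numbers and permutations that is a monoid for the composition product $K\circ K$, whose objects are $(x;y_1,\dots,y_n)$ with $n$ the arity of $x$ and whose morphisms $(x;y)\to(x';y')$ are a morphism $f:x\to x'$ over a permutation $\sigma$ together with morphisms $y_i\to y'_{\sigma(i)}$.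 An algebra of $K$ is a category $X$ with an action $K\circ X\to X$. The club of $E\Lambda$ is $B\Lambda=\coprod_n B\Lambda(n)$ with the multiplication given by $\mu$; its monad on categories is $X\mapsto\coprod_n E\Lambda(n)\times_{\Lambda(n)}X^n$. **Theorem.** (1) Let $\Lambda$ be an action operad with a presentation $(\mathbf g,\mathbf r,s_1,s_2,p)$. Then the club of $E\Lambda$ is generated by a unit object and a tensor product, together with isomorphisms of tensor powers indexed by $\mathbf g$, subject to strict associativity and unit laws and to the equations $s_1(y)=s_2(y)$ for $y\in\mathbf r$. That is, for each club $K$ the following correspond bijectively: * maps of clubs $\Phi:B\Lambda\to K$; * an object $I$ of $K$ of arity $0$ and an object $t$ of arity $2$ that satisfy the strict associativity and unit laws, with an isomorphism $\alpha_x:t_{|x|}\to t_{|x|}$ of $K$ over $\sigma_x$ for each $x\in\mathbf g$, where $t_n$ is the $n$-th tensor power operation formed from $I$ and $t$, such that for each $y\in\mathbf r$ all formal composites that represent $s_1(y)$ and $s_2(y)$ have the same value in $K$; where $I=\Phi(0)$, $t=\Phi(2)$ and $\alpha_x=\Phi(p(x))$. Consequently, the structures of an algebra of $E\Lambda$ on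 a small category $X$ correspond bijectively to the strict monoidal structures on $X$ equipped with natural isomorphisms $$\alpha_x: a_1\otimes\cdots\otimes a_n\to a_{\sigma_x^{-1}(1)}\otimes\cdots\otimes a_{\sigma_x^{-1}(n)}\qquad(x\in\mathbf g,\ n=|x|)$$ that satisfy $s_1(y)=s_2(y)$ for all $y\in\mathbf r$; here the unit, the tensor product and $\alpha_x$ are given by the action of $0$, of $2$ and of $p(x)$. Under this correspondence, a functor is a strict map of algebras if and only if it strictly preserves the unit, the tensor product and all $\alpha_x$, and a transformation between such functors is a transformation of algebra maps if and only if it is monoidal. (2) Let $\mathcal M$ be a notion of strict monoidal category given by a set $\mathcal G$ of natural isomorphisms $f:a_1\otimes\cdots\otimes a_n\to a_{\pi_f^{-1}(1)}\otimes\cdots\otimes a_{\pi_f^{-1}(n)}$ and a set $\mathcal R$ of axioms, each of which equates two formal composites of elements of $\mathcal G$ (built from identities, inverses, composition, tensor product and application to blocks) with the same underlying permutation. Let $s_1,s_2:F\mathcal R\to F\mathcal G$ be the maps that send an axiom to the value of its left, respectively right, hand side. Then $s_1,s_2$ have a coequalizer of action operads, and for every coequalizer $p:F\mathcal G\to\Lambda$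 the strict monoidal categories of type $\mathcal M$ are the algebras of $E\Lambda$, in the sense of the correspondence in (1) (for categories, strict functors and transformations). -/

import Mathlib

set_option linter.unusedVariables false
set_option linter.checkUnivs false
open CategoryTheory CategoryTheory.Limits

universe w v w' v' u

/-! ### Blocks -/

/-- `Fin N`, with `N = k 0 + ⋯ + k (n-1)`, cut into consecutive blocks of sizes `k 0, …, k (n-1)`:
the pair `(i, j)` is sent to the `j`-th position of the `i`-th block. -/
def blk {n N : ℕ} (k : Fin n → ℕ) (h : ∑ i, k i = N) : (Σ i, Fin (k i)) ≃ Fin N :=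
  finSigmaFinEquiv.trans (finCongr h)

theorem blk_val {n N : ℕ} (k : Fin n → ℕ) (h : ∑ i, k i = N) (i : Fin n) (j : Fin (k i)) :
    (blk k h ⟨i, j⟩ : ℕ) = (∑ a, if a < i then k a else 0) + j := by
  have h1 : (blk k h ⟨i, j⟩ : ℕ) = ∑ a : Fin i, k (Fin.castLE i.2.le a) + j := by
    simp [blk, finSigmaFinEquiv_apply]
  rw [h1, ← Finset.sum_filter]
  congr 1
  refine Finset.sum_bij (fun a _ => Fin.castLE i.2.le a) ?_ ?_ ?_ ?_
  · intro a _
    simp only [Finset.mem_filter, Finset.mem_univ, true_and]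
    exact a.2
  · intro a _ b _ hab
    exact Fin.castLE_injective _ hab
  · intro b hb
    simp only [Finset.mem_filter, Finset.mem_univ, true_and] at hb
    exact ⟨⟨b, hb⟩, Finset.mem_univ _, rfl⟩
  · intro a _
    rfl

theorem blk_lt {n N : ℕ} (k : Fin n → ℕ) (h : ∑ i, k i = N) (i i' : Fin n) (j : Fin (k i))
    (j' : Fin (k i')) :
    blk k h ⟨i, j⟩ < blk k h ⟨i', j'⟩ ↔ i < i' ∨ (i = i' ∧ (j : ℕ) < j') := by
  have key : ∀ (i i' : Fin n) (j : Fin (k i)) (j' : Fin (k i')), i < i' →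
      blk k h ⟨i, j⟩ < blk k h ⟨i', j'⟩ := by
    intro i i' j j' hi
    rw [Fin.lt_def, blk_val, blk_val]
    have : (∑ a, if a < i then k a else 0) + k i ≤ ∑ a, if a < i' then k a else 0 := by
      have e : k i = ∑ a, if a = i then k a else 0 := by simp
      rw [e, ← Finset.sum_add_distrib]
      refine Finset.sum_le_sum fun a _ => ?_
      by_cases h1 : a < i
      · simp [h1, h1.ne, h1.trans hi]
      · by_cases h2 : a = i
        · subst h2; simp [hi]
        · simp [h1, h2]
    have := j.2
    omega
  rcases lt_trichotomy i i' with hi | hi | hi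
  · simp [hi, key i i' j j' hi]
  · subst hi
    rw [Fin.lt_def, blk_val, blk_val]
    simp
  · have := key i' i j' j hi
    simp [hi.not_gt, hi.ne', this.le]

theorem blk_sum {n N : ℕ} (k : Fin n → ℕ) (h : ∑ i, k i = N) (q : Fin N → ℕ) :
    ∑ i, ∑ j, q (blk k h ⟨i, j⟩) = ∑ l, q l := by
  rw [← (blk k h).sum_comp, Fintype.sum_sigma]

theorem blk_blk {m M N : ℕ} (n : Fin m → ℕ) (hn : ∑ i, n i = M) (q : Fin M → ℕ)
    (hq : ∑ l, q l = N) (i : Fin m) (j : Fin (n i)) (l : Fin (q (blk n hn ⟨i, j⟩))) :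
    blk q hq ⟨blk n hn ⟨i, j⟩, l⟩ =
      blk (fun i => ∑ j, q (blk n hn ⟨i, j⟩)) ((blk_sum n hn q).trans hq)
        ⟨i, blk (fun j => q (blk n hn ⟨i, j⟩)) rfl ⟨j, l⟩⟩ := by
  apply Fin.ext
  rw [blk_val, blk_val, blk_val, ← add_assoc]
  congr 1
  rw [← (blk n hn).sum_comp, Fintype.sum_sigma]
  have e : (∑ j', if j' < j then q (blk n hn ⟨i, j'⟩) else 0) =
      ∑ i', if i' = i then (∑ j', if j' < j then q (blk n hn ⟨i, j'⟩) else 0) else 0 := by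
    simp
  rw [e, ← Finset.sum_add_distrib]
  refine Finset.sum_congr rfl fun i' _ => ?_
  simp only [blk_lt]
  rcases lt_trichotomy i' i with hi | hi | hi
  · simp [hi, hi.ne]
  · subst hi
    simp
  · simp [hi.not_gt, hi.ne']

theorem blk_congr {n N : ℕ} {k k' : Fin n → ℕ} (hk : ∀ i, k i = k' i) (h : ∑ i, k i = N)
    (h' : ∑ i, k' i = N) {i i' : Fin n} (hi : i = i') {j : Fin (k i)} {j' : Fin (k' i')}
    (hj : (j : ℕ) = j') : blk k h ⟨i, j⟩ = blk k' h' ⟨i', j'⟩ := by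
  obtain rfl : k = k' := funext hk
  subst hi
  rw [Fin.ext hj]

theorem blk_val_congr {n n' N N' : ℕ} (hn : n = n') {k : Fin n → ℕ} {k' : Fin n' → ℕ}
    (hk : ∀ i, k i = k' (Fin.cast hn i)) (h : ∑ i, k i = N) (h' : ∑ i, k' i = N') {i : Fin n}
    {i' : Fin n'} (hi : (i : ℕ) = i') {j : Fin (k i)} {j' : Fin (k' i')} (hj : (j : ℕ) = j') :
    (blk k h ⟨i, j⟩ : ℕ) = blk k' h' ⟨i', j'⟩ := by
  subst hn h h'
  obtain rfl : i = i' := Fin.ext hi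
  obtain rfl : k = k' := funext hk
  rw [Fin.ext hj]

theorem blk_one {n : ℕ} (h : ∑ _ : Fin 1, n = n) (i : Fin 1) (j : Fin n) :
    blk (fun _ : Fin 1 => n) h ⟨i, j⟩ = j := by
  apply Fin.ext
  rw [blk_val]
  have : i = 0 := Subsingleton.elim _ _
  subst this
  simp

theorem blk_ones {n : ℕ} (h : ∑ _ : Fin n, 1 = n) (i : Fin n) (j : Fin 1) :
    blk (fun _ : Fin n => 1) h ⟨i, j⟩ = i := by
  apply Fin.ext
  rw [blk_val, ← Finset.sum_filter, Finset.sum_const, smul_eq_mul, mul_one, Fin.val_eq_zero j,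
    add_zero]
  have : (Finset.univ.filter fun a : Fin n => a < i) = Finset.Iio i := by
    ext a; simp
  rw [this, Fin.card_Iio]

/-- Operadic composition of permutations: `σ` permutes the blocks, which are of sizes `k i`
(the block in place `i` is moved to place `σ i`), and `τ i` permutes the `i`-th block. -/
def blockPerm {n N : ℕ} (k : Fin n → ℕ) (h : ∑ i, k i = N) (σ : Equiv.Perm (Fin n))
    (τ : ∀ i, Equiv.Perm (Fin (k i))) : Equiv.Perm (Fin N) :=
  (blk k h).symm.trans
    ((Equiv.sigmaCongr σ fun i => (τ i).trans (finCongr (by rw [σ.symm_apply_apply]))).trans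
      (blk (fun i => k (σ.symm i)) ((σ.symm.sum_comp k).trans h)))

theorem blockPerm_blk {n N : ℕ} (k : Fin n → ℕ) (h : ∑ i, k i = N) (σ : Equiv.Perm (Fin n))
    (τ : ∀ i, Equiv.Perm (Fin (k i))) (i : Fin n) (j : Fin (k i)) :
    blockPerm k h σ τ (blk k h ⟨i, j⟩) =
      blk (fun i => k (σ.symm i)) ((σ.symm.sum_comp k).trans h)
        ⟨σ i, Fin.cast (by rw [σ.symm_apply_apply]) (τ i j)⟩ := by
  simp only [blockPerm, Equiv.trans_apply, Equiv.symm_apply_apply]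
  rfl

theorem blockPerm_symm_blk {n N : ℕ} (k : Fin n → ℕ) (h : ∑ i, k i = N)
    (σ : Equiv.Perm (Fin n)) (τ : ∀ i, Equiv.Perm (Fin (k i))) (h' : ∑ i, k (σ.symm i) = N)
    (i : Fin n) (j : Fin (k (σ.symm i))) :
    (blockPerm k h σ τ).symm (blk (fun i => k (σ.symm i)) h' ⟨i, j⟩) =
      blk k h ⟨σ.symm i, (τ (σ.symm i)).symm j⟩ := by
  rw [Equiv.symm_apply_eq, blockPerm_blk]
  exact blk_congr (fun _ => rfl) _ _ (σ.apply_symm_apply i).symm (by simp)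

theorem blockPerm_mul {n N : ℕ} (k : Fin n → ℕ) (h : ∑ i, k i = N) (σ σ' : Equiv.Perm (Fin n))
    (τ : ∀ i, Equiv.Perm (Fin (k i))) (h' : ∑ i, k (σ' i) = N)
    (τ' : ∀ i, Equiv.Perm (Fin (k (σ' i)))) :
    blockPerm k h σ τ * blockPerm (fun i => k (σ' i)) h' σ' τ' =
      blockPerm (fun i => k (σ' i)) h' (σ * σ') (fun i => τ (σ' i) * τ' i) := by
  ext x
  obtain ⟨⟨i, j⟩, rfl⟩ := (blk (fun i => k (σ' i)) h').surjective x
  rw [Equiv.Perm.mul_apply, blockPerm_blk, blockPerm_blk]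
  have : blk (fun i => k (σ' (σ'.symm i))) ((σ'.symm.sum_comp fun i => k (σ' i)).trans h')
      ⟨σ' i, Fin.cast (by simp) (τ' i j)⟩ = blk k h ⟨σ' i, τ' i j⟩ :=
    blk_congr (fun i => by simp) _ _ rfl rfl
  rw [this, blockPerm_blk]
  congr 1
  exact blk_congr (fun i => by simp [Equiv.Perm.mul_def]) _ _ rfl rfl

theorem blockPerm_assoc {m N : ℕ} (n : Fin m → ℕ) (q : Fin (∑ i, n i) → ℕ) (hq : ∑ l, q l = N)
    (f : Equiv.Perm (Fin m)) (g : ∀ i, Equiv.Perm (Fin (n i))) (h : ∀ l, Equiv.Perm (Fin (q l))) :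
    blockPerm q hq (blockPerm n rfl f g) h =
      blockPerm (fun i => ∑ j, q (blk n rfl ⟨i, j⟩)) ((blk_sum n rfl q).trans hq) f
        (fun i => blockPerm (fun j => q (blk n rfl ⟨i, j⟩)) rfl (g i)
          (fun j => h (blk n rfl ⟨i, j⟩))) := by
  ext x
  obtain ⟨⟨a, l⟩, rfl⟩ := (blk q hq).surjective x
  obtain ⟨⟨i, j⟩, rfl⟩ := (blk n rfl).surjective a
  rw [blockPerm_blk, blk_blk n rfl q hq i j l, blockPerm_blk (fun i => ∑ j, q (blk n rfl ⟨i, j⟩)),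
    blockPerm_blk (fun j => q (blk n rfl ⟨i, j⟩))]
  have hn : ∑ i, n (f.symm i) = ∑ i, n i := f.symm.sum_comp n
  have e := blockPerm_blk n rfl f g i j
  have hq' : q (blk n rfl ⟨i, j⟩) = q ((blockPerm n rfl f g).symm
      (blk (fun i => n (f.symm i)) hn ⟨f i, Fin.cast (by simp) (g i j)⟩)) := by
    rw [← e, Equiv.symm_apply_apply]
  refine (congrArg Fin.val ((blk_congr (fun _ => rfl) _ _ e
    (j' := Fin.cast hq' (h _ l)) rfl).trans
    (blk_blk (fun i => n (f.symm i)) hn (fun a => q ((blockPerm n rfl f g).symm a))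
      (((blockPerm n rfl f g).symm.sum_comp q).trans hq) _ _ _))).trans ?_
  congr 1
  have hs : ∀ (i : Fin m) (j : Fin (n (f.symm i))),
      q ((blockPerm n rfl f g).symm (blk (fun i => n (f.symm i)) hn ⟨i, j⟩)) =
        q (blk n rfl ⟨f.symm i, (g (f.symm i)).symm j⟩) := fun i j => by
    rw [blockPerm_symm_blk]
  refine blk_congr (fun i => ?_) _ _ rfl ?_
  · simp only [hs]
    exact (g (f.symm i)).symm.sum_comp fun j => q (blk n rfl ⟨f.symm i, j⟩)
  · rw [Fin.val_cast]
    have hni : n (f.symm (f i)) = n i := by rw [f.symm_apply_apply]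
    refine blk_val_congr hni (fun b => ?_) _ _ rfl rfl
    rw [hs]
    exact congrArg q (blk_congr (fun _ => rfl) _ _ (f.symm_apply_apply i) (by
      have : ∀ i' (hi : i' = i), (((g i').symm (Fin.cast (hni.trans (by rw [hi])) b) : Fin (n i')) : ℕ) =
          (g i).symm (Fin.cast hni b) := by
        rintro _ rfl; rfl
      exact this _ (f.symm_apply_apply i)))

/-! ### Action operads -/

/-- An action operad: an operad of sets whose sets of operations are groups, with a map `π` to the
operad of symmetric groups that consists of group homomorphisms.  The composition takes the
sum `N` of the arities together with the proof that it is the sum, so that no casts are needed. -/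
structure ActionOperad where
  carrier : ℕ → Type u
  [group : ∀ n, Group (carrier n)]
  π : ∀ n, carrier n →* Equiv.Perm (Fin n)
  unit : carrier 1
  μ : ∀ {n N : ℕ} (k : Fin n → ℕ), ∑ i, k i = N → carrier n → (∀ i, carrier (k i)) → carrier N
  unit_μ : ∀ {n : ℕ} (g : carrier n), μ (fun _ : Fin 1 => n) (by simp) unit (fun _ => g) = g
  μ_unit : ∀ {n : ℕ} (g : carrier n), μ (fun _ : Fin n => 1) (by simp) g (fun _ => unit) = g
  μ_assoc : ∀ {m N : ℕ} (n : Fin m → ℕ) (q : Fin (∑ i, n i) → ℕ) (hq : ∑ l, q l = N)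
    (f : carrier m) (g : ∀ i, carrier (n i)) (h : ∀ l, carrier (q l)),
    μ q hq (μ n rfl f g) h =
      μ (fun i => ∑ j, q (blk n rfl ⟨i, j⟩)) ((blk_sum n rfl q).trans hq) f
        (fun i => μ (fun j => q (blk n rfl ⟨i, j⟩)) rfl (g i) (fun j => h (blk n rfl ⟨i, j⟩)))
  π_μ : ∀ {n N : ℕ} (k : Fin n → ℕ) (h : ∑ i, k i = N) (g : carrier n) (f : ∀ i, carrier (k i)),
    π N (μ k h g f) = blockPerm k h (π n g) (fun i => π (k i) (f i))
  μ_mul_μ : ∀ {n N : ℕ} (k : Fin n → ℕ) (h : ∑ i, k i = N) (g g' : carrier n)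
    (f : ∀ i, carrier (k i)) (h' : ∑ i, k (π n g' i) = N) (f' : ∀ i, carrier (k (π n g' i))),
    μ k h g f * μ (fun i => k (π n g' i)) h' g' f' =
      μ (fun i => k (π n g' i)) h' (g * g') (fun i => f (π n g' i) * f' i)

attribute [instance] ActionOperad.group

namespace ActionOperad

@[ext]
structure Hom (Λ Λ' : ActionOperad.{u}) where
  app : ∀ n, Λ.carrier n →* Λ'.carrier n
  app_π : ∀ n (g : Λ.carrier n), Λ'.π n (app n g) = Λ.π n g
  app_unit : app 1 Λ.unit = Λ'.unit
  app_μ : ∀ {n N : ℕ} (k : Fin n → ℕ) (h : ∑ i, k i = N) (g : Λ.carrier n)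
    (f : ∀ i, Λ.carrier (k i)),
    app N (Λ.μ k h g f) = Λ'.μ k h (app n g) (fun i => app (k i) (f i))

instance : Category ActionOperad.{u} where
  Hom := Hom
  id Λ := ⟨fun n => MonoidHom.id _, fun _ _ => rfl, rfl, fun _ _ _ _ => rfl⟩
  comp F G := ⟨fun n => (G.app n).comp (F.app n),
    fun n g => (G.app_π n _).trans (F.app_π n g),
    (congrArg (G.app 1) F.app_unit).trans G.app_unit,
    fun k h g f => (congrArg (G.app _) (F.app_μ k h g f)).trans (G.app_μ k h _ _)⟩

/-- The symmetric groups (in an arbitrary universe). -/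
def symmetric : ActionOperad.{u} where
  carrier n := ULift.{u} (Equiv.Perm (Fin n))
  π n := MulEquiv.ulift.toMonoidHom
  unit := 1
  μ k h g f := ⟨blockPerm k h g.down (fun i => (f i).down)⟩
  unit_μ {n} g := by
    apply ULift.ext
    ext x
    obtain ⟨⟨i, j⟩, rfl⟩ := (blk (fun _ : Fin 1 => n) (by simp)).surjective x
    rw [blockPerm_blk, blk_one, blk_one]
    rfl
  μ_unit {n} g := by
    apply ULift.ext
    ext x
    obtain ⟨⟨i, j⟩, rfl⟩ := (blk (fun _ : Fin n => 1) (by simp)).surjective x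
    rw [blockPerm_blk, blk_ones, blk_ones]
  μ_assoc {m N} n q hq f g h := by
    apply ULift.ext
    exact blockPerm_assoc n q hq _ _ _
  π_μ k h g f := rfl
  μ_mul_μ k h g g' f h' f' := by
    apply ULift.ext
    exact blockPerm_mul k h _ _ _ h' _

end ActionOperad

/-! ### Collections over the symmetric groups, and free action operads -/

/-- A collection over the disjoint union of the symmetric groups. -/
structure SymColl where
  carrier : Type u
  toSym : carrier → Σ n, Equiv.Perm (Fin n)

namespace SymColl

def arity (G : SymColl.{u}) (x : G.carrier) : ℕ := (G.toSym x).1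

def perm (G : SymColl.{u}) (x : G.carrier) : Equiv.Perm (Fin (G.arity x)) := (G.toSym x).2

/-- Maps from `G` to the underlying collection of `Λ`. -/
structure HomTo (G : SymColl.{u}) (Λ : ActionOperad.{u}) where
  app : ∀ x, Λ.carrier (G.arity x)
  app_π : ∀ x, Λ.π _ (app x) = G.perm x

end SymColl

/-- Formal composites of the elements of `G`, built with the operations of an action operad. The
block sum of `t₁, …, tₙ` is `op (one n) (t₁, …, tₙ)`, and `op (gen x) (one k₁, …, one kₙ)` is the
generator `x` acting on blocks. -/
inductive FormalComposite (G : SymColl.{u}) : ℕ → Type u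
  | gen (x : G.carrier) : FormalComposite G (G.arity x)
  | unit : FormalComposite G 1
  | one (n : ℕ) : FormalComposite G n
  | mul {n : ℕ} (t t' : FormalComposite G n) : FormalComposite G n
  | inv {n : ℕ} (t : FormalComposite G n) : FormalComposite G n
  | op {n N : ℕ} (k : Fin n → ℕ) (h : ∑ i, k i = N) (t : FormalComposite G n)
      (ts : ∀ i, FormalComposite G (k i)) : FormalComposite G N

namespace FormalComposite

variable {G : SymColl.{u}}

/-- The underlying permutation of a formal composite. -/
def perm : ∀ {n : ℕ}, FormalComposite G n → Equiv.Perm (Fin n)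
  | _, gen x => G.perm x
  | _, unit => 1
  | _, one _ => 1
  | _, mul t t' => t.perm * t'.perm
  | _, inv t => t.perm⁻¹
  | _, op k h t ts => blockPerm k h t.perm (fun i => (ts i).perm)

/-- The value of a formal composite in an action operad. -/
def eval {Λ : ActionOperad.{u}} (φ : G.HomTo Λ) : ∀ {n : ℕ}, FormalComposite G n → Λ.carrier n
  | _, gen x => φ.app x
  | _, unit => Λ.unit
  | _, one _ => 1
  | _, mul t t' => t.eval φ * t'.eval φ
  | _, inv t => (t.eval φ)⁻¹
  | _, op k h t ts => Λ.μ k h (t.eval φ) (fun i => (ts i).eval φ)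

theorem π_eval {Λ : ActionOperad.{u}} (φ : G.HomTo Λ) {n : ℕ} (t : FormalComposite G n) :
    Λ.π n (t.eval φ) = t.perm := by
  induction t with
  | gen x => exact φ.app_π x
  | unit => exact Subsingleton.elim _ _
  | one n => exact map_one _
  | mul t t' h h' => exact (map_mul _ _ _).trans (congrArg₂ _ h h')
  | inv t h => exact (map_inv _ _).trans (congrArg _ h)
  | op k h t ts ih ihs =>
    refine (Λ.π_μ k h _ _).trans ?_
    rw [ih]
    exact congrArg _ (funext ihs)

/-- Two formal composites are identified when they have the same value in every action operad,
for every interpretation of the generators. -/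
def setoid (G : SymColl.{u}) (n : ℕ) : Setoid (FormalComposite G n) where
  r t t' := ∀ (Λ : ActionOperad.{u}) (φ : G.HomTo Λ), t.eval φ = t'.eval φ
  iseqv := ⟨fun _ _ _ => rfl, fun h Λ φ => (h Λ φ).symm, fun h h' Λ φ => (h Λ φ).trans (h' Λ φ)⟩

theorem perm_eq_of_rel {n : ℕ} {t t' : FormalComposite G n} (h : (setoid G n).r t t') :
    t.perm = t'.perm := by
  let φ : G.HomTo ActionOperad.symmetric.{u} := ⟨fun x => ⟨G.perm x⟩, fun _ => rfl⟩
  rw [← π_eval φ t, h _ φ, π_eval φ t']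

/-- The free action operad on `G` in arity `n`. -/
def FreeCarrier (G : SymColl.{u}) (n : ℕ) : Type u := Quotient (setoid G n)

/-- The element of the free action operad given by a formal composite. -/
def toFree {n : ℕ} (t : FormalComposite G n) : FreeCarrier G n := Quotient.mk (setoid G n) t

theorem toFree_eq_iff {n : ℕ} {t t' : FormalComposite G n} :
    t.toFree = t'.toFree ↔ ∀ (Λ : ActionOperad.{u}) (φ : G.HomTo Λ), t.eval φ = t'.eval φ :=
  ⟨fun h => Quotient.exact h, fun h => Quotient.sound (s := setoid G n) h⟩

theorem toFree_surjective {n : ℕ} (a : FreeCarrier G n) : ∃ t : FormalComposite G n, t.toFree = a :=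
  Quotient.exists_rep a

theorem exists_family {n : ℕ} {k : Fin n → ℕ} (a : ∀ i, FreeCarrier G (k i)) :
    ∃ t : ∀ i, FormalComposite G (k i), a = fun i => (t i).toFree := by
  choose t ht using fun i => toFree_surjective (a i)
  exact ⟨t, funext fun i => (ht i).symm⟩

instance (n : ℕ) : Mul (FreeCarrier G n) :=
  ⟨Quotient.map₂ mul fun _ _ h _ _ h' Λ φ => congrArg₂ (· * ·) (h Λ φ) (h' Λ φ)⟩

instance (n : ℕ) : One (FreeCarrier G n) := ⟨(one n).toFree⟩

instance (n : ℕ) : Inv (FreeCarrier G n) :=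
  ⟨Quotient.map inv fun _ _ h Λ φ => congrArg (·⁻¹) (h Λ φ)⟩

theorem toFree_mul {n : ℕ} (t t' : FormalComposite G n) : t.toFree * t'.toFree = (mul t t').toFree := rfl

theorem toFree_inv {n : ℕ} (t : FormalComposite G n) : (t.toFree)⁻¹ = (inv t).toFree := rfl

instance (n : ℕ) : Group (FreeCarrier G n) :=
  Group.ofLeftAxioms
    (fun a b c => by
      obtain ⟨a, rfl⟩ := toFree_surjective a
      obtain ⟨b, rfl⟩ := toFree_surjective b
      obtain ⟨c, rfl⟩ := toFree_surjective c
      exact toFree_eq_iff.2 fun Λ φ => mul_assoc _ _ _)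
    (fun a => by
      obtain ⟨a, rfl⟩ := toFree_surjective a
      exact toFree_eq_iff.2 fun Λ φ => one_mul _)
    (fun a => by
      obtain ⟨a, rfl⟩ := toFree_surjective a
      exact toFree_eq_iff.2 fun Λ φ => inv_mul_cancel _)

noncomputable def freeμ {n N : ℕ} (k : Fin n → ℕ) (h : ∑ i, k i = N) (g : FreeCarrier G n)
    (f : ∀ i, FreeCarrier G (k i)) : FreeCarrier G N :=
  (op k h g.out (fun i => (f i).out)).toFree

theorem freeμ_toFree {n N : ℕ} (k : Fin n → ℕ) (h : ∑ i, k i = N) (t : FormalComposite G n)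
    (ts : ∀ i, FormalComposite G (k i)) :
    freeμ k h t.toFree (fun i => (ts i).toFree) = (op k h t ts).toFree := by
  refine toFree_eq_iff.2 fun Λ φ => ?_
  simp only [eval]
  have e : ∀ {n : ℕ} (t : FormalComposite G n), (Quotient.out t.toFree).eval φ = t.eval φ :=
    fun t => toFree_eq_iff.1 (Quotient.out_eq t.toFree) Λ φ
  simp only [e]

def freeπ (G : SymColl.{u}) (n : ℕ) : FreeCarrier G n →* Equiv.Perm (Fin n) where
  toFun := Quotient.lift perm fun _ _ h => perm_eq_of_rel h
  map_one' := rfl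
  map_mul' a b := by
    obtain ⟨a, rfl⟩ := toFree_surjective a
    obtain ⟨b, rfl⟩ := toFree_surjective b
    rfl

theorem freeπ_toFree {n : ℕ} (t : FormalComposite G n) : freeπ G n t.toFree = t.perm := rfl

end FormalComposite

/-- The free action operad on a collection over the symmetric groups: formal composites modulo the
identities that hold in all action operads. -/
noncomputable def ActionOperad.free (G : SymColl.{u}) : ActionOperad.{u} where
  carrier := FormalComposite.FreeCarrier G
  π := FormalComposite.freeπ G
  unit := FormalComposite.unit.toFree
  μ := FormalComposite.freeμ
  unit_μ g := by
    obtain ⟨t, rfl⟩ := FormalComposite.toFree_surjective g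
    rw [FormalComposite.freeμ_toFree]
    exact FormalComposite.toFree_eq_iff.2 fun Λ φ => Λ.unit_μ _
  μ_unit g := by
    obtain ⟨t, rfl⟩ := FormalComposite.toFree_surjective g
    rw [FormalComposite.freeμ_toFree]
    exact FormalComposite.toFree_eq_iff.2 fun Λ φ => Λ.μ_unit _
  μ_assoc n q hq f g h := by
    obtain ⟨f, rfl⟩ := FormalComposite.toFree_surjective f
    obtain ⟨g, rfl⟩ := FormalComposite.exists_family g
    obtain ⟨h, rfl⟩ := FormalComposite.exists_family h
    simp only [FormalComposite.freeμ_toFree]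
    exact FormalComposite.toFree_eq_iff.2 fun Λ φ => Λ.μ_assoc _ _ _ _ _ _
  π_μ k h g f := by
    obtain ⟨g, rfl⟩ := FormalComposite.toFree_surjective g
    obtain ⟨f, rfl⟩ := FormalComposite.exists_family f
    rw [FormalComposite.freeμ_toFree]
    rfl
  μ_mul_μ k h g g' f h' f' := by
    obtain ⟨g, rfl⟩ := FormalComposite.toFree_surjective g
    obtain ⟨g', rfl⟩ := FormalComposite.toFree_surjective g'
    obtain ⟨f, rfl⟩ := FormalComposite.exists_family f
    obtain ⟨f', rfl⟩ := FormalComposite.exists_family f'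
    rw [FormalComposite.freeμ_toFree, FormalComposite.freeμ_toFree]
    simp only [FormalComposite.toFree_mul]
    rw [FormalComposite.freeμ_toFree]
    refine FormalComposite.toFree_eq_iff.2 fun Λ φ => ?_
    have aux : ∀ (σ : Equiv.Perm _) (_ : Λ.π _ (g'.eval φ) = σ) (h' : ∑ i, k (σ i) = _)
        (f' : ∀ i, FormalComposite G (k (σ i))),
        Λ.μ k h (g.eval φ) (fun i => (f i).eval φ) *
            Λ.μ (fun i => k (σ i)) h' (g'.eval φ) (fun i => (f' i).eval φ) =
          Λ.μ (fun i => k (σ i)) h' (g.eval φ * g'.eval φ)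
            (fun i => (f (σ i)).eval φ * (f' i).eval φ) := by
      rintro _ rfl h' f'
      exact Λ.μ_mul_μ _ _ _ _ _ _ _
    exact aux _ (FormalComposite.π_eval φ g') h' f'

/-- The universal map out of the free action operad that extends `φ`. -/
def ActionOperad.free.lift {G : SymColl.{u}} {Λ : ActionOperad.{u}} (φ : G.HomTo Λ) :
    ActionOperad.free G ⟶ Λ where
  app n :=
    { toFun := Quotient.lift (fun t => t.eval φ) fun _ _ h => h Λ φ
      map_one' := rfl
      map_mul' := fun a b => by
        obtain ⟨a, rfl⟩ := FormalComposite.toFree_surjective a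
        obtain ⟨b, rfl⟩ := FormalComposite.toFree_surjective b
        rfl }
  app_π n g := by
    obtain ⟨t, rfl⟩ := FormalComposite.toFree_surjective g
    exact FormalComposite.π_eval φ t
  app_unit := rfl
  app_μ k h g f := by
    obtain ⟨g, rfl⟩ := FormalComposite.toFree_surjective g
    obtain ⟨f, rfl⟩ := FormalComposite.exists_family f
    exact congrArg _ (FormalComposite.freeμ_toFree k h g f)

/-- The free action operad is free: maps of action operads `free G ⟶ Λ` are the same as maps from
`G` to the underlying collection of `Λ`. -/
theorem ActionOperad.free_universal (G : SymColl.{u}) (Λ : ActionOperad.{u}) (φ : G.HomTo Λ) :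
    ∃! F : ActionOperad.free G ⟶ Λ,
      ∀ x, F.app _ (FormalComposite.gen x).toFree = φ.app x := by
  refine ⟨ActionOperad.free.lift φ, fun x => rfl, fun F hF => ?_⟩
  refine ActionOperad.Hom.ext (funext fun n => MonoidHom.ext fun a => ?_)
  obtain ⟨t, rfl⟩ := FormalComposite.toFree_surjective a
  change F.app n t.toFree = t.eval φ
  induction t with
  | gen x => exact hF x
  | unit => exact F.app_unit
  | one n => exact map_one (F.app n)
  | mul t t' h h' => exact (map_mul (F.app _) t.toFree t'.toFree).trans (congrArg₂ _ h h')
  | inv t h => exact (map_inv (F.app _) t.toFree).trans (congrArg _ h)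
  | op k h t ts ih ihs =>
    rw [← FormalComposite.freeμ_toFree]
    refine (F.app_μ k h t.toFree (fun i => (ts i).toFree)).trans ?_
    rw [ih]
    exact congrArg _ (funext ihs)


/-- A presentation of an action operad: a coequalizer of maps between free action operads. -/
structure Presentation (Λ : ActionOperad.{u}) where
  gens : SymColl.{u}
  rels : SymColl.{u}
  s₁ : ActionOperad.free rels ⟶ ActionOperad.free gens
  s₂ : ActionOperad.free rels ⟶ ActionOperad.free gens
  p : ActionOperad.free gens ⟶ Λ
  w : s₁ ≫ p = s₂ ≫ p
  isColimit : IsColimit (Cofork.ofπ p w)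

/-- The equations `s₁ y = s₂ y`, as equations between formal composites of generators: one has
`P.Eqn t₁ t₂` if, for some `y`, the formal composites `t₁` and `t₂` represent `s₁ y` and `s₂ y`. -/
inductive Presentation.Eqn {Λ : ActionOperad.{u}} (P : Presentation Λ) :
    ∀ {n : ℕ}, FormalComposite P.gens n → FormalComposite P.gens n → Prop
  | intro (y : P.rels.carrier) (t₁ t₂ : FormalComposite P.gens (P.rels.arity y))
      (h₁ : t₁.toFree = P.s₁.app _ (FormalComposite.gen y).toFree)
      (h₂ : t₂.toFree = P.s₂.app _ (FormalComposite.gen y).toFree) : P.Eqn t₁ t₂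

/-! ### Clubs -/

/-- Families of morphisms `x i ⟶ y (σ i)`. -/
abbrev Fam {X : Type w} [Category.{v} X] {m n : ℕ} (σ : Fin m ≃ Fin n) (x : Fin m → X)
    (y : Fin n → X) : Type v :=
  ∀ i j, σ i = j → (x i ⟶ y j)

/-- The family of identities, for `x` and `y` such that `x i = y (σ i)`. -/
def Fam.ofEq {X : Type w} [Category.{v} X] {m n : ℕ} {σ : Fin m ≃ Fin n} {x : Fin m → X}
    {y : Fin n → X} (h : ∀ i j, σ i = j → x i = y j) : Fam σ x y :=
  fun i j e => eqToHom (h i j e)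

/-- A family of morphisms `x i ⟶ y i`, for `σ` the identity. -/
def Fam.ofHoms {X : Type w} [Category.{v} X] {n : ℕ} {σ : Fin n ≃ Fin n} {x y : Fin n → X}
    (hσ : σ = Equiv.refl _) (f : ∀ i, x i ⟶ y i) : Fam σ x y :=
  fun i j e => f i ≫ eqToHom (by rw [← e, hσ]; rfl)

/-- A club over the category `P` whose objects are the natural numbers and whose morphisms
`m ⟶ n` are the bijections `Fin m ≃ Fin n`: a category `K` over `P` (given by `arity` and `perm`)
which is a monoid for the composition product `K ∘ K`.  An object of `K ∘ K` is an object `x` of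
`K` with a family of `arity x` objects of `K`, and a morphism `(x; y) ⟶ (x'; y')` is a morphism
`f : x ⟶ x'` with morphisms `y i ⟶ y' (perm f i)`.  The multiplication `K ∘ K ⥤ K` is given by
`subst` and `substHom`, the unit `1 ⥤ K` by `one`. Morphisms whose (co)domains are only
propositionally equal are compared as arrows. -/
structure Club where
  Obj : Type w
  [cat : Category.{v} Obj]
  arity : Obj → ℕ
  perm : ∀ {x y : Obj}, (x ⟶ y) → (Fin (arity x) ≃ Fin (arity y))
  perm_id : ∀ x : Obj, perm (𝟙 x) = Equiv.refl _
  perm_comp : ∀ {x y z : Obj} (f : x ⟶ y) (g : y ⟶ z), perm (f ≫ g) = (perm f).trans (perm g)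
  one : Obj
  arity_one : arity one = 1
  subst : ∀ x : Obj, (Fin (arity x) → Obj) → Obj
  arity_subst : ∀ (x : Obj) (y : Fin (arity x) → Obj), ∑ i, arity (y i) = arity (subst x y)
  substHom : ∀ {x x' : Obj} {y : Fin (arity x) → Obj} {y' : Fin (arity x') → Obj} (f : x ⟶ x'),
    Fam (perm f) y y' → (subst x y ⟶ subst x' y')
  substHom_id : ∀ (x : Obj) (y : Fin (arity x) → Obj),
    substHom (𝟙 x) (Fam.ofEq (x := y) (y := y) (by rw [perm_id]; rintro i j rfl; rfl)) =
      𝟙 (subst x y)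
  substHom_comp : ∀ {x x' x'' : Obj} {y : Fin (arity x) → Obj} {y' : Fin (arity x') → Obj}
    {y'' : Fin (arity x'') → Obj} (f : x ⟶ x') (f' : x' ⟶ x'') (g : Fam (perm f) y y')
    (g' : Fam (perm f') y' y''),
    substHom f g ≫ substHom f' g' =
      substHom (f ≫ f') (fun i j h => g i _ rfl ≫ g' _ j (by rw [← h, perm_comp]; rfl))
  perm_substHom : ∀ {x x' : Obj} {y : Fin (arity x) → Obj} {y' : Fin (arity x') → Obj} (f : x ⟶ x')
    (g : Fam (perm f) y y') (i : Fin (arity x)) (j : Fin (arity (y i))),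
    perm (substHom f g) (blk (fun i => arity (y i)) (arity_subst x y) ⟨i, j⟩) =
      blk (fun i => arity (y' i)) (arity_subst x' y') ⟨perm f i, perm (g i _ rfl) j⟩
  one_subst : ∀ x : Obj, subst one (fun _ => x) = x
  one_substHom : ∀ {x y : Obj} (f : x ⟶ y),
    Arrow.mk (substHom (𝟙 one) (fun _ _ _ => f) :
      subst one (fun _ => x) ⟶ subst one (fun _ => y)) = Arrow.mk f
  subst_one : ∀ x : Obj, subst x (fun _ => one) = x
  substHom_one : ∀ {x y : Obj} (f : x ⟶ y),
    Arrow.mk (substHom f (fun _ _ _ => 𝟙 one) :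
      subst x (fun _ => one) ⟶ subst y (fun _ => one)) = Arrow.mk f
  subst_assoc : ∀ (x : Obj) (y : Fin (arity x) → Obj) (z : Fin (arity (subst x y)) → Obj),
    subst (subst x y) z = subst x (fun i => subst (y i)
      (fun j => z (blk (fun i => arity (y i)) (arity_subst x y) ⟨i, j⟩)))
  substHom_assoc : ∀ {x x' : Obj} {y : Fin (arity x) → Obj} {y' : Fin (arity x') → Obj}
    {z : Fin (arity (subst x y)) → Obj} {z' : Fin (arity (subst x' y')) → Obj} (f : x ⟶ x')
    (g : Fam (perm f) y y') (h : Fam (perm (substHom f g)) z z'),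
    Arrow.mk (substHom (substHom f g) h) =
      Arrow.mk (substHom f (fun i i' hi => substHom (g i i' hi) (fun j j' hj =>
        h (blk (fun i => arity (y i)) (arity_subst x y) ⟨i, j⟩)
          (blk (fun i => arity (y' i)) (arity_subst x' y') ⟨i', j'⟩)
          (by subst hi hj; exact perm_substHom f g i j))) :
        subst x (fun i => subst (y i)
            (fun j => z (blk (fun i => arity (y i)) (arity_subst x y) ⟨i, j⟩))) ⟶
          subst x' (fun i => subst (y' i)
            (fun j => z' (blk (fun i => arity (y' i)) (arity_subst x' y') ⟨i, j⟩))))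

attribute [instance] Club.cat

/-- Maps of clubs: functors over `P` that preserve the multiplication and the unit. -/
@[ext]
structure Club.Hom (K : Club.{w, v}) (L : Club.{w', v'}) where
  functor : K.Obj ⥤ L.Obj
  arity_obj : ∀ x, L.arity (functor.obj x) = K.arity x
  perm_map : ∀ {x y : K.Obj} (f : x ⟶ y) (i : Fin (L.arity (functor.obj x))),
    Fin.cast (arity_obj y) (L.perm (functor.map f) i) = K.perm f (Fin.cast (arity_obj x) i)
  obj_one : functor.obj K.one = L.one
  obj_subst : ∀ (x : K.Obj) (y : Fin (K.arity x) → K.Obj),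
    functor.obj (K.subst x y) =
      L.subst (functor.obj x) (fun i => functor.obj (y (Fin.cast (arity_obj x) i)))
  map_substHom : ∀ {x x' : K.Obj} {y : Fin (K.arity x) → K.Obj} {y' : Fin (K.arity x') → K.Obj}
    (f : x ⟶ x') (g : Fam (K.perm f) y y'),
    Arrow.mk (functor.map (K.substHom f g)) =
      Arrow.mk (L.substHom (functor.map f) (fun i j h => functor.map
          (g (Fin.cast (arity_obj x) i) (Fin.cast (arity_obj x') j) (by rw [← h, perm_map]))) :
        L.subst (functor.obj x) (fun i => functor.obj (y (Fin.cast (arity_obj x) i))) ⟶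
          L.subst (functor.obj x') (fun i => functor.obj (y' (Fin.cast (arity_obj x') i))))

namespace ActionOperad

variable (Λ : ActionOperad.{u})

/-- Morphisms `m ⟶ n` of the category `BΛ`: elements of `Λ n` if `m = n`, none otherwise. -/
structure BHom (m n : ℕ) : Type u where
  eq : m = n
  elt : Λ.carrier m

def BHom.id (n : ℕ) : Λ.BHom n n := ⟨rfl, 1⟩

variable {Λ} in
def BHom.comp {m n k : ℕ} (f : Λ.BHom m n) (g : Λ.BHom n k) : Λ.BHom m k :=
  ⟨f.eq.trans g.eq, cast (congrArg Λ.carrier f.eq.symm) g.elt * f.elt⟩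

variable {Λ} in
theorem BHom.id_comp {m n : ℕ} (f : Λ.BHom m n) : (BHom.id Λ m).comp f = f := by
  obtain ⟨rfl, f⟩ := f
  exact congrArg (BHom.mk rfl) (mul_one f)

variable {Λ} in
theorem BHom.comp_id {m n : ℕ} (f : Λ.BHom m n) : f.comp (BHom.id Λ n) = f := by
  obtain ⟨rfl, f⟩ := f
  exact congrArg (BHom.mk rfl) (one_mul f)

variable {Λ} in
theorem BHom.assoc {m n k l : ℕ} (f : Λ.BHom m n) (g : Λ.BHom n k) (h : Λ.BHom k l) :
    (f.comp g).comp h = f.comp (g.comp h) := by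
  obtain ⟨rfl, f⟩ := f
  obtain ⟨rfl, g⟩ := g
  obtain ⟨rfl, h⟩ := h
  exact congrArg (BHom.mk rfl) (mul_assoc h g f).symm

/-- The objects of `BΛ` are the natural numbers. -/
def BObj (_ : ActionOperad.{u}) : Type := ℕ

/-- Composition in `BΛ` is the multiplication of the groups `Λ n`. -/
instance : Category.{u} Λ.BObj where
  Hom m n := Λ.BHom m n
  id n := BHom.id Λ n
  comp f g := BHom.comp f g
  id_comp f := BHom.id_comp f
  comp_id f := BHom.comp_id f
  assoc f g h := BHom.assoc f g h

/-- The action of a morphism of `BΛ` on the places. -/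
def BHom.perm {Λ : ActionOperad.{u}} {m n : ℕ} (f : Λ.BHom m n) : Fin m ≃ Fin n :=
  (Λ.π m f.elt).trans (finCongr f.eq)

theorem BHom.sum_eq {Λ : ActionOperad.{u}} {m n : ℕ} {f : Λ.BHom m n} {y : Fin m → ℕ}
    {y' : Fin n → ℕ} (g : ∀ i j, f.perm i = j → Λ.BHom (y i) (y' j)) :
    ∑ i, y i = ∑ j, y' j := by
  rw [← f.perm.sum_comp]
  exact Finset.sum_congr rfl fun i _ => (g i _ rfl).eq

/-- The multiplication of the club `BΛ` on morphisms: the composition of `Λ`. -/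
def BHom.subst {Λ : ActionOperad.{u}} {m n : ℕ} {y : Fin m → ℕ} {y' : Fin n → ℕ}
    (f : Λ.BHom m n) (g : ∀ i j, f.perm i = j → Λ.BHom (y i) (y' j)) :
    Λ.BHom (∑ i, y i) (∑ j, y' j) :=
  ⟨BHom.sum_eq g, Λ.μ y rfl f.elt (fun i => (g i _ rfl).elt)⟩

theorem one_μ_one {n N : ℕ} (k : Fin n → ℕ) (h : ∑ i, k i = N) :
    Λ.μ k h 1 (fun _ => 1) = 1 := by
  have key : ∀ (σ : Equiv.Perm (Fin n)) (hσ : σ = 1) (h' : ∑ i, k (σ i) = N),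
      Λ.μ (fun i => k (σ i)) h' 1 (fun i => 1) = Λ.μ k h 1 (fun i => 1) := by
    rintro _ rfl h'; rfl
  have e := Λ.μ_mul_μ k h 1 1 (fun i => 1) ((Equiv.sum_comp _ k).trans h) (fun i => 1)
  simp only [mul_one] at e
  rw [key _ (map_one _)] at e
  exact mul_eq_left.1 e

theorem unit_eq_one : Λ.unit = 1 := by
  have h := Λ.μ_mul_μ (N := 1) (fun _ : Fin 1 => 1) (by simp) Λ.unit 1 (fun _ => 1) (by simp)
    (fun _ => Λ.unit)
  rw [Λ.unit_μ, Λ.μ_unit] at h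
  have h2 : Λ.μ (fun _ : Fin 1 => 1) (by simp) (Λ.unit * 1) (fun _ => 1 * Λ.unit) = Λ.unit := by
    simp only [mul_one, one_mul]
    exact Λ.unit_μ _
  exact (h.trans h2).symm.trans (one_mul 1)


variable {Λ} in
/-- Equality of morphisms of `BΛ` whose (co)domains are only propositionally equal. -/
theorem BHom.arrow_ext {m n m' n' : ℕ} (f : Λ.BHom m n) (f' : Λ.BHom m' n') (h : m = m')
    (e : f.elt = cast (congrArg Λ.carrier h.symm) f'.elt) :
    Arrow.mk (show (show Λ.BObj from m) ⟶ (show Λ.BObj from n) from f) =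
      Arrow.mk (show (show Λ.BObj from m') ⟶ (show Λ.BObj from n') from f') := by
  subst h
  obtain ⟨rfl, f⟩ := f
  obtain ⟨rfl, f'⟩ := f'
  obtain rfl : f = f' := e
  rfl

theorem μ_cast {n N N' : ℕ} (e : N' = N) (k : Fin n → ℕ) (h : ∑ i, k i = N) (h' : ∑ i, k i = N')
    (g : Λ.carrier n) (f : ∀ i, Λ.carrier (k i)) :
    Λ.μ k h g f = cast (congrArg Λ.carrier e) (Λ.μ k h' g f) := by
  subst e
  rfl

theorem sum_fin_one (n : ℕ) : ∑ _ : Fin 1, n = n := by simp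

theorem sum_fin_ones (n : ℕ) : ∑ _ : Fin n, 1 = n := by simp

namespace BHom

variable {Λ}

theorem perm_id (n : ℕ) : (BHom.id Λ n).perm = Equiv.refl _ := by
  ext i
  change ((Λ.π n 1 i : Fin n) : ℕ) = i
  rw [map_one]
  rfl

theorem perm_comp {m n k : ℕ} (f : Λ.BHom m n) (g : Λ.BHom n k) :
    (f.comp g).perm = f.perm.trans g.perm := by
  obtain ⟨rfl, f⟩ := f
  obtain ⟨rfl, g⟩ := g
  ext i
  change ((Λ.π m (g * f) i : Fin m) : ℕ) = Λ.π m g (Λ.π m f i)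
  rw [map_mul]
  rfl

theorem elt_eqToHom {m n : ℕ} (h : m = n) :
    BHom.elt (m := m) (n := n) (eqToHom (X := show Λ.BObj from m) (Y := show Λ.BObj from n) h) =
      1 := by
  subst h
  rfl

theorem ext_elt {m n : ℕ} {f g : Λ.BHom m n} (h : f.elt = g.elt) : f = g := by
  obtain ⟨_, f⟩ := f
  obtain ⟨_, g⟩ := g
  obtain rfl : f = g := h
  rfl

theorem subst_id {n : ℕ} {y : Fin n → ℕ}
    (g : ∀ i j, (BHom.id Λ n).perm i = j → Λ.BHom (y i) (y j))
    (hg : ∀ i, (g i _ rfl).elt = 1) : (BHom.id Λ n).subst g = BHom.id Λ (∑ i, y i) := by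
  apply ext_elt
  change Λ.μ y rfl 1 _ = 1
  simp only [hg]
  exact Λ.one_μ_one _ _

theorem subst_comp {m n k : ℕ} {y : Fin m → ℕ} {y' : Fin n → ℕ} {y'' : Fin k → ℕ}
    (f : Λ.BHom m n) (f' : Λ.BHom n k) (g : ∀ i j, f.perm i = j → Λ.BHom (y i) (y' j))
    (g' : ∀ i j, f'.perm i = j → Λ.BHom (y' i) (y'' j))
    (G : ∀ i j, (f.comp f').perm i = j → Λ.BHom (y i) (y'' j))
    (hG : ∀ i j h h', G i j h = (g i _ rfl).comp (g' (f.perm i) j h')) :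
    (f.subst g).comp (f'.subst g') = (f.comp f').subst G := by
  obtain ⟨rfl, f⟩ := f
  obtain ⟨rfl, f'⟩ := f'
  obtain rfl : y = fun i => y' (Λ.π m f i) := funext fun i => (g i _ rfl).eq
  apply ext_elt
  have e1 : ∑ i, y' i = ∑ i, y' (Λ.π m f i) := (Equiv.sum_comp (Λ.π m f) y').symm
  change cast _ (Λ.μ y' rfl f' (fun i => (g' i _ rfl).elt)) * Λ.μ _ rfl f (fun i => (g i _ rfl).elt) =
    Λ.μ _ rfl (f' * f) (fun i => (G i _ rfl).elt)
  rw [← Λ.μ_cast e1 y' e1 rfl]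
  have e2 : ∀ i, (G i _ rfl).elt = (g' (Λ.π m f i) _ rfl).elt * (g i _ rfl).elt := by
    intro i
    have e3 : ∀ j (hj : (⟨rfl, f'⟩ : Λ.BHom m m).perm (Λ.π m f i) = j),
        (g' (Λ.π m f i) j hj).elt = (g' (Λ.π m f i) _ rfl).elt := by
      rintro _ rfl; rfl
    have hh : (⟨rfl, f'⟩ : Λ.BHom m m).perm (Λ.π m f i) = (comp ⟨rfl, f⟩ ⟨rfl, f'⟩ : Λ.BHom m m).perm i := by
      rw [perm_comp]; rfl
    rw [hG i _ rfl hh, ← e3 _ hh]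
    rfl
  simp only [e2]
  exact Λ.μ_mul_μ y' e1 f' f (fun i => (g' i _ rfl).elt) rfl (fun i => (g i _ rfl).elt)

theorem perm_subst {m n : ℕ} {y : Fin m → ℕ} {y' : Fin n → ℕ}
    (f : Λ.BHom m n) (g : ∀ i j, f.perm i = j → Λ.BHom (y i) (y' j)) (i : Fin m) (j : Fin (y i)) :
    (f.subst g).perm (blk y rfl ⟨i, j⟩) = blk y' rfl ⟨f.perm i, (g i _ rfl).perm j⟩ := by
  obtain ⟨rfl, f⟩ := f
  obtain rfl : y = fun i => y' (Λ.π m f i) := funext fun i => (g i _ rfl).eq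
  apply Fin.ext
  change ((Λ.π _ (Λ.μ _ rfl f (fun i => (g i _ rfl).elt)) _ : Fin _) : ℕ) = _
  rw [Λ.π_μ, blockPerm_blk]
  exact blk_val_congr rfl (fun i => by simp) _ _ rfl rfl

theorem one_subst {m n : ℕ} (f : Λ.BHom m n) :
    ((BHom.id Λ 1).subst (fun _ _ _ => f) : Λ.BHom (∑ _ : Fin 1, m) (∑ _ : Fin 1, n)).elt =
      cast (congrArg Λ.carrier (by simp)) f.elt := by
  have e : ∑ _ : Fin 1, m = m := by simp
  change Λ.μ (fun _ : Fin 1 => m) rfl 1 (fun _ => f.elt) = _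
  rw [Λ.μ_cast e.symm (fun _ : Fin 1 => m) rfl e, ← Λ.unit_eq_one, Λ.unit_μ]

theorem subst_one {m n : ℕ} (f : Λ.BHom m n) :
    (f.subst (fun _ _ _ => BHom.id Λ 1) : Λ.BHom (∑ _ : Fin m, 1) (∑ _ : Fin n, 1)).elt =
      cast (congrArg Λ.carrier (by simp)) f.elt := by
  have e : ∑ _ : Fin m, 1 = m := by simp
  change Λ.μ (fun _ : Fin m => 1) rfl f.elt (fun _ => 1) = _
  rw [Λ.μ_cast e.symm (fun _ : Fin m => 1) rfl e, ← Λ.unit_eq_one, Λ.μ_unit]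

theorem subst_assoc {m n : ℕ} {y : Fin m → ℕ} {y' : Fin n → ℕ}
    {z : Fin (∑ i, y i) → ℕ} {z' : Fin (∑ i, y' i) → ℕ} (f : Λ.BHom m n)
    (g : ∀ i j, f.perm i = j → Λ.BHom (y i) (y' j))
    (h : ∀ i j, (f.subst g).perm i = j → Λ.BHom (z i) (z' j))
    (H : ∀ i i' (hi : f.perm i = i') j j', (g i i' hi).perm j = j' →
      Λ.BHom (z (blk y rfl ⟨i, j⟩)) (z' (blk y' rfl ⟨i', j'⟩)))
    (hH : ∀ i i' hi j j' hj hij, H i i' hi j j' hj = h (blk y rfl ⟨i, j⟩) (blk y' rfl ⟨i', j'⟩) hij) :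
    ((f.subst g).subst h).elt = cast (congrArg Λ.carrier (blk_sum _ _ _))
      (f.subst (fun i i' hi => (g i i' hi).subst (H i i' hi))).elt := by
  have e := blk_sum y rfl z
  change Λ.μ z rfl (Λ.μ y rfl f.elt (fun i => (g i _ rfl).elt)) (fun l => (h l _ rfl).elt) =
    cast _ (Λ.μ _ rfl f.elt (fun i => Λ.μ _ rfl (g i _ rfl).elt (fun j => (H i _ rfl j _ rfl).elt)))
  rw [Λ.μ_assoc, Λ.μ_cast e _ _ rfl]
  congr 2
  funext i
  congr 1
  funext j
  have e3 : ∀ l l' (hl : (f.subst g).perm l = l'), (h l l' hl).elt = (h l _ rfl).elt := by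
    rintro l _ rfl; rfl
  rw [hH i _ rfl j _ rfl (perm_subst f g i j)]
  exact (e3 _ _ _).symm

end BHom

/-- The club of the Borel construction of `Λ`: the category `BΛ = ∐ BΛ(n)` over `P`, with
multiplication given by the composition of the operad `Λ`.  Its monad `BΛ ∘ -` on categories is
`X ↦ ∐ EΛ(n) ×_{Λ(n)} Xⁿ`: every object of the latter is a unique class `[e; x₁, …, xₙ]`, and a
morphism `[e; x] ⟶ [e; y]` is an element `g` of `Λ n` with morphisms `x i ⟶ y (π g i)`. -/
def club : Club.{0, u} where
  Obj := Λ.BObj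
  arity n := n
  perm f := BHom.perm f
  perm_id n := BHom.perm_id n
  perm_comp f g := BHom.perm_comp f g
  one := (1 : ℕ)
  arity_one := rfl
  subst := fun (n : ℕ) (k : Fin n → ℕ) => show ℕ from ∑ i, k i
  arity_subst n k := rfl
  substHom f g := BHom.subst f g
  substHom_id n y := BHom.subst_id _ fun _ => BHom.elt_eqToHom _
  substHom_comp f f' g g' := BHom.subst_comp f f' g g' _ fun _ _ _ _ => rfl
  perm_substHom f g i j := BHom.perm_subst f g i j
  one_subst n := sum_fin_one _
  one_substHom f := BHom.arrow_ext _ _ (sum_fin_one _) (BHom.one_subst f)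
  subst_one n := sum_fin_ones n
  substHom_one {m _} f := BHom.arrow_ext _ _ (sum_fin_ones m) (BHom.subst_one f)
  subst_assoc x y z := (blk_sum _ _ _).symm
  substHom_assoc f g h := BHom.arrow_ext _ _ (blk_sum _ _ _).symm
    (BHom.subst_assoc f g h _ fun _ _ _ _ _ _ _ => rfl)

/-- The natural number `n` as an object of the club. -/
def ob (n : ℕ) : Λ.club.Obj := n

variable {Λ} in
/-- An element of `Λ n`, as an endomorphism of `n` in the club. -/
def endo {n : ℕ} (g : Λ.carrier n) : Λ.ob n ⟶ Λ.ob n := BHom.mk rfl g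

variable {Λ} in
theorem perm_endo {n : ℕ} (g : Λ.carrier n) : Λ.club.perm (endo g) = Λ.π n g := rfl

end ActionOperad

/-! ### Iterated products -/

/-- The product `op (x 0) (op (x 1) (⋯ e))` of a finite sequence. -/
def prodFin {M : Type w} (e : M) (op : M → M → M) : ∀ n : ℕ, (Fin n → M) → M
  | 0, _ => e
  | n + 1, x => op (x 0) (prodFin e op n (fun i => x i.succ))

theorem prodFin_cast {M : Type w} (e : M) (op : M → M → M) {m n : ℕ} (h : m = n) (x : Fin n → M) :
    prodFin e op m (fun i => x (Fin.cast h i)) = prodFin e op n x := by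
  subst h
  rfl

theorem prodFin_add {M : Type w} (e : M) (op : M → M → M)
    (assoc : ∀ a b c, op (op a b) c = op a (op b c)) (unit_op : ∀ a, op e a = a) (m n N : ℕ)
    (h : m + n = N) (x : Fin N → M) :
    op (prodFin e op m (fun i => x ⟨i, by omega⟩)) (prodFin e op n (fun i => x ⟨m + i, by omega⟩)) =
      prodFin e op N x := by
  induction m generalizing N with
  | zero =>
    obtain rfl : n = N := by omega
    simp [prodFin, unit_op]
  | succ m ih =>
    obtain ⟨N, rfl⟩ : ∃ N', N = N' + 1 := ⟨m + n, by omega⟩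
    simp only [prodFin, assoc]
    rw [← ih N (by omega) (fun i => x i.succ)]
    congr 3
    funext i
    congr 1
    apply Fin.ext
    simp only [Fin.val_succ]
    omega

theorem blk_succ {n N M : ℕ} (k : Fin (n + 1) → ℕ) (h : ∑ i, k i = N) (h' : ∑ i : Fin n, k i.succ = M)
    (i : Fin n) (j : Fin (k i.succ)) :
    (blk k h ⟨i.succ, j⟩ : ℕ) = k 0 + blk (fun i => k i.succ) h' ⟨i, j⟩ := by
  rw [blk_val, blk_val, Fin.sum_univ_succ]
  simp [add_assoc]

theorem prodFin_blk {M : Type w} (e : M) (op : M → M → M)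
    (assoc : ∀ a b c, op (op a b) c = op a (op b c)) (unit_op : ∀ a, op e a = a) {n N : ℕ}
    (k : Fin n → ℕ) (h : ∑ i, k i = N) (x : Fin N → M) :
    prodFin e op n (fun i => prodFin e op (k i) (fun j => x (blk k h ⟨i, j⟩))) =
      prodFin e op N x := by
  induction n generalizing N with
  | zero =>
    obtain rfl : 0 = N := by simpa using h
    rfl
  | succ n ih =>
    have hN : k 0 + ∑ i : Fin n, k i.succ = N := by rw [← h, Fin.sum_univ_succ]
    rw [← prodFin_add e op assoc unit_op _ _ N hN x, ← ih (fun i => k i.succ) rfl]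
    simp only [prodFin]
    congr 1
    · congr 1
      funext j
      congr 1
      apply Fin.ext
      simp [blk_val]
    · congr 1
      funext i
      congr 1
      funext j
      congr 1
      apply Fin.ext
      exact blk_succ k h rfl i j

/-! ### Strict monoidal objects of a club, with operations -/

namespace Club

/-- A unit object and a tensor product in a club, subject to strict associativity and strict
unit laws. -/
structure Tensor (K : Club.{w, v}) where
  unit : K.Obj
  arity_unit : K.arity unit = 0
  tensor : K.Obj
  arity_tensor : K.arity tensor = 2
  assoc : ∀ a b c : K.Obj,
    K.subst tensor (fun i => ![K.subst tensor (fun i => ![a, b] (Fin.cast arity_tensor i)), c]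
        (Fin.cast arity_tensor i)) =
      K.subst tensor (fun i => ![a, K.subst tensor (fun i => ![b, c] (Fin.cast arity_tensor i))]
        (Fin.cast arity_tensor i))
  unit_tensor : ∀ a : K.Obj,
    K.subst tensor (fun i => ![unit, a] (Fin.cast arity_tensor i)) = a
  tensor_unit : ∀ a : K.Obj,
    K.subst tensor (fun i => ![a, unit] (Fin.cast arity_tensor i)) = a

namespace Tensor

variable {K : Club.{w, v}} (T : K.Tensor)

/-- The tensor product of two objects of a club. -/
def tens (a b : K.Obj) : K.Obj := K.subst T.tensor (fun i => ![a, b] (Fin.cast T.arity_tensor i))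

/-- The `n`-th tensor power operation. -/
def pow (n : ℕ) : K.Obj := prodFin T.unit T.tens n (fun _ => K.one)

theorem sum_cast {m n : ℕ} (h : m = n) (f : Fin n → ℕ) : ∑ i, f (Fin.cast h i) = ∑ i, f i := by
  subst h
  rfl

theorem arity_tens (a b : K.Obj) : K.arity (T.tens a b) = K.arity a + K.arity b := by
  refine (K.arity_subst _ _).symm.trans ?_
  refine (sum_cast T.arity_tensor (fun i => K.arity (![a, b] i))).trans ?_
  simp [Fin.sum_univ_two]

theorem arity_pow (n : ℕ) : K.arity (T.pow n) = n := by
  induction n with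
  | zero => exact T.arity_unit
  | succ n ih =>
    refine (T.arity_tens _ _).trans ?_
    rw [K.arity_one]
    exact (congrArg (1 + ·) ih).trans (add_comm _ _)

theorem subst_unit (z z' : Fin (K.arity T.unit) → K.Obj) : z = z' :=
  funext fun i => (Fin.cast T.arity_unit i).elim0

theorem subst_congr {a : K.Obj} {z z' : Fin (K.arity a) → K.Obj} (hz : ∀ i, z i = z' i) :
    K.subst a z = K.subst a z' := by
  rw [funext hz]

theorem subst_tens (a b : K.Obj) (z : Fin (K.arity (T.tens a b)) → K.Obj) :
    K.subst (T.tens a b) z =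
      T.tens (K.subst a (fun j => z (Fin.cast (T.arity_tens a b).symm (Fin.castAdd _ j))))
        (K.subst b (fun j => z (Fin.cast (T.arity_tens a b).symm (Fin.natAdd _ j)))) := by
  have hsum : ∑ i : Fin 2, K.arity (![a, b] i) = K.arity (T.tens a b) :=
    (sum_cast T.arity_tensor (fun i => K.arity (![a, b] i))).symm.trans (K.arity_subst _ _)
  have L : ∀ i : Fin 2, K.subst (![a, b] i)
      (fun j => z (blk (fun i => K.arity (![a, b] i)) hsum ⟨i, j⟩)) =
      ![K.subst a (fun j => z (Fin.cast (T.arity_tens a b).symm (Fin.castAdd _ j))),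
        K.subst b (fun j => z (Fin.cast (T.arity_tens a b).symm (Fin.natAdd _ j)))] i := by
    rw [Fin.forall_fin_two]
    constructor
    · refine congrArg (K.subst a) (funext fun j => congrArg z (Fin.ext ?_))
      rw [blk_val, Fin.sum_univ_two]
      simp
      rfl
    · refine congrArg (K.subst b) (funext fun j => congrArg z (Fin.ext ?_))
      rw [blk_val, Fin.sum_univ_two]
      simp
      rfl
  refine (K.subst_assoc _ _ _).trans (congrArg (K.subst T.tensor) (funext fun i => ?_))
  refine Eq.trans ?_ (L (Fin.cast T.arity_tensor i))
  refine congrArg (K.subst _) (funext fun j => congrArg z (Fin.ext ?_))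
  exact blk_val_congr (k' := fun i => K.arity (![a, b] i)) T.arity_tensor (fun _ => rfl) _ hsum
    rfl rfl

theorem subst_pow (n : ℕ) (z : Fin (K.arity (T.pow n)) → K.Obj) :
    K.subst (T.pow n) z = prodFin T.unit T.tens n (fun i => z (Fin.cast (T.arity_pow n).symm i)) := by
  induction n with
  | zero =>
    have : z = fun _ => K.one := funext fun i => (Fin.cast T.arity_unit i).elim0
    rw [this]
    exact K.subst_one T.unit
  | succ n ih =>
    refine (T.subst_tens _ _ _).trans ?_
    refine congrArg₂ T.tens ?_ ((ih _).trans ?_)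
    · refine (subst_congr fun j => ?_).trans (K.one_subst _)
      refine congrArg z (Fin.ext ?_)
      have := (Fin.cast K.arity_one j).2
      simp only [Fin.val_cast] at this
      simp only [Fin.val_cast, Fin.val_castAdd, Fin.val_zero]
      omega
    · congr 1
      funext i
      refine congrArg z (Fin.ext ?_)
      change K.arity K.one + (i : ℕ) = i + 1
      rw [K.arity_one, add_comm]

/-- Substituting tensor powers into a tensor power gives a tensor power. -/
theorem subst_pow_pow {n N : ℕ} (k : Fin (K.arity (T.pow n)) → ℕ) (h : ∑ i, k i = N) :
    K.subst (T.pow n) (fun i => T.pow (k i)) = T.pow N := by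
  rw [T.subst_pow]
  exact prodFin_blk T.unit T.tens T.assoc T.unit_tensor _
    ((sum_cast (T.arity_pow n).symm k).trans h) (fun _ => K.one)

end Tensor

theorem substHom_eq_id {K : Club.{w, v}} {x : K.Obj} {y : Fin (K.arity x) → K.Obj} (f : x ⟶ x)
    (hf : f = 𝟙 x) (g : Fam (K.perm f) y y)
    (hg : ∀ i j h e, g i j h = eqToHom e) : K.substHom f g = 𝟙 (K.subst x y) := by
  subst hf
  rw [← K.substHom_id]
  congr 1
  funext i j h
  exact hg i j h _

/-- The multiplication of a club on isomorphisms. -/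
def substIso {K : Club.{w, v}} {x x' : K.Obj} {y : Fin (K.arity x) → K.Obj}
    {y' : Fin (K.arity x') → K.Obj} (f : x ≅ x')
    (g : ∀ i j, K.perm f.hom i = j → (y i ≅ y' j)) : K.subst x y ≅ K.subst x' y' where
  hom := K.substHom f.hom (fun i j h => (g i j h).hom)
  inv := K.substHom f.inv (fun j i h => (g i j (by
    rw [← h, ← Equiv.trans_apply, ← K.perm_comp, f.inv_hom_id, K.perm_id]; rfl)).inv)
  hom_inv_id := by
    rw [K.substHom_comp]
    refine substHom_eq_id _ f.hom_inv_id _ fun i j h e => ?_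
    obtain rfl : i = j := by
      rw [← h, f.hom_inv_id, K.perm_id]; rfl
    simp
  inv_hom_id := by
    rw [K.substHom_comp]
    refine substHom_eq_id _ f.inv_hom_id _ fun i j h e => ?_
    obtain rfl : i = j := by
      rw [← h, f.inv_hom_id, K.perm_id]; rfl
    have key : ∀ l (h₁ : K.perm f.hom l = i) (h₂ : K.perm f.hom l = i),
        (g l i h₁).inv ≫ (g l i h₂).hom = eqToHom e := by
      intro l h₁ h₂
      simp
    exact key _ _ _

/-- A strict unit and tensor product in the club `K`, together with, for each element `x` of `G` of
arity `n`, an isomorphism from the `n`-th tensor power operation to itself, over the permutation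
of `x`. -/
structure Operations (K : Club.{w, v}) (G : SymColl.{u}) extends K.Tensor where
  iso : ∀ x : G.carrier, toTensor.pow (G.arity x) ≅ toTensor.pow (G.arity x)
  perm_iso : ∀ (x : G.carrier) (i : Fin (K.arity (toTensor.pow (G.arity x)))),
    Fin.cast (toTensor.arity_pow _) (K.perm (iso x).hom i) =
      G.perm x (Fin.cast (toTensor.arity_pow _) i)

/-- The interpretation of formal composites as automorphisms of the tensor powers. -/
def Operations.interp {K : Club.{w, v}} {G : SymColl.{u}} (S : K.Operations G) :
    ∀ {n : ℕ}, FormalComposite G n → (S.pow n ≅ S.pow n)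
  | _, .gen x => S.iso x
  | _, .unit => Iso.refl _
  | _, .one _ => Iso.refl _
  | _, .mul t t' => S.interp t' ≪≫ S.interp t
  | _, .inv t => (S.interp t).symm
  | _, .op (n := n) (N := N) k h t ts =>
    let k' : Fin (K.arity (S.pow n)) → ℕ := fun i => k (Fin.cast (S.arity_pow n) i)
    let σ := K.perm (S.interp t).hom
    have hk' : ∑ i, k' i = N := (Tensor.sum_cast (S.arity_pow n) k).trans h
    eqToIso (S.subst_pow_pow k' hk').symm ≪≫
      Club.substIso (y := fun i => S.pow (k' i)) (y' := fun i => S.pow (k' (σ.symm i)))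
        (S.interp t)
        (fun i j e => S.interp (ts (Fin.cast (S.arity_pow n) i)) ≪≫
          eqToIso (by rw [← e, Equiv.symm_apply_apply])) ≪≫
      eqToIso (S.subst_pow_pow (fun i => k' (σ.symm i)) ((σ.symm.sum_comp k').trans hk'))

end Club

/-- Two formal composites that `E` relates have the same value in `S`. -/
def Club.Operations.Satisfies {K : Club.{w, v}} {G : SymColl.{u}} (S : K.Operations G)
    (E : ∀ {n : ℕ}, FormalComposite G n → FormalComposite G n → Prop) : Prop :=
  ∀ {n : ℕ} (t₁ t₂ : FormalComposite G n), E t₁ t₂ → S.interp t₁ = S.interp t₂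

/-- A map of clubs out of `Λ.club` sends the unit object, the tensor product and the
generators (through `p`) to the given ones. -/
structure Club.Hom.Realizes {Λ : ActionOperad.{u}} {G : SymColl.{u}}
    (p : ActionOperad.free G ⟶ Λ) {K : Club.{w, v}} (F : Club.Hom Λ.club K)
    (S : K.Operations G) : Prop where
  obj_unit : F.functor.obj (Λ.ob 0) = S.unit
  obj_tensor : F.functor.obj (Λ.ob 2) = S.tensor
  map_gen : ∀ x : G.carrier,
    Arrow.mk (F.functor.map (ActionOperad.endo (p.app (G.arity x) (FormalComposite.gen x).toFree))) =
      Arrow.mk (S.iso x).hom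

/-! ### Algebras of a club -/

/-- An algebra structure on a category `X` for (the monad `K ∘ -` of) a club `K`. An object of
`K ∘ X` is an object `a` of `K` with a family of `arity a` objects of `X`, and a morphism
`(a; x) ⟶ (b; y)` is a morphism `f : a ⟶ b` with morphisms `x i ⟶ y (perm f i)`; the action
`K ∘ X ⥤ X` is given by `obj` and `map`. -/
structure Club.Algebra (K : Club.{w', v'}) (X : Type w) [Category.{v} X] where
  obj : ∀ a : K.Obj, (Fin (K.arity a) → X) → X
  map : ∀ {a b : K.Obj} {x : Fin (K.arity a) → X} {y : Fin (K.arity b) → X} (f : a ⟶ b),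
    Fam (K.perm f) x y → (obj a x ⟶ obj b y)
  map_id : ∀ (a : K.Obj) (x : Fin (K.arity a) → X),
    map (𝟙 a) (Fam.ofEq (x := x) (y := x) (by rw [K.perm_id]; rintro i j rfl; rfl)) = 𝟙 (obj a x)
  map_comp : ∀ {a b c : K.Obj} {x : Fin (K.arity a) → X} {y : Fin (K.arity b) → X}
    {z : Fin (K.arity c) → X} (f : a ⟶ b) (f' : b ⟶ c) (g : Fam (K.perm f) x y)
    (g' : Fam (K.perm f') y z),
    map f g ≫ map f' g' =
      map (f ≫ f') (fun i j h => g i _ rfl ≫ g' _ j (by rw [← h, K.perm_comp]; rfl))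
  obj_one : ∀ x : X, obj K.one (fun _ => x) = x
  map_one : ∀ {x y : X} (g : x ⟶ y),
    Arrow.mk (map (𝟙 K.one) (fun _ _ _ => g) : obj K.one (fun _ => x) ⟶ obj K.one (fun _ => y)) =
      Arrow.mk g
  obj_subst : ∀ (a : K.Obj) (b : Fin (K.arity a) → K.Obj) (x : Fin (K.arity (K.subst a b)) → X),
    obj (K.subst a b) x = obj a (fun i => obj (b i)
      (fun j => x (blk (fun i => K.arity (b i)) (K.arity_subst a b) ⟨i, j⟩)))
  map_subst : ∀ {a a' : K.Obj} {b : Fin (K.arity a) → K.Obj} {b' : Fin (K.arity a') → K.Obj}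
    {x : Fin (K.arity (K.subst a b)) → X} {x' : Fin (K.arity (K.subst a' b')) → X} (f : a ⟶ a')
    (g : Fam (K.perm f) b b') (h : Fam (K.perm (K.substHom f g)) x x'),
    Arrow.mk (map (K.substHom f g) h) =
      Arrow.mk (map f (fun i i' hi => map (g i i' hi) (fun j j' hj =>
        h (blk (fun i => K.arity (b i)) (K.arity_subst a b) ⟨i, j⟩)
          (blk (fun i => K.arity (b' i)) (K.arity_subst a' b') ⟨i', j'⟩)
          (by subst hi hj; exact K.perm_substHom f g i j))) :
        obj a (fun i => obj (b i)
            (fun j => x (blk (fun i => K.arity (b i)) (K.arity_subst a b) ⟨i, j⟩))) ⟶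
          obj a' (fun i => obj (b' i)
            (fun j => x' (blk (fun i => K.arity (b' i)) (K.arity_subst a' b') ⟨i, j⟩))))

namespace Club.Algebra

variable {K : Club.{w', v'}} {X Y : Type w} [Category.{v} X] [Category.{v} Y]

/-- `F` is a strict map of algebras. -/
structure IsStrictMap (A : K.Algebra X) (B : K.Algebra Y) (F : X ⥤ Y) : Prop where
  obj : ∀ (a : K.Obj) (x : Fin (K.arity a) → X),
    F.obj (A.obj a x) = B.obj a (fun i => F.obj (x i))
  map : ∀ {a b : K.Obj} {x : Fin (K.arity a) → X} {y : Fin (K.arity b) → X} (f : a ⟶ b)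
    (g : Fam (K.perm f) x y),
    Arrow.mk (F.map (A.map f g)) = Arrow.mk (B.map f (fun i j h => F.map (g i j h)) :
      B.obj a (fun i => F.obj (x i)) ⟶ B.obj b (fun i => F.obj (y i)))

/-- `θ` is a transformation of algebra maps. -/
def IsTransformation (A : K.Algebra X) (B : K.Algebra Y) {F F' : X ⥤ Y} (θ : F ⟶ F') : Prop :=
  ∀ (a : K.Obj) (x : Fin (K.arity a) → X),
    Arrow.mk (θ.app (A.obj a x)) =
      Arrow.mk (B.map (𝟙 a) (Fam.ofHoms (K.perm_id a) (fun i => θ.app (x i))) :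
        B.obj a (fun i => F.obj (x i)) ⟶ B.obj a (fun i => F'.obj (x i)))

end Club.Algebra

/-! ### Strict monoidal categories with natural isomorphisms of tensor powers -/

/-- A strict monoidal structure on a category. -/
structure StrictMonoidal (X : Type w) [Category.{v} X] where
  unit : X
  tensor : X × X ⥤ X
  assoc : tensor.prod (𝟭 X) ⋙ tensor = prod.associator X X X ⋙ (𝟭 X).prod tensor ⋙ tensor
  unit_tensor : Prod.sectR unit X ⋙ tensor = 𝟭 X
  tensor_unit : Prod.sectL X unit ⋙ tensor = 𝟭 X

namespace StrictMonoidal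

variable {X : Type w} [Category.{v} X] (S : StrictMonoidal X)

/-- The tensor product of `n` objects. -/
def prod (n : ℕ) (x : Fin n → X) : X := prodFin S.unit (fun a b => S.tensor.obj (a, b)) n x

/-- The tensor product of `n` morphisms. -/
def prodMap : ∀ (n : ℕ) {x y : Fin n → X}, (∀ i, x i ⟶ y i) → (S.prod n x ⟶ S.prod n y)
  | 0, _, _, _ => 𝟙 S.unit
  | n + 1, x, y, f =>
    S.tensor.map (X := (x 0, S.prod n (fun i => x i.succ)))
      (Y := (y 0, S.prod n (fun i => y i.succ))) (f 0, prodMap n (fun i => f i.succ))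

theorem prodMap_id : ∀ (n : ℕ) (x : Fin n → X), S.prodMap n (fun i => 𝟙 (x i)) = 𝟙 (S.prod n x)
  | 0, _ => rfl
  | n + 1, x => by
    rw [prodMap, prodMap_id n]
    exact S.tensor.map_id _

theorem prodMap_comp : ∀ (n : ℕ) {x y z : Fin n → X} (f : ∀ i, x i ⟶ y i) (g : ∀ i, y i ⟶ z i),
    S.prodMap n (fun i => f i ≫ g i) = S.prodMap n f ≫ S.prodMap n g
  | 0, _, _, _, _, _ => (Category.id_comp _).symm
  | n + 1, x, y, z, f, g => by
    rw [prodMap, prodMap_comp n]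
    exact S.tensor.map_comp (X := (x 0, S.prod n (fun i => x i.succ)))
      (Y := (y 0, S.prod n (fun i => y i.succ))) (Z := (z 0, S.prod n (fun i => z i.succ)))
      (f 0, S.prodMap n (fun i => f i.succ)) (g 0, S.prodMap n (fun i => g i.succ))

/-- The `n`-th tensor power functor. -/
def pow (n : ℕ) : (Fin n → X) ⥤ X where
  obj := S.prod n
  map f := S.prodMap n f
  map_id x := S.prodMap_id n x
  map_comp f g := S.prodMap_comp n f g

/-- The tensor product of tensor products of the blocks is the tensor product. -/
theorem prod_prod {n N : ℕ} (k : Fin n → ℕ) (h : ∑ i, k i = N) (x : Fin N → X) :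
    S.prod n (fun i => S.prod (k i) (fun j => x (blk k h ⟨i, j⟩))) = S.prod N x :=
  prodFin_blk _ _ (fun a b c => Functor.congr_obj S.assoc ((a, b), c))
    (fun a => Functor.congr_obj S.unit_tensor a) k h x

/-- The tensor product of `n` isomorphisms. -/
def prodIso (n : ℕ) {x y : Fin n → X} (f : ∀ i, x i ≅ y i) : S.prod n x ≅ S.prod n y where
  hom := S.prodMap n (fun i => (f i).hom)
  inv := S.prodMap n (fun i => (f i).inv)
  hom_inv_id := by
    rw [← prodMap_comp]
    simp only [Iso.hom_inv_id, prodMap_id]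
  inv_hom_id := by
    rw [← prodMap_comp]
    simp only [Iso.inv_hom_id, prodMap_id]

end StrictMonoidal

/-- A strict monoidal structure on `X`, together with, for each element of `G` with underlying
permutation `σ` of `n` letters, a natural isomorphism
`x₁ ⊗ ⋯ ⊗ xₙ ≅ x_{σ⁻¹(1)} ⊗ ⋯ ⊗ x_{σ⁻¹(n)}`. -/
structure StrictMonoidalWith (G : SymColl.{u}) (X : Type w) [Category.{v} X] extends
    StrictMonoidal X where
  iso : ∀ f : G.carrier,
    toStrictMonoidal.pow (G.arity f) ≅
      Pi.comap (fun _ : Fin (G.arity f) => X) (G.perm f).symm ⋙ toStrictMonoidal.pow (G.arity f)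

namespace StrictMonoidalWith

variable {G : SymColl.{u}} {X : Type w} [Category.{v} X] (S : StrictMonoidalWith G X)

/-- The value of a formal composite at the objects `x₁, …, xₙ`: an isomorphism
`x₁ ⊗ ⋯ ⊗ xₙ ≅ x_{σ⁻¹(1)} ⊗ ⋯ ⊗ x_{σ⁻¹(n)}`, where `σ` is its underlying permutation. -/
def interp : ∀ {n : ℕ} (t : FormalComposite G n) (x : Fin n → X),
    S.prod n x ≅ S.prod n (fun i => x (t.perm.symm i))
  | _, .gen f, x => (S.iso f).app x
  | _, .unit, _ => Iso.refl _
  | _, .one _, _ => Iso.refl _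
  | _, .mul t t', x => interp t' x ≪≫ interp t (fun i => x (t'.perm.symm i))
  | n, .inv t, x =>
    eqToIso (congrArg (S.prod n) (funext fun i => congrArg x (t.perm.apply_symm_apply i).symm)) ≪≫
      (interp t (fun i => x (t.perm i))).symm
  | _, .op (n := n) (N := N) k h t ts, x =>
    eqToIso (S.prod_prod k h x).symm ≪≫
      S.prodIso n (fun i => interp (ts i) (fun j => x (blk k h ⟨i, j⟩))) ≪≫
      interp t _ ≪≫
      eqToIso (by
        refine Eq.trans ?_ (S.prod_prod (fun i => k (t.perm.symm i))
          ((t.perm.symm.sum_comp k).trans h) _)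
        refine congrArg (S.prod n) (funext fun i => congrArg (S.prod _) (funext fun j => ?_))
        exact congrArg x (blockPerm_symm_blk k h t.perm (fun i => (ts i).perm) _ i j).symm)

/-- Two formal composites that `E` relates have the same value in `S`. -/
def Satisfies (E : ∀ {n : ℕ}, FormalComposite G n → FormalComposite G n → Prop) : Prop :=
  ∀ {n : ℕ} (t₁ t₂ : FormalComposite G n), E t₁ t₂ →
    ∀ x : Fin n → X, Arrow.mk (S.interp t₁ x).hom = Arrow.mk (S.interp t₂ x).hom

variable {Y : Type w} [Category.{v} Y]

/-- `F` strictly preserves the unit, the tensor product and the natural isomorphisms. -/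
structure IsStrictFunctor (S : StrictMonoidalWith G X) (T : StrictMonoidalWith G Y) (F : X ⥤ Y) :
    Prop where
  unit : F.obj S.unit = T.unit
  tensor : S.tensor ⋙ F = F.prod F ⋙ T.tensor
  iso : ∀ (f : G.carrier) (x : Fin (G.arity f) → X),
    Arrow.mk (F.map ((S.iso f).hom.app x)) = Arrow.mk ((T.iso f).hom.app (fun i => F.obj (x i)))

/-- `θ` is a monoidal transformation of strict monoidal functors. -/
structure IsMonoidalTransformation (S : StrictMonoidalWith G X) (T : StrictMonoidalWith G Y)
    {F F' : X ⥤ Y} (θ : F ⟶ F') : Prop where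
  unit : Arrow.mk (θ.app S.unit) = Arrow.mk (𝟙 T.unit)
  tensor : ∀ x y : X, Arrow.mk (θ.app (S.tensor.obj (x, y))) =
    Arrow.mk (T.tensor.map (X := (F.obj x, F.obj y)) (Y := (F'.obj x, F'.obj y))
      (θ.app x, θ.app y))

end StrictMonoidalWith

/-- The strict monoidal category with operations `S` underlies the algebra `A`: its unit and
tensor product are given by the action of the objects `0` and `2` of the club, and its natural
isomorphisms by the action of the generators (through `p`). -/
structure Club.Algebra.Underlies {Λ : ActionOperad.{u}} {G : SymColl.{u}}
    (p : ActionOperad.free G ⟶ Λ) {X : Type w} [Category.{v} X] (A : Λ.club.Algebra X)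
    (S : StrictMonoidalWith G X) : Prop where
  unit : ∀ x : Fin 0 → X, S.unit = A.obj (Λ.ob 0) x
  tensor_obj : ∀ x : Fin 2 → X, S.tensor.obj (x 0, x 1) = A.obj (Λ.ob 2) x
  tensor_map : ∀ {x y : Fin 2 → X} (f : ∀ i, x i ⟶ y i),
    Arrow.mk (S.tensor.map (X := (x 0, x 1)) (Y := (y 0, y 1)) (f 0, f 1)) =
      Arrow.mk (A.map (x := x) (y := y) (𝟙 (Λ.ob 2)) (Fam.ofHoms (Λ.club.perm_id _) f))
  iso : ∀ (f : G.carrier) (x : Fin (G.arity f) → X),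
    Arrow.mk ((S.iso f).hom.app x) =
      Arrow.mk (A.map (x := x) (y := fun i => x ((G.perm f).symm i))
        (ActionOperad.endo (p.app (G.arity f) (FormalComposite.gen f).toFree))
        (Fam.ofEq (fun i j h => by
          have e : G.perm f i = j :=
            (congrFun (congrArg _ (p.app_π (G.arity f) (FormalComposite.gen f).toFree)) i).symm.trans h
          exact congrArg x ((G.perm f).symm_apply_eq.2 e.symm).symm)))

/-- For an action operad `Λ` generated by `G` through `p`, and a set `E` of equations between formal
composites: the algebras of the club of `Λ`, with their strict maps and transformations, are the
strict monoidal categories equipped with natural isomorphisms indexed by `G` that satisfy `E`,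
with the strict functors and monoidal transformations. -/
structure AlgebrasCorrespond {Λ : ActionOperad.{u}} {G : SymColl.{u}}
    (p : ActionOperad.free G ⟶ Λ)
    (E : ∀ {n : ℕ}, FormalComposite G n → FormalComposite G n → Prop) : Prop where
  toOperations : ∀ (X : Type u) [Category.{u} X] (A : Λ.club.Algebra X),
    ∃! S : StrictMonoidalWith G X, S.Satisfies E ∧ A.Underlies p S
  toAlgebra : ∀ (X : Type u) [Category.{u} X] (S : StrictMonoidalWith G X), S.Satisfies E →
    ∃! A : Λ.club.Algebra X, A.Underlies p S
  strictMap_iff : ∀ (X Y : Type u) [Category.{u} X] [Category.{u} Y] (A : Λ.club.Algebra X)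
    (B : Λ.club.Algebra Y) (S : StrictMonoidalWith G X) (T : StrictMonoidalWith G Y),
    A.Underlies p S → B.Underlies p T → ∀ F : X ⥤ Y,
      A.IsStrictMap B F ↔ S.IsStrictFunctor T F
  transformation_iff : ∀ (X Y : Type u) [Category.{u} X] [Category.{u} Y] (A : Λ.club.Algebra X)
    (B : Λ.club.Algebra Y) (S : StrictMonoidalWith G X) (T : StrictMonoidalWith G Y),
    A.Underlies p S → B.Underlies p T → ∀ F F' : X ⥤ Y, S.IsStrictFunctor T F →
      S.IsStrictFunctor T F' → ∀ θ : F ⟶ F',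
        A.IsTransformation B θ ↔ S.IsMonoidalTransformation T θ

/-- A set of axioms for natural isomorphisms indexed by `G`: pairs of formal composites with the
same underlying permutation. -/
structure AxiomSet (G : SymColl.{u}) where
  carrier : Type u
  arity : carrier → ℕ
  lhs : ∀ r, FormalComposite G (arity r)
  rhs : ∀ r, FormalComposite G (arity r)
  perm_eq : ∀ r, (lhs r).perm = (rhs r).perm

namespace AxiomSet

variable {G : SymColl.{u}} (R : AxiomSet G)

/-- The axioms, as a collection over the symmetric groups. -/
def coll : SymColl.{u} := ⟨R.carrier, fun r => ⟨R.arity r, (R.lhs r).perm⟩⟩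

/-- Each axiom is sent to the value of its left hand side. -/
noncomputable def s₁ : ActionOperad.free R.coll ⟶ ActionOperad.free G :=
  ActionOperad.free.lift ⟨fun r => (R.lhs r).toFree, fun _ => rfl⟩

/-- Each axiom is sent to the value of its right hand side. -/
noncomputable def s₂ : ActionOperad.free R.coll ⟶ ActionOperad.free G :=
  ActionOperad.free.lift ⟨fun r => (R.rhs r).toFree, fun r => (R.perm_eq r).symm⟩

/-- The axioms, as equations between formal composites. -/
inductive Eqn : ∀ {n : ℕ}, FormalComposite G n → FormalComposite G n → Prop
  | intro (r : R.carrier) : Eqn (R.lhs r) (R.rhs r)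

end AxiomSet

/-!
The theorem rests on one observation, used twice: every object on the other side of the
correspondence has its own action operad, and the structures to be classified are the maps from
`Λ` to it.

For a strict unit and tensor product `T` in a club `K`, the automorphisms of the tensor powers
`t_n` form an action operad `T.autOperad`, whose composition is the substitution of `K`.
Interpreting the generators in `K` is the same as a map from the collection of generators to this
action operad, and the value of a formal composite in `K` is its value there
(`Operations.eval_homTo`). For a strict monoidal category `S`, the natural isomorphisms `x₁ ⊗ ⋯ ⊗
xₙ ≅ x_{σ⁻¹(1)} ⊗ ⋯ ⊗ x_{σ⁻¹(n)}`, with `σ` as part of the data, form an action operad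
`PermNatIso.operad S`, and again the value of a formal composite is its value there
(`StrictMonoidalWith.mk_interp`).

Coequalizers of action operads exist (`ActionOperad.coeq`) and are surjective, so that a
presentation has the following consequences, collected in `ActionOperad.Presents`: every element of
`Λ` is represented by a formal composite; the equations hold in `Λ`; and an interpretation of the
generators in any action operad that satisfies the equations extends to a map out of `Λ`. Applied
to `T.autOperad`, this gives the map of clubs (`Tensor.homOfAut`), and applied to
`PermNatIso.operad S` the algebra (`PermNatIso.toAlgebra`): the object `n` acts by the `n`-fold
tensor product, and an element of `Λ n` by the natural isomorphism to which it is sent. Uniqueness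
follows from surjectivity.

Conversely, the objects of the club of `Λ` act on the objects, and on the arrows, of an algebra as
an unbiased monoid (`UnbiasedMonoid`): the product of `n` elements may be computed in blocks. An
unbiased monoid is a strict monoid and its `n`-fold products are iterated binary ones
(`UnbiasedMonoid.act_eq_prodFin`). So an algebra has an underlying strict monoidal structure, for
which the object `n` acts by the `n`-fold tensor product, and the morphisms of the club act by a
map of action operads from `Λ` to `PermNatIso.operad` (`Club.Algebra.ActsBy.hom`).

Strict associativity makes most equations of morphisms hold only between morphisms whose sources
and targets are propositionally equal. All of them are therefore stated as equalities of objects of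
the arrow category, where arrows are composed by `Arrow.seq`, which asks for a proof that the
target of the first is the source of the second.
-/

/-! ### Partial composition of arrows -/

namespace CategoryTheory.Arrow

variable {C : Type w} [Category.{v} C] {D : Type w'} [Category.{v'} D]

/-- The composite of two arrows of a category, given that the target of the first is equal to the
source of the second. -/
def seq (f g : Arrow C) (h : f.right = g.left) : Arrow C :=
  Arrow.mk (f.hom ≫ eqToHom h ≫ g.hom)

theorem seq_congr {f f' g g' : Arrow C} {h : f.right = g.left} {h' : f'.right = g'.left}
    (hf : f = f') (hg : g = g') : seq f g h = seq f' g' h' := by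
  subst hf hg
  rfl

theorem seq_congr_left {f f' : Arrow C} (hf : f = f') (g : Arrow C) (h : f.right = g.left) :
    seq f g h = seq f' g (hf ▸ h) :=
  seq_congr hf rfl

theorem seq_congr_right (f : Arrow C) {g g' : Arrow C} (hg : g = g') (h : f.right = g.left) :
    seq f g h = seq f g' (hg ▸ h) :=
  seq_congr rfl hg

theorem seq_mk {a b c : C} (f : a ⟶ b) (g : b ⟶ c) (h) :
    seq (mk f) (mk g) h = mk (f ≫ g) := by
  change mk (f ≫ eqToHom rfl ≫ g) = _
  rw [eqToHom_refl, Category.id_comp]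

theorem mk_comp_eq_seq {a b c : C} {f : a ⟶ b} {g : b ⟶ c} {f' g' : Arrow C} (hf : mk f = f')
    (hg : mk g = g') : mk (f ≫ g) = seq f' g' (by rw [← hf, ← hg]; rfl) := by
  subst hf hg
  exact (seq_mk _ _ _).symm

theorem seq_assoc (f g k : Arrow C) (h : f.right = g.left) (h' : g.right = k.left) :
    seq (seq f g h) k h' = seq f (seq g k h') h := by
  obtain ⟨a, b, f⟩ := f
  obtain ⟨b', c, g⟩ := g
  obtain ⟨c', d, k⟩ := k
  obtain rfl : b = b' := h
  obtain rfl : c = c' := h'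
  simp [seq]

theorem id_seq (a : C) (g : Arrow C) (h : a = g.left) : seq (mk (𝟙 a)) g h = g := by
  obtain ⟨b, c, g⟩ := g
  obtain rfl : a = b := h
  exact (seq_mk _ _ _).trans (congrArg mk (Category.id_comp g))

theorem seq_id (a : C) (g : Arrow C) (h : g.right = a) : seq g (mk (𝟙 a)) h = g := by
  obtain ⟨b, c, g⟩ := g
  obtain rfl : c = a := h
  exact (seq_mk _ _ _).trans (congrArg mk (Category.comp_id g))

theorem mk_id_eq {a b : C} (h : a = b) : mk (𝟙 a) = mk (𝟙 b) := by
  subst h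
  rfl

theorem mk_eqToHom {a b : C} (h : a = b) : mk (eqToHom h) = mk (𝟙 a) := by
  subst h
  rfl

theorem eq_of_mk_eq {a b : C} {f g : a ⟶ b} (h : mk f = mk g) : f = g := mk_injective _ _ h

theorem left_eq {f g : Arrow C} (h : f = g) : f.left = g.left := by rw [h]

theorem right_eq {f g : Arrow C} (h : f = g) : f.right = g.right := by rw [h]

theorem mk_map_congr (F : C ⥤ D) {a b a' b' : C} {f : a ⟶ b} {f' : a' ⟶ b'}
    (h : mk f = mk f') : mk (F.map f) = mk (F.map f') :=
  congrArg F.mapArrow.obj h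

theorem mk_map_of_functor_eq {F G : C ⥤ D} (h : F = G) {a b : C} (f : a ⟶ b) :
    mk (F.map f) = mk (G.map f) := by
  subst h
  rfl

theorem mapArrow_seq (F : C ⥤ D) (f g : Arrow C) (h : f.right = g.left) :
    F.mapArrow.obj (seq f g h) =
      seq (F.mapArrow.obj f) (F.mapArrow.obj g) (congrArg F.obj h) := by
  obtain ⟨a, b, f⟩ := f
  obtain ⟨b', c, g⟩ := g
  obtain rfl : b = b' := h
  refine (congrArg F.mapArrow.obj (seq_mk f g rfl)).trans ?_
  exact (congrArg mk (F.map_comp f g)).trans (seq_mk (F.map f) (F.map g) rfl).symm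

/-- The inverse of an invertible arrow. -/
noncomputable def inverse (f : Arrow C) [IsIso f.hom] : Arrow C := mk (inv f.hom)

theorem seq_inverse (f : Arrow C) [IsIso f.hom] : seq f f.inverse rfl = mk (𝟙 f.left) :=
  (seq_mk f.hom (inv f.hom) rfl).trans (congrArg mk (IsIso.hom_inv_id _))

theorem inverse_seq (f : Arrow C) [IsIso f.hom] : seq f.inverse f rfl = mk (𝟙 f.right) :=
  (seq_mk (inv f.hom) f.hom rfl).trans (congrArg mk (IsIso.inv_hom_id _))

theorem eq_inverse {f g : Arrow C} [IsIso f.hom] (h : f.right = g.left)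
    (e : seq f g h = mk (𝟙 f.left)) : g = f.inverse := by
  refine (id_seq f.right g h).symm.trans ?_
  refine (seq_congr (f' := seq f.inverse f rfl) (h' := h) (inverse_seq f).symm rfl).trans ?_
  refine (seq_assoc f.inverse f g rfl h).trans ?_
  exact (seq_congr (h' := rfl) rfl e).trans (seq_id _ _ _)

theorem isIso_seq (f g : Arrow C) (h : f.right = g.left) (hf : IsIso f.hom) (hg : IsIso g.hom) :
    IsIso (seq f g h).hom := by
  change IsIso (f.hom ≫ eqToHom h ≫ g.hom)
  infer_instance

theorem inverse_mk_iso {a b : C} (e : a ≅ b) (f : Arrow C) [IsIso f.hom] (h : mk e.hom = f) :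
    mk e.inv = f.inverse := by
  refine eq_inverse (by rw [← h]; rfl) ?_
  subst h
  exact (seq_mk _ _ _).trans (congrArg mk e.hom_inv_id)

theorem mk_comp_congr {a b c a' b' c' : C} {f : a ⟶ b}
    {g : b ⟶ c} {f' : a' ⟶ b'} {g' : b' ⟶ c'} (hf : mk f = mk f')
    (hg : mk g = mk g') : mk (f ≫ g) = mk (f' ≫ g') :=
  (mk_comp_eq_seq hf hg).trans (seq_mk f' g' rfl)

theorem mk_comp_of_id_right {a b c d : C} {f : a ⟶ b}
    {g : b ⟶ c} (h : mk g = mk (𝟙 d)) : mk (f ≫ g) = mk f :=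
  (mk_comp_eq_seq rfl h).trans (seq_id _ _ _)

theorem mk_comp_of_id_left {a b c d : C} {f : a ⟶ b}
    {g : b ⟶ c} (h : mk f = mk (𝟙 d)) : mk (f ≫ g) = mk g :=
  (mk_comp_eq_seq h rfl).trans (id_seq _ _ _)

/-- A right inverse of an arrow that is equal to an isomorphism is equal to the inverse of the
isomorphism. -/
theorem mk_eq_mk_inv {a b a' b' : C} {e : a ≅ b}
    {f : a' ⟶ b'} {g : b' ⟶ a'} (h : mk f = mk e.hom) (hfg : f ≫ g = 𝟙 a') :
    mk g = mk e.inv := by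
  obtain ⟨rfl, rfl, h⟩ := (mk_eq_mk_iff _ _).1 h
  simp only [eqToHom_refl, Category.id_comp, Category.comp_id] at h
  subst h
  obtain rfl : g = e.inv := (cancel_epi e.hom).1 (hfg.trans e.hom_inv_id.symm)
  rfl

/-- A commutative square with invertible vertical sides still commutes when these are inverted. -/
theorem seq_inverse_of_seq_eq {p v' w' p' : Arrow C} [IsIso v'.hom] [IsIso w'.hom]
    {h : p.right = v'.left} {h' : w'.right = p'.left} (e : seq p v' h = seq w' p' h')
    (h₁ : p'.right = v'.right)
    (h₂ : w'.left = p.left) : seq p' v'.inverse h₁ = seq w'.inverse p h₂ := by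
  obtain ⟨a, b, p⟩ := p
  obtain ⟨b', c, v⟩ := v'
  obtain ⟨a', d, w⟩ := w'
  obtain ⟨d', c', p'⟩ := p'
  obtain rfl : b = b' := h
  obtain rfl : d = d' := h'
  obtain rfl : c' = c := h₁
  obtain rfl : a' = a := h₂
  change IsIso v at *
  change IsIso w at *
  have e' : p ≫ v = w ≫ p' :=
    eq_of_mk_eq ((seq_mk p v rfl).symm.trans (e.trans (seq_mk w p' rfl)))
  refine (seq_mk p' (inv v) rfl).trans (Eq.trans (congrArg mk ?_) (seq_mk (inv w) p rfl).symm)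
  rw [IsIso.comp_inv_eq, Category.assoc, e', IsIso.inv_hom_id_assoc]

/-- A commutative square in the middle of a composite of four arrows lets the two inner arrows be
exchanged. -/
theorem seq_seq_exchange {p q r t r' w' : Arrow C} {h₂ : q.right = r.left} {h₄ : r'.right = w'.left}
    (e : seq q r h₂ = seq r' w' h₄) (h₁ : p.right = q.left) (h₃ : r.right = t.left) :
    seq (seq p q h₁) (seq r t h₃) h₂ =
      seq (seq p r' (by have := left_eq e; exact h₁.trans this))
        (seq w' t (by have := right_eq e; exact this.symm.trans h₃)) h₄ := by
  have h₅ : p.right = r'.left := by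
    have := left_eq e
    exact h₁.trans this
  have h₆ : w'.right = t.left := by
    have := right_eq e
    exact this.symm.trans h₃
  refine (seq_assoc p q (seq r t h₃) h₁ h₂).trans ?_
  refine (seq_congr_right p (seq_assoc q r t h₂ h₃).symm h₁).trans ?_
  refine (seq_congr_right p (seq_congr_left e t h₃) h₁).trans ?_
  refine (seq_congr_right p (seq_assoc r' w' t h₄ h₆) h₅).trans ?_
  exact (seq_assoc p r' (seq w' t h₆) h₅ h₄).symm

theorem mapArrow_inverse (F : C ⥤ D) {f : Arrow C} {g : Arrow D} [IsIso f.hom] [IsIso g.hom]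
    (h : F.mapArrow.obj f = g) : F.mapArrow.obj f.inverse = g.inverse :=
  inverse_mk_iso (F.mapIso (asIso f.hom)) g h

end CategoryTheory.Arrow

/-! ### Coequalizers of action operads -/

namespace ActionOperad

variable {Θ Λ : ActionOperad.{u}}

theorem hom_ext_app {F F' : Θ ⟶ Λ} (h : ∀ n g, F.app n g = F'.app n g) : F = F' :=
  Hom.ext (funext fun n => MonoidHom.ext (h n))

/-- Composites of morphisms of action operads are computed levelwise. -/
theorem comp_app {Λ' : ActionOperad.{u}} (F : Θ ⟶ Λ) (F' : Λ ⟶ Λ') (n : ℕ) (g : Θ.carrier n) :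
    (F ≫ F').app n g = F'.app n (F.app n g) := rfl

/-- The map of an action operad to the symmetric groups. -/
def toSymmetric (Λ : ActionOperad.{u}) : Λ ⟶ symmetric.{u} where
  app n :=
    { toFun := fun g => ⟨Λ.π n g⟩
      map_one' := congrArg ULift.up (map_one (Λ.π n))
      map_mul' := fun a b => congrArg ULift.up (map_mul (Λ.π n) a b) }
  app_π _ _ := rfl
  app_unit := congrArg ULift.up (Subsingleton.elim _ _)
  app_μ k h g f := congrArg ULift.up (Λ.π_μ k h g f)

/-- The congruence that identifies two elements when every map of action operads that
coequalizes `s` and `s'` does. -/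
def coeqCon (s s' : Θ ⟶ Λ) (n : ℕ) : Con (Λ.carrier n) where
  r a b := ∀ (Λ' : ActionOperad.{u}) (F : Λ ⟶ Λ'), s ≫ F = s' ≫ F → F.app n a = F.app n b
  iseqv := ⟨fun _ _ _ _ => rfl, fun h Λ' F e => (h Λ' F e).symm,
    fun h h' Λ' F e => (h Λ' F e).trans (h' Λ' F e)⟩
  mul' h h' Λ' F e := by rw [map_mul, map_mul, h Λ' F e, h' Λ' F e]

section

variable (s s' : Θ ⟶ Λ)

theorem coeqCon_mk_eq {n : ℕ} {a b : Λ.carrier n} :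
    ((a : (coeqCon s s' n).Quotient) = b) ↔
      ∀ (Λ' : ActionOperad.{u}) (F : Λ ⟶ Λ'), s ≫ F = s' ≫ F → F.app n a = F.app n b :=
  Con.eq _

theorem coeqCon_exists_rep {n : ℕ} (a : (coeqCon s s' n).Quotient) :
    ∃ b : Λ.carrier n, a = (b : (coeqCon s s' n).Quotient) :=
  (Quotient.exists_rep a).imp fun _ h => h.symm

theorem coeqCon_exists_family {n : ℕ} {k : Fin n → ℕ} (a : ∀ i, (coeqCon s s' (k i)).Quotient) :
    ∃ b : ∀ i, Λ.carrier (k i), a = fun i => (b i : (coeqCon s s' (k i)).Quotient) := by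
  choose b hb using fun i => Quotient.exists_rep (a i)
  exact ⟨b, funext fun i => (hb i).symm⟩

/-- The operadic composition of the quotient by `coeqCon`. -/
noncomputable def coeqμ {n N : ℕ} (k : Fin n → ℕ) (h : ∑ i, k i = N)
    (g : (coeqCon s s' n).Quotient) (f : ∀ i, (coeqCon s s' (k i)).Quotient) :
    (coeqCon s s' N).Quotient :=
  (Λ.μ k h (Quotient.out g) (fun i => Quotient.out (f i)) : Λ.carrier N)

theorem coeqμ_mk {n N : ℕ} (k : Fin n → ℕ) (h : ∑ i, k i = N) (g : Λ.carrier n)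
    (f : ∀ i, Λ.carrier (k i)) :
    coeqμ s s' k h g (fun i => (f i : (coeqCon s s' (k i)).Quotient)) =
      (Λ.μ k h g f : Λ.carrier N) := by
  refine (coeqCon_mk_eq s s').2 fun Λ' F e => ?_
  have key : ∀ {n : ℕ} (a : Λ.carrier n),
      F.app n (Quotient.out (a : (coeqCon s s' n).Quotient)) = F.app n a :=
    fun {n} a => (coeqCon_mk_eq s s').1
      (Quotient.out_eq (a : (coeqCon s s' n).Quotient)) Λ' F e
  rw [F.app_μ, F.app_μ, key]
  simp only [key]

/-- The coequalizer of two maps of action operads. -/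
noncomputable def coeq : ActionOperad.{u} where
  carrier n := (coeqCon s s' n).Quotient
  π n := Con.lift _ (Λ.π n) fun a b h => by
    have e : s ≫ Λ.toSymmetric = s' ≫ Λ.toSymmetric := hom_ext_app fun n g =>
      ULift.ext _ _ ((s.app_π n g).trans (s'.app_π n g).symm)
    exact congrArg ULift.down (h _ Λ.toSymmetric e)
  unit := (Λ.unit : Λ.carrier 1)
  μ := coeqμ s s'
  unit_μ g := by
    obtain ⟨g, rfl⟩ := Quotient.exists_rep g
    exact (coeqμ_mk s s' _ _ Λ.unit fun _ => g).trans (congrArg _ (Λ.unit_μ g))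
  μ_unit g := by
    obtain ⟨g, rfl⟩ := Quotient.exists_rep g
    exact (coeqμ_mk s s' _ _ g fun _ => Λ.unit).trans (congrArg _ (Λ.μ_unit g))
  μ_assoc n q hq f g h := by
    obtain ⟨f, rfl⟩ := coeqCon_exists_rep s s' f
    obtain ⟨g, rfl⟩ := coeqCon_exists_family s s' g
    obtain ⟨h, rfl⟩ := coeqCon_exists_family s s' h
    simp only [coeqμ_mk]
    exact congrArg _ (Λ.μ_assoc n q hq f g h)
  π_μ k h g f := by
    obtain ⟨g, rfl⟩ := Quotient.exists_rep g
    obtain ⟨f, rfl⟩ := coeqCon_exists_family s s' f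
    exact (congrArg _ (coeqμ_mk s s' k h g f)).trans (Λ.π_μ k h g f)
  μ_mul_μ k h g g' f h' f' := by
    obtain ⟨g, rfl⟩ := Quotient.exists_rep g
    obtain ⟨g', rfl⟩ := Quotient.exists_rep g'
    obtain ⟨f, rfl⟩ := coeqCon_exists_family s s' f
    obtain ⟨f', rfl⟩ := coeqCon_exists_family s s' (k := fun i => k (Λ.π _ g' i)) f'
    refine (congrArg₂ (· * ·) (coeqμ_mk s s' k h g f) (coeqμ_mk s s' _ h' g' f')).trans ?_
    refine Eq.trans ?_ (coeqμ_mk s s' _ h' (g * g') (fun i => f (Λ.π _ g' i) * f' i)).symm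
    exact congrArg _ (Λ.μ_mul_μ k h g g' f h' f')

/-- The projection onto the coequalizer. -/
noncomputable def coeqProj : Λ ⟶ coeq s s' where
  app n := (coeqCon s s' n).mk'
  app_π _ _ := rfl
  app_unit := rfl
  app_μ k h g f := (coeqμ_mk s s' k h g f).symm

theorem coeqProj_surjective (n : ℕ) : Function.Surjective ((coeqProj s s').app n) :=
  Con.mk'_surjective

theorem coeq_condition : s ≫ coeqProj s s' = s' ≫ coeqProj s s' :=
  hom_ext_app fun n g => (coeqCon_mk_eq s s').2 fun Λ' F e =>
    congrArg (fun F : Θ ⟶ Λ' => F.app n g) e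

/-- The map out of the coequalizer induced by a map that coequalizes `s` and `s'`. -/
noncomputable def coeqDesc {Λ' : ActionOperad.{u}} (F : Λ ⟶ Λ') (e : s ≫ F = s' ≫ F) :
    coeq s s' ⟶ Λ' where
  app n := Con.lift _ (F.app n) fun a b h => h Λ' F e
  app_π n g := by
    obtain ⟨g, rfl⟩ := Quotient.exists_rep g
    exact F.app_π n g
  app_unit := F.app_unit
  app_μ k h g f := by
    obtain ⟨g, rfl⟩ := Quotient.exists_rep g
    obtain ⟨f, rfl⟩ := coeqCon_exists_family s s' f
    exact (congrArg _ (coeqμ_mk s s' k h g f)).trans (F.app_μ k h g f)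

/-- `coeq s s'` is a coequalizer of `s` and `s'`. -/
noncomputable def coeqIsColimit :
    IsColimit (Cofork.ofπ (coeqProj s s') (coeq_condition s s')) :=
  Cofork.IsColimit.mk _ (fun c => coeqDesc s s' c.π c.condition) (fun c => rfl)
    (fun c m hm => hom_ext_app fun n g => by
      obtain ⟨g, rfl⟩ := coeqProj_surjective s s' n g
      exact congrArg (fun F : Λ ⟶ c.pt => F.app n g) hm)

variable {s s'}

/-- Every coequalizer of action operads is levelwise surjective, because one of them is. -/
theorem surjective_of_isColimit {Λ' : ActionOperad.{u}} {p : Λ ⟶ Λ'} {e : s ≫ p = s' ≫ p}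
    (hp : IsColimit (Cofork.ofπ p e)) (n : ℕ) : Function.Surjective (p.app n) := by
  intro g
  let i := (coeqIsColimit s s').desc (Cofork.ofπ p e)
  let j := hp.desc (Cofork.ofπ (coeqProj s s') (coeq_condition s s'))
  have hi : coeqProj s s' ≫ i = p :=
    (coeqIsColimit s s').fac (Cofork.ofπ p e) WalkingParallelPair.one
  have hj : p ≫ j = coeqProj s s' :=
    hp.fac (Cofork.ofπ (coeqProj s s') (coeq_condition s s')) WalkingParallelPair.one
  have hji : j ≫ i = 𝟙 Λ' := Cofork.IsColimit.hom_ext hp (by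
    change p ≫ j ≫ i = p ≫ 𝟙 _
    rw [← Category.assoc, hj, hi, Category.comp_id])
  obtain ⟨a, ha⟩ := coeqProj_surjective s s' n (j.app n g)
  refine ⟨a, ?_⟩
  rw [← hi, comp_app, ha]
  exact congrArg (fun F : Λ' ⟶ Λ' => F.app n g) hji

end

end ActionOperad

/-! ### Presentations by formal composites -/

/-- A map out of a free action operad sends a formal composite to its value at the images of the
generators. -/
theorem FormalComposite.app_toFree {G : SymColl.{u}} {Λ : ActionOperad.{u}}
    (F : ActionOperad.free G ⟶ Λ) (φ : G.HomTo Λ)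
    (h : ∀ x, F.app _ (FormalComposite.gen x).toFree = φ.app x) {n : ℕ}
    (t : FormalComposite G n) : F.app n t.toFree = t.eval φ := by
  obtain rfl : F = ActionOperad.free.lift φ :=
    (ActionOperad.free_universal G Λ φ).unique h fun _ => rfl
  rfl

/-- The map `p` presents the action operad `Λ` by the generators `G` and the equations `E` between
formal composites: every element of `Λ` is the value of a formal composite, the equations hold in
`Λ`, and the interpretations of the generators that satisfy the equations extend to `Λ`. -/
structure ActionOperad.Presents {G : SymColl.{u}} {Λ : ActionOperad.{u}}
    (p : ActionOperad.free G ⟶ Λ)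
    (E : ∀ {n : ℕ}, FormalComposite G n → FormalComposite G n → Prop) : Prop where
  surjective : ∀ {n : ℕ} (g : Λ.carrier n), ∃ t : FormalComposite G n, p.app n t.toFree = g
  sound : ∀ {n : ℕ} (t₁ t₂ : FormalComposite G n), E t₁ t₂ →
    p.app n t₁.toFree = p.app n t₂.toFree
  exists_hom : ∀ (Λ' : ActionOperad.{u}) (φ : G.HomTo Λ'),
    (∀ {n : ℕ} (t₁ t₂ : FormalComposite G n), E t₁ t₂ → t₁.eval φ = t₂.eval φ) →
      ∃ q : Λ ⟶ Λ', ∀ {n : ℕ} (t : FormalComposite G n), q.app n (p.app n t.toFree) = t.eval φ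

/-- A coequalizer of maps between free action operads presents its target, by any set of equations
that relates only values of the two maps, and relates their values at every generator. -/
theorem ActionOperad.presents_of_isColimit {G R : SymColl.{u}} {Λ : ActionOperad.{u}}
    {s₁ s₂ : ActionOperad.free R ⟶ ActionOperad.free G} {p : ActionOperad.free G ⟶ Λ}
    {h : s₁ ≫ p = s₂ ≫ p} (hp : IsColimit (Cofork.ofπ p h))
    {E : ∀ {n : ℕ}, FormalComposite G n → FormalComposite G n → Prop}
    (hE : ∀ {n : ℕ} (t₁ t₂ : FormalComposite G n), E t₁ t₂ →
      ∃ a, t₁.toFree = s₁.app n a ∧ t₂.toFree = s₂.app n a)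
    (hE' : ∀ y : R.carrier, ∃ t₁ t₂ : FormalComposite G (R.arity y), E t₁ t₂ ∧
      t₁.toFree = s₁.app _ (FormalComposite.gen y).toFree ∧
      t₂.toFree = s₂.app _ (FormalComposite.gen y).toFree) : Presents p E where
  surjective g := by
    obtain ⟨a, rfl⟩ := surjective_of_isColimit hp _ g
    obtain ⟨t, rfl⟩ := FormalComposite.toFree_surjective a
    exact ⟨t, rfl⟩
  sound t₁ t₂ e := by
    obtain ⟨a, h₁, h₂⟩ := hE t₁ t₂ e
    rw [h₁, h₂]
    exact congrArg (fun F : ActionOperad.free R ⟶ Λ => F.app _ a) h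
  exists_hom Λ' φ hφ := by
    have w : s₁ ≫ free.lift φ = s₂ ≫ free.lift φ := by
      let ψ : R.HomTo Λ' := ⟨fun y => (s₁ ≫ free.lift φ).app _ (FormalComposite.gen y).toFree,
        fun y => (s₁ ≫ free.lift φ).app_π _ _⟩
      refine (free_universal R Λ' ψ).unique (fun y => rfl) fun y => ?_
      obtain ⟨t₁, t₂, e, h₁, h₂⟩ := hE' y
      change (free.lift φ).app _ (s₂.app _ _) = (free.lift φ).app _ (s₁.app _ _)
      rw [← h₁, ← h₂]
      exact (hφ _ _ e).symm
    refine ⟨hp.desc (Cofork.ofπ (free.lift φ) w), fun {n} t => ?_⟩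
    have := hp.fac (Cofork.ofπ (free.lift φ) w) WalkingParallelPair.one
    exact congrArg (fun F : ActionOperad.free G ⟶ Λ' => F.app n t.toFree) this

theorem Presentation.presents {Λ : ActionOperad.{u}} (P : Presentation Λ) :
    ActionOperad.Presents P.p P.Eqn :=
  ActionOperad.presents_of_isColimit P.isColimit
    (by rintro n _ _ ⟨y, t₁, t₂, h₁, h₂⟩; exact ⟨_, h₁, h₂⟩)
    (fun y => by
      obtain ⟨t₁, h₁⟩ := FormalComposite.toFree_surjective
        (P.s₁.app _ (FormalComposite.gen y).toFree)
      obtain ⟨t₂, h₂⟩ := FormalComposite.toFree_surjective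
        (P.s₂.app _ (FormalComposite.gen y).toFree)
      exact ⟨t₁, t₂, .intro y t₁ t₂ h₁ h₂, h₁, h₂⟩)

theorem AxiomSet.presents {G : SymColl.{u}} (R : AxiomSet G) {Λ : ActionOperad.{u}}
    {p : ActionOperad.free G ⟶ Λ} {h : R.s₁ ≫ p = R.s₂ ≫ p}
    (hp : IsColimit (Cofork.ofπ p h)) : ActionOperad.Presents p R.Eqn :=
  ActionOperad.presents_of_isColimit hp
    (by rintro n _ _ ⟨r⟩; exact ⟨(FormalComposite.gen (G := R.coll) r).toFree, rfl, rfl⟩)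
    (fun r => ⟨R.lhs r, R.rhs r, .intro r, rfl, rfl⟩)

/-! ### Unbiased monoids -/

/-- A monoid in unbiased form: an `n`-fold multiplication `act n` for every `n`, such that the
multiplication of one element is trivial and a product may be computed in blocks. -/
structure UnbiasedMonoid (M : Type w) where
  act : ∀ n, (Fin n → M) → M
  act_one : ∀ x : Fin 1 → M, act 1 x = x 0
  act_blk : ∀ {n : ℕ} (k : Fin n → ℕ) (x : Fin (∑ i, k i) → M),
    act (∑ i, k i) x = act n (fun i => act (k i) (fun j => x (blk k rfl ⟨i, j⟩)))

namespace UnbiasedMonoid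

variable {M : Type w} (A : UnbiasedMonoid M)

/-- A product may be cut in two. -/
theorem act_add {m n N : ℕ} (h : m + n = N) (x : Fin N → M) :
    A.act N x = A.act 2 ![A.act m (fun i => x ⟨i, by omega⟩),
      A.act n (fun i => x ⟨m + i, by omega⟩)] := by
  obtain rfl : ∑ i, ![m, n] i = N := by rw [← h, Fin.sum_univ_two]; rfl
  rw [A.act_blk]
  refine congrArg (A.act 2) (funext ((Fin.forall_fin_two).2 ⟨?_, ?_⟩))
  · refine congrArg (A.act m) (funext fun j => congrArg x (Fin.ext ?_))
    simp [blk_val]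
  · refine congrArg (A.act n) (funext fun j => congrArg x (Fin.ext ?_))
    simp [blk_val]

theorem act_congr {n : ℕ} {x y : Fin n → M} (h : ∀ i, x i = y i) : A.act n x = A.act n y := by
  rw [funext h]

theorem assoc (a b c : M) :
    A.act 2 ![A.act 2 ![a, b], c] = A.act 2 ![a, A.act 2 ![b, c]] := by
  have h₁ := A.act_add (m := 2) (n := 1) rfl ![a, b, c]
  have h₂ := A.act_add (m := 1) (n := 2) rfl ![a, b, c]
  rw [A.act_one] at h₁ h₂
  refine Eq.trans ?_ ((h₁.symm.trans h₂).trans ?_)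
  · refine A.act_congr ((Fin.forall_fin_two).2 ⟨A.act_congr ?_, rfl⟩)
    exact (Fin.forall_fin_two).2 ⟨rfl, rfl⟩
  · refine A.act_congr ((Fin.forall_fin_two).2 ⟨rfl, A.act_congr ?_⟩)
    exact (Fin.forall_fin_two).2 ⟨rfl, rfl⟩

theorem unit_act (x : Fin 0 → M) (a : M) : A.act 2 ![A.act 0 x, a] = a := by
  have h := A.act_add (m := 0) (n := 1) rfl (fun _ : Fin 1 => a)
  rw [A.act_one (fun _ => a)] at h
  rw [Subsingleton.elim x fun _ => a]
  exact h.symm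

theorem act_unit (x : Fin 0 → M) (a : M) : A.act 2 ![a, A.act 0 x] = a := by
  have h := A.act_add (m := 1) (n := 0) rfl (fun _ : Fin 1 => a)
  rw [A.act_one (fun _ => a)] at h
  rw [Subsingleton.elim x fun _ => a]
  exact h.symm

/-- The `n`-fold multiplications are determined by those with no factor and with two factors. -/
theorem act_eq_prodFin {e : M} {op : M → M → M} (he : ∀ x, A.act 0 x = e)
    (hop : ∀ a b, A.act 2 ![a, b] = op a b) (n : ℕ) (x : Fin n → M) :
    A.act n x = prodFin e op n x := by
  induction n with
  | zero => exact he x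
  | succ n ih =>
    rw [A.act_add (m := 1) (n := n) (add_comm 1 n), hop, A.act_one, ih]
    refine congrArg₂ op rfl (congrArg (prodFin e op n) (funext fun i => congrArg x (Fin.ext ?_)))
    exact add_comm 1 (i : ℕ)

end UnbiasedMonoid

/-! ### Families of morphisms over a permutation -/

/-- A family of endomorphisms, as a family over the permutation `σ`. -/
def Fam.ofEnd {X : Type w} [Category.{v} X] {m n : ℕ} {σ : Fin m ≃ Fin n} {y : Fin m → X}
    (e : ∀ i, y i ⟶ y i) : Fam σ y (fun j => y (σ.symm j)) :=
  fun i j h => e i ≫ eqToHom (by subst h; simp)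

theorem Fam.mk_ofEnd {X : Type w} [Category.{v} X] {m n : ℕ} {σ : Fin m ≃ Fin n} {y : Fin m → X}
    (e : ∀ i, y i ⟶ y i) (i : Fin m) (j : Fin n) (h : σ i = j) :
    Arrow.mk (Fam.ofEnd (σ := σ) e i j h) = Arrow.mk (e i) :=
  Arrow.arrow_mk_comp_eqToHom _ _

theorem Fam.mk_ofHoms {X : Type w} [Category.{v} X] {n : ℕ} {σ : Fin n ≃ Fin n} {x y : Fin n → X}
    (hσ : σ = Equiv.refl _) (f : ∀ i, x i ⟶ y i) (i j : Fin n) (h : σ i = j) :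
    Arrow.mk (Fam.ofHoms hσ f i j h) = Arrow.mk (f i) :=
  Arrow.arrow_mk_comp_eqToHom _ _

theorem Fam.mk_ofEq {X : Type w} [Category.{v} X] {m n : ℕ} {σ : Fin m ≃ Fin n} {x : Fin m → X}
    {y : Fin n → X} (h : ∀ i j, σ i = j → x i = y j) (i : Fin m) (j : Fin n) (e : σ i = j) :
    Arrow.mk (Fam.ofEq h i j e) = Arrow.mk (𝟙 (x i)) :=
  Arrow.mk_eqToHom _

theorem Fam.mk_eq {X : Type w} [Category.{v} X] {m n : ℕ} {σ : Fin m ≃ Fin n} {x : Fin m → X}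
    {y : Fin n → X} (g : Fam σ x y) {i i' : Fin m} {j j' : Fin n} (hi : i = i') (h : σ i = j)
    (h' : σ i' = j') : Arrow.mk (g i j h) = Arrow.mk (g i' j' h') := by
  subst hi h h'
  rfl

/-! ### Substitution in a club, up to equality of arrows -/

namespace Club

variable {K : Club.{w, v}}

theorem subst_eq_of_eq {a a' : K.Obj} (h : a = a') {y : Fin (K.arity a) → K.Obj}
    {y' : Fin (K.arity a') → K.Obj}
    (hy : ∀ (i : Fin (K.arity a)) (i' : Fin (K.arity a')), (i : ℕ) = i' → y i = y' i') :
    K.subst a y = K.subst a' y' := by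
  subst h
  exact congrArg _ (funext fun i => hy i i rfl)

theorem subst_of_eq_one {a : K.Obj} (h : a = K.one) {y : Fin (K.arity a) → K.Obj} {c : K.Obj}
    (hy : ∀ i, y i = c) : K.subst a y = c := by
  subst h
  obtain rfl : y = fun _ => c := funext hy
  exact K.one_subst c

/-- The permutations of morphisms that are equal as arrows have the same values. The arities need
not be definitionally equal, so the values are compared as natural numbers. -/
theorem perm_val_congr {a b a' b' : K.Obj} {f : a ⟶ b} {f' : a' ⟶ b'}
    (h : Arrow.mk f = Arrow.mk f') {i : Fin (K.arity a)} {i' : Fin (K.arity a')}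
    (hi : (i : ℕ) = i') : (K.perm f i : ℕ) = K.perm f' i' := by
  obtain ⟨rfl, rfl, h⟩ := (Arrow.mk_eq_mk_iff _ _).1 h
  simp only [eqToHom_refl, Category.id_comp, Category.comp_id] at h
  subst h
  rw [Fin.ext hi]

/-- Substitution respects equality of arrows, in both arguments. -/
theorem substHom_congr {a b a' b' : K.Obj} {f : a ⟶ b} {f' : a' ⟶ b'}
    {y : Fin (K.arity a) → K.Obj} {z : Fin (K.arity b) → K.Obj}
    {y' : Fin (K.arity a') → K.Obj} {z' : Fin (K.arity b') → K.Obj}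
    {g : Fam (K.perm f) y z} {g' : Fam (K.perm f') y' z'}
    (h : Arrow.mk f = Arrow.mk f')
    (hg : ∀ (i : Fin (K.arity a)) j hij (i' : Fin (K.arity a')) j' hij', (i : ℕ) = i' →
      Arrow.mk (g i j hij) = Arrow.mk (g' i' j' hij')) :
    Arrow.mk (K.substHom f g) = Arrow.mk (K.substHom f' g') := by
  obtain ⟨rfl, rfl, h⟩ := (Arrow.mk_eq_mk_iff _ _).1 h
  simp only [eqToHom_refl, Category.id_comp, Category.comp_id] at h
  subst h
  obtain rfl : y = y' := funext fun i => Arrow.left_eq (hg i _ rfl i _ rfl rfl)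
  obtain rfl : z = z' := funext fun j => Arrow.right_eq
    (hg ((K.perm f).symm j) j (by simp) ((K.perm f).symm j) j (by simp) rfl)
  obtain rfl : g = g' := funext fun i => funext fun j => funext fun hij =>
    Arrow.eq_of_mk_eq (hg i j hij i j hij rfl)
  rfl

end Club

/-! ### The operad of automorphisms of the tensor powers in a club -/

namespace Club.Tensor

variable {K : Club.{w, u}} (T : K.Tensor)

theorem pow_one : T.pow 1 = K.one := T.tensor_unit K.one

theorem mk_id_pow_one : Arrow.mk (𝟙 (T.pow 1)) = Arrow.mk (𝟙 K.one) :=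
  Arrow.mk_id_eq T.pow_one

/-- The permutation that underlies an automorphism of a tensor power. -/
def autPerm (n : ℕ) : Aut (T.pow n) →* Equiv.Perm (Fin n) where
  toFun f := (finCongr (T.arity_pow n).symm).trans
    ((K.perm f.hom).trans (finCongr (T.arity_pow n)))
  map_one' := by
    ext i
    change ((K.perm (𝟙 (T.pow n)) (Fin.cast (T.arity_pow n).symm i) : Fin _) : ℕ) = i
    rw [K.perm_id]
    rfl
  map_mul' f g := by
    ext i
    change ((K.perm (g.hom ≫ f.hom) (Fin.cast (T.arity_pow n).symm i) : Fin _) : ℕ) = _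
    rw [K.perm_comp]
    rfl

theorem autPerm_val {n : ℕ} (f : Aut (T.pow n)) (i : Fin n) (i' : Fin (K.arity (T.pow n)))
    (h : (i : ℕ) = i') : (T.autPerm n f i : ℕ) = K.perm f.hom i' := by
  change ((K.perm f.hom (Fin.cast (T.arity_pow n).symm i) : Fin _) : ℕ) = _
  congr 2
  exact Fin.ext h

/-- The operadic composition of automorphisms of tensor powers, given by substitution. -/
def autμ {n N : ℕ} (k : Fin n → ℕ) (h : ∑ i, k i = N) (f : Aut (T.pow n))
    (g : ∀ i, Aut (T.pow (k i))) : Aut (T.pow N) :=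
  let k' : Fin (K.arity (T.pow n)) → ℕ := fun i => k (Fin.cast (T.arity_pow n) i)
  let σ := K.perm f.hom
  have hk' : ∑ i, k' i = N := (Tensor.sum_cast (T.arity_pow n) k).trans h
  eqToIso (T.subst_pow_pow k' hk').symm ≪≫
    Club.substIso (y := fun i => T.pow (k' i)) (y' := fun i => T.pow (k' (σ.symm i))) f
      (fun i j e => (g (Fin.cast (T.arity_pow n) i) : T.pow (k' i) ≅ T.pow (k' i)) ≪≫
        eqToIso (by rw [← e, Equiv.symm_apply_apply])) ≪≫
    eqToIso (T.subst_pow_pow (fun i => k' (σ.symm i)) ((σ.symm.sum_comp k').trans hk'))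

/-- `autμ` is the substitution of any family of arrows that agrees with the given one. -/
theorem mk_autμ {n N : ℕ} (k : Fin n → ℕ) (h : ∑ i, k i = N) (f : Aut (T.pow n))
    (g : ∀ i, Aut (T.pow (k i))) {a b : K.Obj} {f' : a ⟶ b} {y : Fin (K.arity a) → K.Obj}
    {z : Fin (K.arity b) → K.Obj} {g' : Fam (K.perm f') y z} (hf : Arrow.mk f.hom = Arrow.mk f')
    (hg : ∀ (i : Fin n) (i' : Fin (K.arity a)) j' h', (i : ℕ) = i' →
      Arrow.mk (g i).hom = Arrow.mk (g' i' j' h')) :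
    Arrow.mk (T.autμ k h f g).hom = Arrow.mk (K.substHom f' g') := by
  simp only [autμ, Iso.trans_hom, eqToIso.hom, Arrow.arrow_mk_eqToHom_comp,
    Arrow.arrow_mk_comp_eqToHom]
  refine substHom_congr hf fun i j e i' j' h' hi => ?_
  exact (Arrow.arrow_mk_comp_eqToHom (g (Fin.cast (T.arity_pow n) i)).hom
    (by rw [← e, Equiv.symm_apply_apply])).trans (hg (Fin.cast (T.arity_pow n) i) i' j' h' hi)

/-- A family of automorphisms of tensor powers, as a family over the permutation of `f`. -/
def autFam {n : ℕ} (k : Fin n → ℕ) (f : Aut (T.pow n)) (g : ∀ i, Aut (T.pow (k i))) :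
    Fam (K.perm f.hom) (fun i => T.pow (k (Fin.cast (T.arity_pow n) i)))
      (fun j => T.pow (k (Fin.cast (T.arity_pow n) ((K.perm f.hom).symm j)))) :=
  Fam.ofEnd (y := fun i => T.pow (k (Fin.cast (T.arity_pow n) i)))
    (fun i => (g (Fin.cast (T.arity_pow n) i)).hom)

theorem mk_autFam {n : ℕ} (k : Fin n → ℕ) (f : Aut (T.pow n)) (g : ∀ i, Aut (T.pow (k i)))
    (i : Fin n) (i' : Fin (K.arity (T.pow n))) (j' h') (hi : (i : ℕ) = i') :
    Arrow.mk (g i).hom = Arrow.mk (T.autFam k f g i' j' h') := by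
  obtain rfl : i = Fin.cast (T.arity_pow n) i' := Fin.ext hi
  exact (Arrow.arrow_mk_comp_eqToHom _ _).symm

theorem mk_autμ_eq {n N : ℕ} (k : Fin n → ℕ) (h : ∑ i, k i = N) (f : Aut (T.pow n))
    (g : ∀ i, Aut (T.pow (k i))) :
    Arrow.mk (T.autμ k h f g).hom = Arrow.mk (K.substHom f.hom (T.autFam k f g)) :=
  T.mk_autμ k h f g rfl fun i i' j' h' hi => T.mk_autFam k f g i i' j' h' hi

theorem aut_ext {n : ℕ} {f g : Aut (T.pow n)} (h : Arrow.mk f.hom = Arrow.mk g.hom) : f = g :=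
  Aut.ext (Arrow.eq_of_mk_eq h)

/-- The automorphisms of the tensor powers, as an action operad. -/
def autOperad : ActionOperad.{u} where
  carrier n := Aut (T.pow n)
  π := T.autPerm
  unit := Iso.refl _
  μ := T.autμ
  unit_μ {n} g := by
    apply T.aut_ext
    refine (T.mk_autμ _ _ _ _ (f' := 𝟙 K.one) (g' := fun _ _ _ => g.hom) T.mk_id_pow_one
      fun _ _ _ _ _ => rfl).trans (K.one_substHom _)
  μ_unit {n} g := by
    apply T.aut_ext
    refine (T.mk_autμ _ _ _ _ (f' := g.hom) (g' := fun _ _ _ => 𝟙 K.one) rfl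
      fun _ _ _ _ _ => T.mk_id_pow_one).trans (K.substHom_one _)
  μ_assoc {m N} n q hq f g h := by
    apply T.aut_ext
    have hs : K.arity (K.subst (T.pow m) fun i => T.pow (n (Fin.cast (T.arity_pow m) i))) =
        ∑ i, n i :=
      (congrArg K.arity (T.subst_pow_pow _ (Tensor.sum_cast (T.arity_pow m) n))).trans
        (T.arity_pow _)
    let H : Fam (K.perm (K.substHom f.hom (T.autFam n f g))) (fun l => T.pow (q (Fin.cast hs l)))
        _ := Fam.ofEnd (fun l => (h (Fin.cast hs l)).hom)
    have hH : ∀ (l : Fin (∑ i, n i)) (l' : Fin (K.arity (K.subst (T.pow m) _))) j' h',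
        (l : ℕ) = l' →
        Arrow.mk (h l).hom = Arrow.mk (H l' j' h') := by
      intro l l' j' h' hl
      obtain rfl : l = Fin.cast hs l' := Fin.ext hl
      exact (Arrow.arrow_mk_comp_eqToHom _ _).symm
    have e₂ := T.mk_autμ q hq (T.autμ n rfl f g) h (g' := H) (T.mk_autμ_eq n rfl f g) hH
    refine e₂.trans ((K.substHom_assoc f.hom _ H).trans (Eq.symm ?_))
    refine T.mk_autμ _ _ f _ rfl fun i i' j' h' hi => ?_
    refine T.mk_autμ _ _ (g i) _ (T.mk_autFam _ _ _ _ _ _ _ hi) fun l l' k' hk hl =>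
      hH _ _ _ _ ?_
    exact blk_val_congr (T.arity_pow m).symm (fun i => (T.arity_pow _).symm) _ _ hi hl
  π_μ {n N} k h f g := by
    ext x
    obtain ⟨⟨i, j⟩, rfl⟩ := (blk k h).surjective x
    let i' : Fin (K.arity (T.pow n)) := Fin.cast (T.arity_pow n).symm i
    let j' : Fin (K.arity (T.pow (k (Fin.cast (T.arity_pow n) i')))) :=
      Fin.cast (T.arity_pow _).symm j
    have e₂ : ((blk k h ⟨i, j⟩ : Fin N) : ℕ) =
        blk (fun i => K.arity (T.pow (k (Fin.cast (T.arity_pow n) i)))) (K.arity_subst _ _)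
          ⟨i', j'⟩ :=
      blk_val_congr (T.arity_pow n).symm (fun i => (T.arity_pow _).symm) _ _ rfl rfl
    rw [T.autPerm_val _ _ (Fin.cast (T.arity_pow N).symm (blk k h ⟨i, j⟩)) rfl, blockPerm_blk]
    rw [perm_val_congr (T.mk_autμ_eq k h f g) e₂, K.perm_substHom]
    have e₃ : ((T.autPerm n f i : Fin n) : ℕ) = K.perm f.hom i' := T.autPerm_val f i i' rfl
    have e₄ : ((T.autPerm _ (g i) j : Fin _) : ℕ) = K.perm (T.autFam k f g i' _ rfl) j' :=
      (T.autPerm_val (g i) j (Fin.cast (T.arity_pow _).symm j) rfl).trans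
        (perm_val_congr (T.mk_autFam k f g i i' _ _ rfl) rfl)
    refine (blk_val_congr (T.arity_pow n).symm (fun a => ?_) _ _ e₃ e₄).symm
    refine Eq.trans (congrArg k ?_) (T.arity_pow _).symm
    rw [Equiv.symm_apply_eq]
    apply Fin.ext
    rw [T.autPerm_val f _ ((K.perm f.hom).symm (Fin.cast (T.arity_pow n).symm a)) rfl]
    simp
  μ_mul_μ {n N} k h g g' f h' f' := by
    apply T.aut_ext
    let F' : Fam (K.perm g'.hom) (fun i => T.pow (k (T.autPerm n g' (Fin.cast (T.arity_pow n) i))))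
        (fun i => T.pow (k (Fin.cast (T.arity_pow n) i))) :=
      fun i j e => (f' (Fin.cast (T.arity_pow n) i)).hom ≫ eqToHom (by rw [← e]; rfl)
    have hF' : ∀ (i : Fin n) (i' : Fin (K.arity (T.pow n))) j' h', (i : ℕ) = i' →
        Arrow.mk (f' i).hom = Arrow.mk (F' i' j' h') := by
      intro i i' j' h' hi
      obtain rfl : i = Fin.cast (T.arity_pow n) i' := Fin.ext hi
      exact (Arrow.arrow_mk_comp_eqToHom _ _).symm
    refine (Arrow.mk_comp_congr (T.mk_autμ _ h' g' f' rfl hF') (T.mk_autμ_eq k h g f)).trans ?_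
    rw [K.substHom_comp]
    refine (T.mk_autμ _ h' (g * g') _ rfl fun i i' j' h' hi => ?_).symm
    refine Arrow.mk_comp_congr (hF' i i' _ rfl hi) (T.mk_autFam k g f _ _ _ _ ?_)
    exact T.autPerm_val g' i i' hi

end Club.Tensor

/-! ### Maps out of the club of an action operad -/

namespace FormalComposite

variable {G : SymColl.{u}} {Λ : ActionOperad.{u}} (p : ActionOperad.free G ⟶ Λ)

theorem app_unit : p.app 1 unit.toFree = 1 := (p.app_unit).trans Λ.unit_eq_one

theorem app_one (n : ℕ) : p.app n (one n).toFree = 1 := map_one (p.app n)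

theorem app_mul {n : ℕ} (t t' : FormalComposite G n) :
    p.app n (mul t t').toFree = p.app n t.toFree * p.app n t'.toFree :=
  map_mul (p.app n) t.toFree t'.toFree

theorem app_inv {n : ℕ} (t : FormalComposite G n) :
    p.app n (inv t).toFree = (p.app n t.toFree)⁻¹ :=
  map_inv (p.app n) t.toFree

theorem app_op {n N : ℕ} (k : Fin n → ℕ) (h : ∑ i, k i = N) (t : FormalComposite G n)
    (ts : ∀ i, FormalComposite G (k i)) :
    p.app N (op k h t ts).toFree =
      Λ.μ k h (p.app n t.toFree) (fun i => p.app (k i) (ts i).toFree) :=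
  (congrArg (p.app N) (freeμ_toFree k h t ts).symm).trans
    (p.app_μ k h t.toFree (fun i => (ts i).toFree))

theorem π_app {n : ℕ} (t : FormalComposite G n) : Λ.π n (p.app n t.toFree) = t.perm :=
  p.app_π n t.toFree

end FormalComposite

namespace ActionOperad

variable {Λ : ActionOperad.{u}}

theorem endo_one (n : ℕ) : endo (1 : Λ.carrier n) = 𝟙 (Λ.ob n) := rfl

theorem endo_mul {n : ℕ} (g g' : Λ.carrier n) : endo (g * g') = endo g' ≫ endo g := rfl

/-- An element of `Λ n`, as an automorphism of `n` in the club. -/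
def endoIso {n : ℕ} (g : Λ.carrier n) : Λ.ob n ≅ Λ.ob n where
  hom := endo g
  inv := endo g⁻¹
  hom_inv_id := by rw [← endo_mul, inv_mul_cancel, endo_one]
  inv_hom_id := by rw [← endo_mul, mul_inv_cancel, endo_one]

/-- The blocks of an operadic composite, as a family of morphisms of the club. -/
def endoFam {n : ℕ} (k : Fin n → ℕ) (g : Λ.carrier n) (f : ∀ i, Λ.carrier (k i)) :
    Fam (Λ.club.perm (endo g)) (fun i => Λ.ob (k i)) (fun i => Λ.ob (k ((Λ.π n g).symm i))) :=
  Fam.ofEnd (y := fun i => Λ.ob (k i)) fun i => endo (f i)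

theorem mk_endoFam {n : ℕ} (k : Fin n → ℕ) (g : Λ.carrier n) (f : ∀ i, Λ.carrier (k i)) (i j h) :
    Arrow.mk (endoFam k g f i j h) = Arrow.mk (endo (f i)) :=
  Fam.mk_ofEnd _ _ _ _

theorem elt_endoFam {n : ℕ} (k : Fin n → ℕ) (g : Λ.carrier n) (f : ∀ i, Λ.carrier (k i)) (i j h) :
    BHom.elt (endoFam k g f i j h) = f i := by
  subst h
  have key : ∀ {m n : ℕ} (e : m = n) (x : Λ.carrier m), BHom.elt (m := m) (n := n)
      (endo x ≫ eqToHom (X := Λ.ob m) (Y := Λ.ob n) e) = x := by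
    rintro m _ rfl x
    exact one_mul x
  exact key _ _

theorem mk_endo_μ {n N : ℕ} (k : Fin n → ℕ) (h : ∑ i, k i = N) (g : Λ.carrier n)
    (f : ∀ i, Λ.carrier (k i)) :
    Arrow.mk (endo (Λ.μ k h g f)) = Arrow.mk (Λ.club.substHom (endo g) (endoFam k g f)) := by
  subst h
  refine BHom.arrow_ext _ _ rfl ?_
  exact congrArg (Λ.μ k rfl g) (funext fun i => (elt_endoFam k g f i _ rfl).symm)

end ActionOperad

namespace Club

open ActionOperad

variable {K : Club.{w, u}} {Λ : ActionOperad.{u}}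

theorem Tensor.app_mul_hom {T : K.Tensor} (q : Λ ⟶ T.autOperad) {n : ℕ} (f g : Λ.carrier n) :
    (q.app n (g * f) : Aut (T.pow n)).hom =
      (q.app n f : Aut (T.pow n)).hom ≫ (q.app n g : Aut (T.pow n)).hom :=
  congrArg Iso.hom (map_mul (q.app n) g f)

/-- The map of clubs that corresponds to an action of `Λ` on the tensor powers. -/
def Tensor.homOfAut (T : K.Tensor) (q : Λ ⟶ T.autOperad) : Club.Hom Λ.club K where
  functor :=
    { obj := fun n => T.pow n
      map := fun {m n} f => (q.app m (BHom.elt f) : T.pow m ≅ T.pow m).hom ≫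
        eqToHom (congrArg T.pow (BHom.eq f))
      map_id := fun n => by
        refine (Category.comp_id _).trans ?_
        exact congrArg Iso.hom (map_one (q.app (show ℕ from n)))
      map_comp := fun {m n k} f g => by
        obtain ⟨rfl, f⟩ := f
        obtain ⟨rfl, g⟩ := g
        refine (Category.comp_id _).trans ((Tensor.app_mul_hom q f g).trans ?_)
        exact (congrArg₂ (· ≫ ·) (Category.comp_id _) (Category.comp_id _)).symm }
  arity_obj n := T.arity_pow n
  perm_map {m n} f i := by
    obtain ⟨rfl, f⟩ := f
    have := congrArg (fun σ : Equiv.Perm _ => σ (Fin.cast (T.arity_pow _) i)) (q.app_π m f)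
    refine Eq.trans (Fin.ext ?_) this
    exact perm_val_congr (i := i) (i' := i)
      (Arrow.arrow_mk_comp_eqToHom (show T.pow m ≅ T.pow m from q.app m f).hom rfl) rfl
  obj_one := T.pow_one
  obj_subst n k := (T.subst_pow_pow _ (Tensor.sum_cast (T.arity_pow n) k)).symm
  map_substHom {m n y y'} f g := by
    refine (Arrow.arrow_mk_comp_eqToHom _ _).trans ?_
    have e := q.app_μ y rfl (BHom.elt f) (fun i => BHom.elt (g i _ rfl))
    refine (congrArg (fun a : Aut (T.pow _) => Arrow.mk a.hom) e).trans ?_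
    refine T.mk_autμ y rfl _ _ (Arrow.arrow_mk_comp_eqToHom _ _).symm fun i i' j' h' hi => ?_
    obtain rfl : i = Fin.cast (T.arity_pow m) i' := Fin.ext hi
    have key : ∀ j' h',
        Arrow.mk (q.app _ (BHom.elt (g (Fin.cast (T.arity_pow m) i') _ rfl)) : Aut (T.pow _)).hom =
        Arrow.mk ((q.app _ (BHom.elt (g (Fin.cast (T.arity_pow m) i') j' h')) : Aut (T.pow _)).hom ≫
          eqToHom (congrArg T.pow (BHom.eq (g (Fin.cast (T.arity_pow m) i') j' h')))) := by
      rintro _ rfl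
      exact (Arrow.arrow_mk_comp_eqToHom _ _).symm
    exact key _ _

theorem Tensor.mk_homOfAut_map (T : K.Tensor) (q : Λ ⟶ T.autOperad) {n : ℕ} (g : Λ.carrier n) :
    Arrow.mk ((T.homOfAut q).functor.map (endo g)) = Arrow.mk (q.app n g : Aut (T.pow n)).hom :=
  Arrow.arrow_mk_comp_eqToHom _ _

namespace Hom

variable (F : Club.Hom Λ.club K)

/-- The objects of a club, with the multiplications given by the images of the objects of the club
of an action operad. -/
def unbiasedMonoid : UnbiasedMonoid K.Obj where
  act n y := K.subst (F.functor.obj (Λ.ob n)) (fun i => y (Fin.cast (F.arity_obj (Λ.ob n)) i))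
  act_one y := subst_of_eq_one F.obj_one fun i =>
    congrArg y (Subsingleton.elim (α := Fin 1) _ _)
  act_blk {n} k y := by
    have e := F.obj_subst (Λ.ob n) k
    let y' : Fin (K.arity (K.subst (F.functor.obj (Λ.ob n)) fun i =>
        F.functor.obj (k (Fin.cast (F.arity_obj (Λ.ob n)) i)))) → K.Obj :=
      fun i => y (Fin.cast ((congrArg K.arity e).symm.trans (F.arity_obj _)) i)
    refine (subst_eq_of_eq (y' := y') e fun i i' hi => congrArg y (Fin.ext hi)).trans ?_
    refine (K.subst_assoc _ _ _).trans ?_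
    refine congrArg _ (funext fun i => congrArg _ (funext fun j => congrArg y (Fin.ext ?_)))
    refine blk_val_congr (F.arity_obj (Λ.ob n)) (fun i => F.arity_obj _) ?_ rfl rfl rfl
    exact (Finset.sum_congr rfl fun i _ => F.arity_obj _).trans
      (Tensor.sum_cast (F.arity_obj (Λ.ob n)) k)

theorem unbiasedMonoid_act_one (n : ℕ) :
    F.unbiasedMonoid.act n (fun _ => K.one) = F.functor.obj (Λ.ob n) :=
  K.subst_one _

/-- The unit and the tensor product given by the images of the objects `0` and `2`. -/
def tensor : K.Tensor where
  unit := F.functor.obj (Λ.ob 0)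
  arity_unit := F.arity_obj _
  tensor := F.functor.obj (Λ.ob 2)
  arity_tensor := F.arity_obj _
  assoc a b c := F.unbiasedMonoid.assoc a b c
  unit_tensor a := by
    have := F.unbiasedMonoid.unit_act (fun _ => K.one) a
    rwa [unbiasedMonoid_act_one] at this
  tensor_unit a := by
    have := F.unbiasedMonoid.act_unit (fun _ => K.one) a
    rwa [unbiasedMonoid_act_one] at this

variable {F}

theorem obj_eq_pow {T : K.Tensor} (h₀ : F.functor.obj (Λ.ob 0) = T.unit)
    (h₂ : F.functor.obj (Λ.ob 2) = T.tensor) (n : ℕ) : F.functor.obj (Λ.ob n) = T.pow n := by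
  rw [← F.unbiasedMonoid_act_one]
  refine F.unbiasedMonoid.act_eq_prodFin (fun x => ?_) (fun a b => ?_) n _
  · rw [Subsingleton.elim x fun _ => K.one, unbiasedMonoid_act_one, h₀]
  · exact subst_eq_of_eq h₂ fun i i' hi => congrArg ![a, b] (Fin.ext hi)

end Hom

namespace Operations

variable {G : SymColl.{u}} (S : K.Operations G)

/-- The generators, as elements of the operad of automorphisms of the tensor powers. -/
def homTo : G.HomTo S.autOperad where
  app x := S.iso x
  app_π x := by
    ext i
    refine (S.autPerm_val (S.iso x) i (Fin.cast (S.arity_pow _).symm i) rfl).trans ?_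
    exact congrArg Fin.val (S.perm_iso x (Fin.cast (S.arity_pow _).symm i))

theorem eval_homTo {n : ℕ} (t : FormalComposite G n) : t.eval S.homTo = S.interp t := by
  induction t with
  | gen x => rfl
  | unit => rfl
  | one n => rfl
  | mul t t' h h' => exact congrArg₂ (fun a b : Aut (S.pow _) => a * b) h h'
  | inv t h => exact congrArg (fun a : Aut (S.pow _) => a⁻¹) h
  | op k h t ts ih ihs => exact congrArg₂ (S.autμ k h) ih (funext ihs)

theorem mk_interp_op {n N : ℕ} (k : Fin n → ℕ) (h : ∑ i, k i = N) (t : FormalComposite G n)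
    (ts : ∀ i, FormalComposite G (k i)) {a b : K.Obj} {f' : a ⟶ b} {y : Fin (K.arity a) → K.Obj}
    {z : Fin (K.arity b) → K.Obj} {g' : Fam (K.perm f') y z}
    (hf : Arrow.mk (S.interp t).hom = Arrow.mk f')
    (hg : ∀ (i : Fin n) (i' : Fin (K.arity a)) j' h', (i : ℕ) = i' →
      Arrow.mk (S.interp (ts i)).hom = Arrow.mk (g' i' j' h')) :
    Arrow.mk (S.interp (.op k h t ts)).hom = Arrow.mk (K.substHom f' g') :=
  S.mk_autμ k h (S.interp t) (fun i => S.interp (ts i)) hf hg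

theorem ext_mk {S S' : K.Operations G} (h₀ : S.unit = S'.unit) (h₂ : S.tensor = S'.tensor)
    (h : ∀ x, Arrow.mk (S.iso x).hom = Arrow.mk (S'.iso x).hom) : S = S' := by
  obtain ⟨T, iso, perm⟩ := S
  obtain ⟨T', iso', perm'⟩ := S'
  obtain rfl : T = T' := by
    obtain ⟨_, _, _, _, _, _, _⟩ := T
    obtain ⟨_, _, _, _, _, _, _⟩ := T'
    obtain rfl := h₀
    obtain rfl := h₂
    rfl
  obtain rfl : iso = iso' := funext fun x => Iso.ext (Arrow.eq_of_mk_eq (h x))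
  rfl

end Operations

section

variable {G : SymColl.{u}} {p : ActionOperad.free G ⟶ Λ} {F : Club.Hom Λ.club K}
  {S : K.Operations G}

theorem Hom.Realizes.obj_eq (h : F.Realizes p S) (n : ℕ) : F.functor.obj (Λ.ob n) = S.pow n :=
  Hom.obj_eq_pow h.obj_unit h.obj_tensor n

/-- A map of clubs that realizes `S` sends the value of a formal composite in `Λ` to its value
in `S`. -/
theorem Hom.Realizes.mk_map_endo (h : F.Realizes p S) {n : ℕ} (t : FormalComposite G n) :
    Arrow.mk (F.functor.map (endo (p.app n t.toFree))) = Arrow.mk (S.interp t).hom := by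
  induction t with
  | gen x => exact h.map_gen x
  | unit =>
    rw [FormalComposite.app_unit, endo_one, F.functor.map_id]
    exact Arrow.mk_id_eq (h.obj_eq 1)
  | one n =>
    rw [FormalComposite.app_one, endo_one, F.functor.map_id]
    exact Arrow.mk_id_eq (h.obj_eq n)
  | mul t t' ih ih' =>
    rw [FormalComposite.app_mul, endo_mul, F.functor.map_comp]
    exact Arrow.mk_comp_congr ih' ih
  | inv t ih =>
    refine Arrow.mk_eq_mk_inv ih ?_
    rw [← F.functor.map_comp, ← endo_mul, FormalComposite.app_inv, inv_mul_cancel, endo_one,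
      F.functor.map_id]
  | op k hk t ts ih ihs =>
    rw [FormalComposite.app_op]
    refine (Arrow.mk_map_congr F.functor (mk_endo_μ _ _ _ _)).trans ?_
    refine (F.map_substHom _ _).trans (S.mk_interp_op k hk t ts ih.symm ?_).symm
    intro i i' j' h' hi
    obtain rfl : i = Fin.cast (F.arity_obj _) i' := Fin.ext hi
    refine (ihs _).symm.trans (Arrow.mk_map_congr F.functor ?_)
    exact (mk_endoFam k _ (fun i => p.app (k i) (ts i).toFree) _ _ _).symm

/-- The tensor powers, with the images of the generators, form operations of the club. -/
noncomputable def Hom.operations (F : Club.Hom Λ.club K) (p : ActionOperad.free G ⟶ Λ) :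
    K.Operations G where
  toTensor := F.tensor
  iso x := eqToIso (Hom.obj_eq_pow (F := F) (T := F.tensor) rfl rfl _).symm ≪≫
    F.functor.mapIso (endoIso (p.app _ (FormalComposite.gen x).toFree)) ≪≫
    eqToIso (Hom.obj_eq_pow (F := F) (T := F.tensor) rfl rfl _)
  perm_iso x i := by
    have e : Arrow.mk (eqToHom (Hom.obj_eq_pow (F := F) (T := F.tensor) rfl rfl (G.arity x)).symm ≫
        F.functor.map (endo (p.app _ (FormalComposite.gen x).toFree)) ≫
        eqToHom (Hom.obj_eq_pow (F := F) (T := F.tensor) rfl rfl (G.arity x))) =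
        Arrow.mk (F.functor.map (endo (p.app _ (FormalComposite.gen x).toFree))) := by
      rw [Arrow.arrow_mk_eqToHom_comp, Arrow.arrow_mk_comp_eqToHom]
    let i' : Fin (K.arity (F.functor.obj (Λ.ob (G.arity x)))) :=
      Fin.cast ((F.tensor.arity_pow _).trans (F.arity_obj _).symm) i
    apply Fin.ext
    refine (perm_val_congr e (i' := i') rfl).trans ?_
    refine (congrArg Fin.val
      (F.perm_map (endo (p.app _ (FormalComposite.gen x).toFree)) i')).trans ?_
    exact congrArg Fin.val (congrArg (fun σ : Equiv.Perm (Fin (G.arity x)) =>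
      σ (Fin.cast (F.tensor.arity_pow _) i)) (p.app_π _ (FormalComposite.gen x).toFree))

theorem Hom.realizes_operations (F : Club.Hom Λ.club K) (p : ActionOperad.free G ⟶ Λ) :
    F.Realizes p (F.operations p) where
  obj_unit := rfl
  obj_tensor := rfl
  map_gen x := by
    simp only [Hom.operations, Iso.trans_hom, eqToIso.hom, Arrow.arrow_mk_eqToHom_comp,
      Arrow.arrow_mk_comp_eqToHom]
    rfl

variable {E : ∀ {n : ℕ}, FormalComposite G n → FormalComposite G n → Prop}

theorem Hom.Realizes.satisfies (hp : Presents p E) (h : F.Realizes p S) : S.Satisfies E :=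
  fun t₁ t₂ e => Iso.ext (Arrow.eq_of_mk_eq (by
    rw [← h.mk_map_endo, ← h.mk_map_endo, hp.sound t₁ t₂ e]))

theorem Hom.existsUnique_operations (hp : Presents p E) (F : Club.Hom Λ.club K) :
    ∃! S : K.Operations G, S.Satisfies E ∧ F.Realizes p S := by
  refine ⟨F.operations p, ⟨(F.realizes_operations p).satisfies hp, F.realizes_operations p⟩, ?_⟩
  rintro S ⟨-, h⟩
  exact Operations.ext_mk h.obj_unit.symm h.obj_tensor.symm fun x =>
    (h.map_gen x).symm.trans ((F.realizes_operations p).map_gen x)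

theorem Hom.Realizes.unique (hp : Presents p E) {F' : Club.Hom Λ.club K} (h : F.Realizes p S)
    (h' : F'.Realizes p S) : F = F' := by
  refine Club.Hom.ext (Arrow.functor_ext fun m n f => ?_)
  obtain ⟨rfl, g⟩ := f
  obtain ⟨t, rfl⟩ := hp.surjective g
  exact (h.mk_map_endo t).trans (h'.mk_map_endo t).symm

theorem Operations.existsUnique_hom (hp : Presents p E) (S : K.Operations G)
    (hS : S.Satisfies E) : ∃! F : Club.Hom Λ.club K, F.Realizes p S := by
  obtain ⟨q, hq⟩ := hp.exists_hom S.autOperad S.homTo fun t₁ t₂ e => by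
    rw [S.eval_homTo, S.eval_homTo]
    exact hS t₁ t₂ e
  have h : (S.homOfAut q).Realizes p S :=
    { obj_unit := rfl
      obj_tensor := by
        change S.tens K.one (S.tens K.one S.unit) = S.tensor
        rw [show S.tens K.one S.unit = K.one from S.tensor_unit K.one]
        refine Eq.trans ?_ (K.subst_one S.tensor)
        refine congrArg _ (funext fun i => ?_)
        generalize Fin.cast S.arity_tensor i = j
        fin_cases j <;> rfl
      map_gen := fun x => by
        refine (S.mk_homOfAut_map q _).trans ?_
        exact congrArg (fun a : Aut (S.pow _) => Arrow.mk a.hom) (hq (.gen x)) }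
  exact ⟨_, h, fun F' h' => h'.unique hp h⟩

end

end Club

/-! ### Tensor products of arrows in a strict monoidal category -/

namespace StrictMonoidal

variable {X : Type w} [Category.{v} X] (S : StrictMonoidal X)

/-- The tensor product of two arrows. -/
def tensArr (a b : Arrow X) : Arrow X :=
  Arrow.mk (S.tensor.map (X := (a.left, b.left)) (Y := (a.right, b.right)) (a.hom, b.hom))

/-- The tensor product of `n` arrows. -/
def prodArr (n : ℕ) (u : Fin n → Arrow X) : Arrow X :=
  Arrow.mk (S.prodMap n (fun i => (u i).hom))

theorem prodArr_eq_prodFin (n : ℕ) (u : Fin n → Arrow X) :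
    S.prodArr n u = prodFin (Arrow.mk (𝟙 S.unit)) S.tensArr n u := by
  induction n with
  | zero => rfl
  | succ n ih => exact congrArg (S.tensArr (u 0)) (ih fun i => u i.succ)

theorem tensArr_assoc (a b c : Arrow X) :
    S.tensArr (S.tensArr a b) c = S.tensArr a (S.tensArr b c) :=
  Arrow.mk_map_of_functor_eq S.assoc (a := ((a.left, b.left), c.left))
    (b := ((a.right, b.right), c.right)) ((a.hom, b.hom), c.hom)

theorem unit_tensArr (a : Arrow X) : S.tensArr (Arrow.mk (𝟙 S.unit)) a = a :=
  Arrow.mk_map_of_functor_eq S.unit_tensor a.hom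

theorem tensArr_unit (a : Arrow X) : S.tensArr a (Arrow.mk (𝟙 S.unit)) = a :=
  Arrow.mk_map_of_functor_eq S.tensor_unit a.hom

theorem prodArr_blk {n N : ℕ} (k : Fin n → ℕ) (h : ∑ i, k i = N) (u : Fin N → Arrow X) :
    S.prodArr n (fun i => S.prodArr (k i) (fun j => u (blk k h ⟨i, j⟩))) = S.prodArr N u := by
  simp only [prodArr_eq_prodFin]
  exact prodFin_blk _ _ S.tensArr_assoc S.unit_tensArr k h u

theorem prodArr_one (u : Fin 1 → Arrow X) : S.prodArr 1 u = u 0 := S.tensArr_unit _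

theorem prod_one (x : Fin 1 → X) : S.prod 1 x = x 0 := Functor.congr_obj S.tensor_unit (x 0)

theorem prodArr_id (n : ℕ) (x : Fin n → X) :
    S.prodArr n (fun i => Arrow.mk (𝟙 (x i))) = Arrow.mk (𝟙 (S.prod n x)) :=
  congrArg Arrow.mk (S.prodMap_id n x)

theorem prodArr_congr {n : ℕ} {u u' : Fin n → Arrow X} (h : ∀ i, u i = u' i) :
    S.prodArr n u = S.prodArr n u' := congrArg _ (funext h)

theorem prod_congr {n : ℕ} {x x' : Fin n → X} (h : ∀ i, x i = x' i) :
    S.prod n x = S.prod n x' := congrArg _ (funext h)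

theorem prodArr_seq {n : ℕ} (u u' : Fin n → Arrow X) (h : ∀ i, (u i).right = (u' i).left) :
    S.prodArr n (fun i => Arrow.seq (u i) (u' i) (h i)) =
      Arrow.seq (S.prodArr n u) (S.prodArr n u') (S.prod_congr h) := by
  have e₁ : ∀ i, Arrow.mk ((u i).hom ≫ eqToHom (h i)) = u i := fun i =>
    Arrow.arrow_mk_comp_eqToHom _ _
  refine Eq.trans ?_ (Arrow.mk_comp_eq_seq (f := S.prodMap n fun i => (u i).hom ≫ eqToHom (h i))
    (g := S.prodMap n fun i => (u' i).hom) (S.prodArr_congr e₁) rfl)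
  rw [← S.prodMap_comp]
  exact S.prodArr_congr fun i => congrArg Arrow.mk (Category.assoc _ _ _).symm

theorem isIso_prodArr {n : ℕ} (u : Fin n → Arrow X) (h : ∀ i, IsIso (u i).hom) :
    IsIso (S.prodArr n u).hom :=
  (S.prodIso n (fun i => asIso (u i).hom)).isIso_hom

end StrictMonoidal

/-! ### The operad of natural isomorphisms between permuted tensor products -/

/-- A natural isomorphism `x₁ ⊗ ⋯ ⊗ xₙ ≅ x_{σ⁻¹(1)} ⊗ ⋯ ⊗ x_{σ⁻¹(n)}`, with `σ = perm`, given by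
its components as arrows of the category. -/
structure PermNatIso {X : Type w} [Category.{v} X] (S : StrictMonoidal X) (n : ℕ) where
  perm : Equiv.Perm (Fin n)
  val : (Fin n → X) → Arrow X
  val_left : ∀ x, (val x).left = S.prod n x
  val_right : ∀ x, (val x).right = S.prod n (fun i => x (perm.symm i))
  natural : ∀ u : Fin n → Arrow X,
    Arrow.seq (S.prodArr n u) (val (fun i => (u i).right)) (val_left _).symm =
      Arrow.seq (val (fun i => (u i).left)) (S.prodArr n (fun i => u (perm.symm i))) (val_right _)
  isIso : ∀ x, IsIso (val x).hom

namespace PermNatIso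

variable {X : Type w} [Category.{v} X] {S : StrictMonoidal X}

attribute [instance] PermNatIso.isIso

theorem ext_val {n : ℕ} {f g : PermNatIso S n} (h : f.perm = g.perm)
    (h' : ∀ x, f.val x = g.val x) : f = g := by
  obtain ⟨σ, val, _, _, _, _⟩ := f
  obtain ⟨τ, val', _, _, _, _⟩ := g
  obtain rfl : σ = τ := h
  obtain rfl : val = val' := funext h'
  rfl

theorem val_congr {n : ℕ} (f : PermNatIso S n) {x y : Fin n → X} (h : ∀ i, x i = y i) :
    f.val x = f.val y := congrArg _ (funext h)

/-- The identity of `x₁ ⊗ ⋯ ⊗ xₙ`. -/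
def id (S : StrictMonoidal X) (n : ℕ) : PermNatIso S n where
  perm := 1
  val x := Arrow.mk (𝟙 (S.prod n x))
  val_left _ := rfl
  val_right _ := rfl
  natural u := (Arrow.seq_id _ _ _).trans (Arrow.id_seq _ _ _).symm
  isIso x := inferInstanceAs (IsIso (𝟙 _))

/-- The composite of two natural isomorphisms. -/
def mul {n : ℕ} (f g : PermNatIso S n) : PermNatIso S n where
  perm := f.perm * g.perm
  val x := Arrow.seq (g.val x) (f.val (fun i => x (g.perm.symm i)))
    ((g.val_right x).trans (f.val_left _).symm)
  val_left x := g.val_left x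
  val_right x := f.val_right _
  natural u := by
    have e₁ := g.natural u
    have e₂ := f.natural fun i => u (g.perm.symm i)
    refine (Arrow.seq_assoc _ _ _ (g.val_left _).symm
      ((g.val_right _).trans (f.val_left _).symm)).symm.trans ?_
    refine (Arrow.seq_congr_left e₁ _ _).trans ?_
    refine (Arrow.seq_assoc _ _ _ _ _).trans ?_
    refine (Arrow.seq_congr_right _ e₂ _).trans ?_
    exact (Arrow.seq_assoc _ _ _ _ _).symm
  isIso x := Arrow.isIso_seq _ _ _ (g.isIso x) (f.isIso _)

/-- The inverse of a natural isomorphism. -/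
noncomputable def inv {n : ℕ} (f : PermNatIso S n) : PermNatIso S n where
  perm := f.perm⁻¹
  val x := (f.val (fun i => x (f.perm i))).inverse
  val_left x := (f.val_right _).trans (S.prod_congr fun i => congrArg x (by simp))
  val_right x := f.val_left _
  natural u := by
    refine Arrow.seq_inverse_of_seq_eq (h := (f.val_left _).symm) (h' := (f.val_right _).trans
      (S.prod_congr fun i => congrArg (fun i => (u i).left) (by simp))) ?_ _ _
    refine (f.natural fun i => u (f.perm i)).trans (Arrow.seq_congr rfl ?_)
    exact S.prodArr_congr fun i => congrArg u (by simp)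
  isIso x := by
    have := f.isIso (fun i => x (f.perm i))
    exact inferInstanceAs (IsIso (CategoryTheory.inv (f.val _).hom))

instance (n : ℕ) : Mul (PermNatIso S n) := ⟨mul⟩

instance (n : ℕ) : One (PermNatIso S n) := ⟨id S n⟩

noncomputable instance (n : ℕ) : Inv (PermNatIso S n) := ⟨inv⟩

theorem val_mul {n : ℕ} (f g : PermNatIso S n) (x : Fin n → X) :
    (f * g).val x = Arrow.seq (g.val x) (f.val (fun i => x (g.perm.symm i)))
      ((g.val_right x).trans (f.val_left _).symm) := rfl

noncomputable instance (n : ℕ) : Group (PermNatIso S n) :=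
  Group.ofLeftAxioms
    (fun a b c => ext_val rfl fun x => (Arrow.seq_assoc _ _ _ _ _).symm)
    (fun a => ext_val rfl fun x => Arrow.seq_id _ _ _)
    (fun a => ext_val (inv_mul_cancel a.perm) fun x => by
      have e : ∀ y (hy : y = x) (h : (a.val x).right = (a.val y).inverse.left),
          Arrow.seq (a.val x) (a.val y).inverse h = Arrow.mk (𝟙 (S.prod n x)) := by
        rintro _ rfl h
        exact (Arrow.seq_inverse _).trans (Arrow.mk_id_eq (a.val_left _))
      exact e _ (funext fun i => congrArg x (a.perm.symm_apply_apply i)) _)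

/-- The operadic composition: the `i`-th block is permuted by `g i`, then `f` permutes the
blocks. -/
def μ {n N : ℕ} (k : Fin n → ℕ) (h : ∑ i, k i = N) (f : PermNatIso S n)
    (g : ∀ i, PermNatIso S (k i)) : PermNatIso S N where
  perm := blockPerm k h f.perm (fun i => (g i).perm)
  val x := Arrow.seq (S.prodArr n (fun i => (g i).val (fun j => x (blk k h ⟨i, j⟩))))
    (f.val (fun i => S.prod (k i) (fun j => x (blk k h ⟨i, (g i).perm.symm j⟩))))
    ((S.prod_congr fun i => (g i).val_right _).trans (f.val_left _).symm)
  val_left x := (S.prod_congr fun i => (g i).val_left _).trans (S.prod_prod k h x)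
  val_right x := by
    refine (f.val_right _).trans ?_
    refine Eq.trans ?_ (S.prod_prod (fun i => k (f.perm.symm i))
      ((f.perm.symm.sum_comp k).trans h) _)
    refine S.prod_congr fun i => S.prod_congr fun j => ?_
    exact congrArg x (blockPerm_symm_blk k h f.perm (fun i => (g i).perm) _ i j).symm
  natural u := by
    let u' : ∀ i, Fin (k i) → Arrow X := fun i j => u (blk k h ⟨i, j⟩)
    have e₁ := fun i => (g i).natural (u' i)
    have e₂ := f.natural fun i => S.prodArr (k i) fun j => u' i ((g i).perm.symm j)
    have e₃ : S.prodArr n (fun i => S.prodArr (k i) (u' i)) = S.prodArr N u := S.prodArr_blk k h u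
    have e₄ : S.prodArr n (fun i => S.prodArr (k (f.perm.symm i)) fun j =>
        u' _ ((g (f.perm.symm i)).perm.symm j)) =
        S.prodArr N (fun i => u ((blockPerm k h f.perm fun i => (g i).perm).symm i)) := by
      rw [← S.prodArr_blk (fun i => k (f.perm.symm i)) ((f.perm.symm.sum_comp k).trans h)]
      refine S.prodArr_congr fun i => S.prodArr_congr fun j => ?_
      exact congrArg u (blockPerm_symm_blk k h f.perm (fun i => (g i).perm) _ i j).symm
    have e₅ := (S.prodArr_seq _ _ fun i => ((g i).val_left _).symm).symm.trans
      ((S.prodArr_congr e₁).trans (S.prodArr_seq _ _ fun i => (g i).val_right _))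
    refine (Arrow.seq_congr_left e₃.symm _ _).trans ?_
    refine (Arrow.seq_assoc _ _ _ (S.prod_congr fun i => ((g i).val_left _).symm) _).symm.trans ?_
    refine (Arrow.seq_congr_left e₅ _ ((S.prod_congr fun i => (g i).val_right _).trans
      (f.val_left _).symm)).trans ?_
    refine (Arrow.seq_assoc _ _ _ _ _).trans ?_
    refine (Arrow.seq_congr_right _ e₂ _).trans ?_
    refine (Arrow.seq_assoc _ _ _ ((S.prod_congr fun i => (g i).val_right _).trans
      (f.val_left _).symm) (f.val_right _)).symm.trans ?_
    exact Arrow.seq_congr rfl e₄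
  isIso x := Arrow.isIso_seq _ _ _ (S.isIso_prodArr _ fun i => (g i).isIso _) (f.isIso _)

theorem val_μ {n N : ℕ} (k : Fin n → ℕ) (h : ∑ i, k i = N) (f : PermNatIso S n)
    (g : ∀ i, PermNatIso S (k i)) (x : Fin N → X) :
    (μ k h f g).val x = Arrow.seq (S.prodArr n (fun i => (g i).val (fun j => x (blk k h ⟨i, j⟩))))
      (f.val (fun i => S.prod (k i) (fun j => x (blk k h ⟨i, (g i).perm.symm j⟩))))
      ((S.prod_congr fun i => (g i).val_right _).trans (f.val_left _).symm) := rfl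

theorem val_family_congr {n : ℕ} {k : Fin n → ℕ} (f : ∀ i, PermNatIso S (k i)) {i i' : Fin n}
    (hi : i = i') {x : Fin (k i) → X} {x' : Fin (k i') → X}
    (hx : ∀ (j : Fin (k i)) (j' : Fin (k i')), (j : ℕ) = j' → x j = x' j') :
    (f i).val x = (f i').val x' := by
  subst hi
  exact val_congr _ fun j => hx j j rfl

theorem μ_mul_μ {n N : ℕ} (k : Fin n → ℕ) (h : ∑ i, k i = N) (g g' : PermNatIso S n)
    (f : ∀ i, PermNatIso S (k i)) (h' : ∑ i, k (g'.perm i) = N)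
    (f' : ∀ i, PermNatIso S (k (g'.perm i))) :
    μ k h g f * μ (fun i => k (g'.perm i)) h' g' f' =
      μ (fun i => k (g'.perm i)) h' (g * g') (fun i => f (g'.perm i) * f' i) := by
  refine ext_val (blockPerm_mul k h g.perm g'.perm _ h' _) fun x => ?_
  have hb : ∀ (i : Fin n) (j : Fin (k i)),
      (blockPerm (fun i => k (g'.perm i)) h' g'.perm (fun i => (f' i).perm)).symm
        (blk k h ⟨i, j⟩) = blk (fun i => k (g'.perm i)) h' ⟨g'.perm.symm i,
          (f' (g'.perm.symm i)).perm.symm (Fin.cast (by simp) j)⟩ := by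
    intro i j
    rw [← blockPerm_symm_blk (fun i => k (g'.perm i)) h' g'.perm (fun i => (f' i).perm)
      ((g'.perm.symm.sum_comp fun i => k (g'.perm i)).trans h')]
    exact congrArg _ (blk_congr (fun i => by simp) _ _ rfl rfl)
  let u : Fin n → Arrow X := fun i => (f (g'.perm i)).val fun j =>
    x (blk (fun i => k (g'.perm i)) h' ⟨i, (f' i).perm.symm j⟩)
  have hu := g'.natural u
  have hR : ∀ i, u (g'.perm.symm i) = (f i).val fun j =>
      x ((blockPerm (fun i => k (g'.perm i)) h' g'.perm (fun i => (f' i).perm)).symm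
        (blk k h ⟨i, j⟩)) := by
    intro i
    refine val_family_congr f (g'.perm.apply_symm_apply i) fun j j' hj => congrArg x ?_
    rw [hb]
    exact congrArg (fun j => blk (fun i => k (g'.perm i)) h' ⟨g'.perm.symm i,
      (f' (g'.perm.symm i)).perm.symm j⟩) (Fin.ext hj)
  have hT : ∀ i, (u (g'.perm.symm i)).right = S.prod (k i) fun j =>
      x ((blockPerm (fun i => k (g'.perm i)) h' g'.perm (fun i => (f' i).perm)).symm
        (blk k h ⟨i, (f i).perm.symm j⟩)) := fun i =>
    (Arrow.right_eq (hR i)).trans ((f i).val_right _)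
  have hQ : (g'.val fun i => (u i).left) = g'.val fun i => S.prod (k (g'.perm i)) fun j =>
      x (blk (fun i => k (g'.perm i)) h' ⟨i, (f' i).perm.symm j⟩) :=
    val_congr _ fun i => (f (g'.perm i)).val_left _
  refine (Arrow.seq_seq_exchange ((Arrow.seq_congr hQ.symm
    (S.prodArr_congr fun i => (hR i).symm)).trans hu.symm) _ _).trans ?_
  refine Arrow.seq_congr (S.prodArr_seq _ _ _).symm (Arrow.seq_congr ?_ ?_)
  · exact val_congr _ fun i => (f (g'.perm i)).val_right _
  · exact val_congr _ fun i => (hT i).symm.trans ((f _).val_right _)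

/-- The permuting natural isomorphisms of tensor products, as an action operad. -/
noncomputable def operad {X : Type u} [Category.{u} X] (S : StrictMonoidal X) :
    ActionOperad.{u} where
  carrier n := PermNatIso S n
  π n :=
    { toFun := PermNatIso.perm
      map_one' := rfl
      map_mul' := fun _ _ => rfl }
  unit := id S 1
  μ := μ
  unit_μ {n} g := by
    refine ext_val ?_ fun x => ?_
    · exact congrArg ULift.down (ActionOperad.symmetric.{u}.unit_μ ⟨g.perm⟩)
    · refine (Arrow.seq_id _ _ _).trans ((S.prodArr_one _).trans ?_)
      exact val_congr _ fun i => congrArg x (blk_one _ _ _)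
  μ_unit {n} g := by
    refine ext_val ?_ fun x => ?_
    · exact congrArg ULift.down (ActionOperad.symmetric.{u}.μ_unit ⟨g.perm⟩)
    · refine (Arrow.seq_congr_left (S.prodArr_id n _) _ _).trans ((Arrow.id_seq _ _ _).trans ?_)
      refine val_congr _ fun i => (S.prod_one _).trans ?_
      exact congrArg x (blk_ones _ _ _)
  μ_assoc {m N} n q hq f g h := by
    refine ext_val (blockPerm_assoc n q hq _ _ _) fun x => ?_
    refine (Arrow.seq_assoc _ _ _ _ _).symm.trans (Arrow.seq_congr ?_ ?_)
    · refine Eq.trans (Arrow.seq_congr ?_ ?_) (S.prodArr_seq _ _ _).symm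
      · refine (S.prodArr_blk n rfl _).symm.trans ?_
        exact S.prodArr_congr fun i => S.prodArr_congr fun j => val_congr _ fun l =>
          congrArg x (blk_blk n rfl q hq i j l)
      · exact S.prodArr_congr fun i => val_congr _ fun j => S.prod_congr fun l =>
          congrArg x (blk_blk n rfl q hq i j _)
    · refine val_congr _ fun i => ?_
      refine Eq.trans ?_ (S.prod_prod (fun j => q (blk n rfl ⟨i, (g i).perm.symm j⟩))
        ((g i).perm.symm.sum_comp fun j => q (blk n rfl ⟨i, j⟩)) _)
      refine S.prod_congr fun j => S.prod_congr fun l => congrArg x ?_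
      refine (blk_blk n rfl q hq i _ _).trans ?_
      exact congrArg (fun l => blk (fun i => ∑ j, q (blk n rfl ⟨i, j⟩)) _ ⟨i, l⟩)
        (blockPerm_symm_blk (fun j => q (blk n rfl ⟨i, j⟩)) rfl (g i).perm
          (fun j => (h (blk n rfl ⟨i, j⟩)).perm) _ j l).symm
  π_μ k h g f := rfl
  μ_mul_μ k h g g' f h' f' := μ_mul_μ k h g g' f h' f'

end PermNatIso

/-! ### The action of a club on arrows -/

namespace Club.Algebra

variable {K : Club.{w', v'}} {X : Type w} [Category.{v} X] (A : K.Algebra X)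

theorem map_congr {a b a' b' : K.Obj} {f : a ⟶ b} {f' : a' ⟶ b'}
    {x : Fin (K.arity a) → X} {y : Fin (K.arity b) → X}
    {x' : Fin (K.arity a') → X} {y' : Fin (K.arity b') → X}
    {g : Fam (K.perm f) x y} {g' : Fam (K.perm f') x' y'} (h : Arrow.mk f = Arrow.mk f')
    (hg : ∀ (i : Fin (K.arity a)) j hij (i' : Fin (K.arity a')) j' hij', (i : ℕ) = i' →
      Arrow.mk (g i j hij) = Arrow.mk (g' i' j' hij')) :
    Arrow.mk (A.map f g) = Arrow.mk (A.map f' g') := by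
  obtain ⟨rfl, rfl, h⟩ := (Arrow.mk_eq_mk_iff _ _).1 h
  simp only [eqToHom_refl, Category.id_comp, Category.comp_id] at h
  subst h
  obtain rfl : x = x' := funext fun i => Arrow.left_eq (hg i _ rfl i _ rfl rfl)
  obtain rfl : y = y' := funext fun j => Arrow.right_eq
    (hg ((K.perm f).symm j) j (by simp) ((K.perm f).symm j) j (by simp) rfl)
  obtain rfl : g = g' := funext fun i => funext fun j => funext fun hij =>
    Arrow.eq_of_mk_eq (hg i j hij i j hij rfl)
  rfl

theorem map_congr_right {a b : K.Obj} {f : a ⟶ b}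
    {x x' : Fin (K.arity a) → X} {y y' : Fin (K.arity b) → X}
    {g : Fam (K.perm f) x y} {g' : Fam (K.perm f) x' y'}
    (hg : ∀ i j hij, Arrow.mk (g i j hij) = Arrow.mk (g' i j hij)) :
    Arrow.mk (A.map f g) = Arrow.mk (A.map f g') :=
  A.map_congr rfl fun i j hij i' j' hij' hi => by
    obtain rfl := Fin.ext hi
    obtain rfl : j = j' := hij.symm.trans hij'
    exact hg i j hij

theorem mk_map_eq_id {a : K.Obj} {f : a ⟶ a} (hf : f = 𝟙 a) {x y : Fin (K.arity a) → X}
    {g : Fam (K.perm f) x y} (hg : ∀ i j hij, Arrow.mk (g i j hij) = Arrow.mk (𝟙 (x i))) :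
    Arrow.mk (A.map f g) = Arrow.mk (𝟙 (A.obj a x)) := by
  subst hf
  rw [← A.map_id]
  exact A.map_congr_right fun i j hij => (hg i j hij).trans (Fam.mk_ofEq _ _ _ _).symm

/-- The action of an object of the club on arrows. -/
def actArr (a : K.Obj) (u : Fin (K.arity a) → Arrow X) : Arrow X :=
  Arrow.mk (A.map (x := fun i => (u i).left) (y := fun i => (u i).right) (𝟙 a)
    (Fam.ofHoms (K.perm_id a) (fun i => (u i).hom)))

/-- The action of a morphism of the club on identities. -/
def permArr {a b : K.Obj} (f : a ⟶ b) (x : Fin (K.arity a) → X) : Arrow X :=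
  Arrow.mk (A.map f (Fam.ofEnd (fun i => 𝟙 (x i))))

theorem actArr_congr {a : K.Obj} {u u' : Fin (K.arity a) → Arrow X} (h : ∀ i, u i = u' i) :
    A.actArr a u = A.actArr a u' := congrArg _ (funext h)

theorem actArr_id (a : K.Obj) (x : Fin (K.arity a) → X) :
    A.actArr a (fun i => Arrow.mk (𝟙 (x i))) = Arrow.mk (𝟙 (A.obj a x)) :=
  A.mk_map_eq_id rfl fun i j hij => Fam.mk_ofHoms _ _ _ _ _

/-- The action of a morphism of `K ∘ X` is the action of its second component, followed by that
of its first component. -/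
theorem mk_map {a b : K.Obj} (f : a ⟶ b) {x : Fin (K.arity a) → X} {y : Fin (K.arity b) → X}
    (g : Fam (K.perm f) x y) :
    Arrow.mk (A.map f g) = Arrow.seq (A.actArr a (fun i => Arrow.mk (g i _ rfl)))
      (A.permArr f (fun i => y (K.perm f i))) rfl := by
  refine Eq.trans ?_ (Arrow.seq_mk (A.map (𝟙 a) _) (A.map f _) rfl).symm
  rw [A.map_comp]
  refine A.map_congr (congrArg Arrow.mk (Category.id_comp f).symm) fun i j hij i' j' hij' hi => ?_
  obtain rfl := Fin.ext hi
  subst hij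
  refine Eq.symm ((Arrow.mk_comp_of_id_right (Fam.mk_ofEnd _ _ _ _)).trans ?_)
  exact Fam.mk_ofHoms _ _ _ _ _

/-- The action of a morphism of `K ∘ X` is the action of its first component, followed by that
of its second component. -/
theorem mk_map' {a b : K.Obj} (f : a ⟶ b) {x : Fin (K.arity a) → X} {y : Fin (K.arity b) → X}
    (g : Fam (K.perm f) x y) :
    Arrow.mk (A.map f g) = Arrow.seq (A.permArr f x)
      (A.actArr b (fun j => Arrow.mk (g ((K.perm f).symm j) j (Equiv.apply_symm_apply _ _))))
      rfl := by
  refine Eq.trans ?_ (Arrow.seq_mk (A.map f _) (A.map (𝟙 b) _) rfl).symm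
  rw [A.map_comp]
  refine A.map_congr (congrArg Arrow.mk (Category.comp_id f).symm) fun i j hij i' j' hij' hi => ?_
  obtain rfl := Fin.ext hi
  refine Eq.symm ((Arrow.mk_comp_of_id_left (Fam.mk_ofEnd _ _ _ _)).trans ?_)
  refine (Fam.mk_ofHoms _ _ _ _ _).trans ?_
  have key : ∀ i' j' h', i' = i → j' = j → Arrow.mk (g i' j' h') = Arrow.mk (g i j hij) := by
    rintro _ _ h' rfl rfl
    rfl
  exact key _ _ _ (by simp) hij

theorem isIso_permArr {a b : K.Obj} (f : a ≅ b) (x : Fin (K.arity a) → X) :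
    IsIso (A.permArr f.hom x).hom := by
  have e : ∀ i, K.perm f.inv (K.perm f.hom i) = i := fun i => by
    rw [← Equiv.trans_apply, ← K.perm_comp, f.hom_inv_id, K.perm_id]; rfl
  have e' : ∀ i, K.perm f.hom (K.perm f.inv i) = i := fun i => by
    rw [← Equiv.trans_apply, ← K.perm_comp, f.inv_hom_id, K.perm_id]; rfl
  have h₁ : ∀ i j, K.perm f.inv i = j → x ((K.perm f.hom).symm i) = x j := by
    rintro i _ rfl
    exact congrArg x ((Equiv.symm_apply_eq _).2 (e' i).symm)
  refine ⟨A.map f.inv (Fam.ofEq h₁), Arrow.eq_of_mk_eq ?_, Arrow.eq_of_mk_eq ?_⟩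
  · refine (congrArg Arrow.mk (A.map_comp _ _ _ _)).trans ?_
    refine A.mk_map_eq_id f.hom_inv_id fun i j hij => ?_
    exact (Arrow.mk_comp_of_id_right (Fam.mk_ofEq h₁ _ _ _)).trans (Fam.mk_ofEnd _ _ _ _)
  · refine (congrArg Arrow.mk (A.map_comp _ _ _ _)).trans ?_
    refine A.mk_map_eq_id f.inv_hom_id fun i j hij => ?_
    exact (Arrow.mk_comp_of_id_right (Fam.mk_ofEnd _ _ _ _)).trans (Fam.mk_ofEq _ _ _ _)

theorem ext_mk {A B : K.Algebra X} (h : ∀ a x, A.obj a x = B.obj a x)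
    (h' : ∀ {a b : K.Obj} {x : Fin (K.arity a) → X} {y : Fin (K.arity b) → X} (f : a ⟶ b)
      (g : Fam (K.perm f) x y), Arrow.mk (A.map f g) = Arrow.mk (B.map f g)) : A = B := by
  obtain ⟨obj, map, _, _, _, _, _, _⟩ := A
  obtain ⟨obj', map', _, _, _, _, _, _⟩ := B
  obtain rfl : obj = obj' := funext fun a => funext fun x => h a x
  obtain rfl : @map = @map' := by
    funext a b x y f g
    exact Arrow.eq_of_mk_eq (h' f g)
  rfl

end Club.Algebra

/-! ### Algebras of the club of an action operad -/

namespace Club.Algebra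

open ActionOperad

variable {Λ : ActionOperad.{u}} {X : Type w} [Category.{v} X] (A : Λ.club.Algebra X)

/-- The actions of the objects of the club on the objects of an algebra. -/
def objMonoid : UnbiasedMonoid X where
  act n x := A.obj (Λ.ob n) x
  act_one x := by
    rw [show x = fun _ => x 0 from funext fun i => congrArg x (Subsingleton.elim _ _)]
    exact A.obj_one (x 0)
  act_blk {n} k x := A.obj_subst (Λ.ob n) k x

/-- The actions of the objects of the club on the arrows of an algebra. -/
def arrMonoid : UnbiasedMonoid (Arrow X) where
  act n u := A.actArr (Λ.ob n) u
  act_one u := by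
    refine Eq.trans ?_ (A.map_one (u 0).hom)
    refine A.map_congr_right fun i j hij => (Fam.mk_ofHoms _ _ _ _ _).trans ?_
    exact congrArg (fun i : Fin 1 => Arrow.mk (u i).hom) (Subsingleton.elim (α := Fin 1) _ _)
  act_blk {n} k u := by
    let k' : Fin (Λ.club.arity (Λ.ob n)) → Λ.club.Obj := k
    have hd : ∀ i j, Λ.club.perm (𝟙 (Λ.ob n)) i = j → k' i = k' j := by
      intro i j h
      rw [Λ.club.perm_id] at h
      exact congrArg k h
    let d : Fam (Λ.club.perm (𝟙 (Λ.ob n))) k' k' := Fam.ofEq hd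
    have e : Λ.club.substHom (𝟙 (Λ.ob n)) d = 𝟙 _ := Λ.club.substHom_id (Λ.ob n) k'
    let g : Fam (Λ.club.perm (Λ.club.substHom (𝟙 (Λ.ob n)) d))
        (fun i => (u i).left) (fun i => (u i).right) :=
      Fam.ofHoms (by rw [e, Λ.club.perm_id]) fun i => (u i).hom
    have hg : ∀ i j hij, Arrow.mk (g i j hij) = u i := fun i j hij => Fam.mk_ofHoms _ _ _ _ _
    refine Eq.trans ?_ ((A.map_subst (𝟙 (Λ.ob n)) d g).trans ?_)
    · refine A.map_congr (congrArg Arrow.mk e.symm) fun i j hij i' j' hij' hi => ?_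
      obtain rfl := Fin.ext hi
      exact (Fam.mk_ofHoms _ _ _ _ _).trans (hg _ _ _).symm
    · refine A.map_congr_right fun i j hij => Eq.trans ?_ (Fam.mk_ofHoms _ _ _ _ _).symm
      refine A.map_congr (Fam.mk_ofEq _ _ _ _) fun l m hlm l' m' hlm' hl => ?_
      obtain rfl := Fin.ext hl
      refine (hg _ _ _).trans (Eq.symm ?_)
      exact Fam.mk_ofHoms (Λ.club.perm_id _) (fun j => (u (blk k rfl ⟨i, j⟩)).hom) _ _ _

end Club.Algebra

/-! ### The natural isomorphisms given by an algebra -/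

namespace Club.Algebra

open ActionOperad

theorem permArr_congr {K : Club.{w', v'}} {X : Type w} [Category.{v} X] (A : K.Algebra X)
    {a b : K.Obj} (f : a ⟶ b) {x y : Fin (K.arity a) → X} (h : ∀ i, x i = y i) :
    A.permArr f x = A.permArr f y := congrArg _ (funext h)

theorem permArr_id {K : Club.{w', v'}} {X : Type w} [Category.{v} X] (A : K.Algebra X)
    (a : K.Obj) (x : Fin (K.arity a) → X) : A.permArr (𝟙 a) x = Arrow.mk (𝟙 (A.obj a x)) :=
  A.mk_map_eq_id rfl fun i j hij => Fam.mk_ofEnd _ _ _ _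

theorem permArr_comp {K : Club.{w', v'}} {X : Type w} [Category.{v} X] (A : K.Algebra X)
    {a b c : K.Obj} (f : a ⟶ b) (f' : b ⟶ c) (x : Fin (K.arity a) → X) :
    A.permArr (f ≫ f') x =
      Arrow.seq (A.permArr f x) (A.permArr f' (fun i => x ((K.perm f).symm i))) rfl := by
  refine Eq.trans ?_ (Arrow.seq_mk (A.map f _) (A.map f' _) rfl).symm
  rw [A.map_comp]
  refine A.map_congr rfl fun i j hij i' j' hij' hi => ?_
  obtain rfl := Fin.ext hi
  refine (Fam.mk_ofEnd _ _ _ _).trans (Eq.symm ?_)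
  exact (Arrow.mk_comp_of_id_right (Fam.mk_ofEnd _ _ _ _)).trans (Fam.mk_ofEnd _ _ _ _)

variable {Λ : ActionOperad.{u}}

section

variable {X : Type w} [Category.{v} X]

/-- The objects of the club act on the algebra by the tensor products of `S`. -/
structure ActsBy (A : Λ.club.Algebra X) (S : StrictMonoidal X) : Prop where
  obj : ∀ n (x : Fin n → X), A.obj (Λ.ob n) x = S.prod n x
  arr : ∀ n (u : Fin n → Arrow X), A.actArr (Λ.ob n) u = S.prodArr n u

/-- An element of `Λ n` acts on an algebra by a natural isomorphism. -/
def ActsBy.permNatIso {A : Λ.club.Algebra X} {S : StrictMonoidal X} (h : A.ActsBy S) {n : ℕ}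
    (g : Λ.carrier n) : PermNatIso S n where
  perm := Λ.π n g
  val x := A.permArr (endo g) x
  val_left x := h.obj n x
  val_right x := h.obj n _
  natural u := by
    let e : Fam (Λ.club.perm (endo g)) (fun i => (u i).left)
        (fun j => (u ((Λ.π n g).symm j)).right) :=
      fun i j hij => (u i).hom ≫ eqToHom (by
        rw [← hij]
        exact congrArg (fun i => (u i).right) ((Λ.π n g).symm_apply_apply i).symm)
    have he : ∀ i j hij, Arrow.mk (e i j hij) = u i := fun i j hij =>
      Arrow.arrow_mk_comp_eqToHom _ _
    have e₁ := (A.mk_map (endo g) e).symm.trans (A.mk_map' (endo g) e)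
    refine (Arrow.seq_congr ?_ ?_).trans (e₁.trans (Arrow.seq_congr rfl ?_))
    · refine (h.arr n u).symm.trans ?_
      exact A.actArr_congr fun i => (he i _ rfl).symm
    · refine A.permArr_congr _ fun i => ?_
      exact congrArg (fun i => (u i).right) ((Λ.π n g).symm_apply_apply i).symm
    · refine Eq.trans ?_ (h.arr n _)
      exact A.actArr_congr fun i => he _ _ (Equiv.apply_symm_apply _ _)
  isIso x := A.isIso_permArr (endoIso g) x

/-- The right hand side of `ActsBy.permArr_μ`, computed for morphisms `φ i` that are equal, as
arrows, to the elements `f i`, between objects that are not literally `k i`. -/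
theorem ActsBy.seq_eq_μ {A : Λ.club.Algebra X} {S : StrictMonoidal X} (h : A.ActsBy S) {n : ℕ}
    (k : Fin n → ℕ) (g : Λ.carrier n) (f : ∀ i, Λ.carrier (k i)) (x : Fin (∑ i, k i) → X)
    (c : Fin n → Λ.club.Obj) (y : ∀ i, Fin (Λ.club.arity (c i)) → X) (φ : ∀ i, Λ.ob (k i) ⟶ c i)
    (g' : ∀ i, Fam (Λ.club.perm (φ i)) (fun j => x (blk k rfl ⟨i, j⟩)) (y i))
    (hφ : ∀ i, Arrow.mk (φ i) = Arrow.mk (endo (f i)))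
    (hg' : ∀ i j j' hj, Arrow.mk (g' i j j' hj) = Arrow.mk (𝟙 (x (blk k rfl ⟨i, j⟩)))) (hr) :
    Arrow.seq (A.actArr (Λ.ob n) fun i => Arrow.mk (A.map (φ i) (g' i)))
        (A.permArr (endo g) fun i => A.obj (c i) (y i)) hr =
      (PermNatIso.μ k rfl (h.permNatIso g) fun i => h.permNatIso (f i)).val x := by
  have e₃ : ∀ i, Arrow.mk (A.map (φ i) (g' i)) =
      (h.permNatIso (f i)).val fun j => x (blk k rfl ⟨i, j⟩) := fun i =>
    A.map_congr (hφ i) fun j l hjl j' l' hjl' hj => by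
      obtain rfl := Fin.ext hj
      refine (hg' _ _ _ _).trans (Eq.symm ?_)
      exact Fam.mk_ofEnd _ _ _ _
  refine Arrow.seq_congr ?_ ?_
  · exact (h.arr n _).trans (S.prodArr_congr e₃)
  · refine A.permArr_congr _ fun i => ?_
    exact (Arrow.right_eq (e₃ i)).trans ((h.permNatIso (f i)).val_right _)

/-- An operadic composite of elements of `Λ` acts by the operadic composite of the natural
isomorphisms by which they act. This is the compatibility of the algebra with substitution, for
families of identities of `X`. -/
theorem ActsBy.permArr_μ {A : Λ.club.Algebra X} {S : StrictMonoidal X} (h : A.ActsBy S) {n : ℕ}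
    (k : Fin n → ℕ) (g : Λ.carrier n) (f : ∀ i, Λ.carrier (k i)) (x : Fin (∑ i, k i) → X) :
    A.permArr (endo (Λ.μ k rfl g f)) x =
      (PermNatIso.μ k rfl (h.permNatIso g) fun i => h.permNatIso (f i)).val x := by
  obtain ⟨x', H, hH⟩ : ∃ (x' : _) (H : Fam (Λ.club.perm (Λ.club.substHom (endo g) (endoFam k g f)))
      x x'), ∀ i j hij, Arrow.mk (H i j hij) = Arrow.mk (𝟙 (x i)) :=
    ⟨_, Fam.ofEnd fun i => 𝟙 (x i), fun i j hij => Fam.mk_ofEnd _ _ _ _⟩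
  have e₁ : A.permArr (endo (Λ.μ k rfl g f)) x =
      Arrow.mk (A.map (Λ.club.substHom (endo g) (endoFam k g f)) H) :=
    A.map_congr (mk_endo_μ k rfl g f) fun i j hij i' j' hij' hi => by
      obtain rfl := Fin.ext hi
      exact (Fam.mk_ofEnd _ _ _ _).trans (hH _ _ _).symm
  refine e₁.trans ((A.map_subst (endo g) (endoFam k g f) H).trans ((A.mk_map _ _).trans ?_))
  refine h.seq_eq_μ k g f x _ _ _ _ (fun i => mk_endoFam k g f i _ rfl) ?_ _
  exact fun i j j' hj => hH _ _ _

end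

/-- The action of the elements of `Λ n` on an algebra is a map of action operads. -/
noncomputable def ActsBy.hom {X : Type u} [Category.{u} X] {A : Λ.club.Algebra X}
    {S : StrictMonoidal X} (h : A.ActsBy S) : Λ ⟶ PermNatIso.operad S where
  app n :=
    { toFun := fun g => h.permNatIso g
      map_one' := PermNatIso.ext_val (g := PermNatIso.id S n) (_root_.map_one (Λ.π n)) fun x =>
        (A.permArr_id (Λ.ob n) x).trans (Arrow.mk_id_eq (h.obj n x))
      map_mul' := fun g g' => PermNatIso.ext_val
        (g := PermNatIso.mul (h.permNatIso g) (h.permNatIso g')) (map_mul (Λ.π n) g g') fun x =>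
          A.permArr_comp (endo g') (endo g) x }
  app_π n g := rfl
  app_unit := by
    refine PermNatIso.ext_val (Subsingleton.elim _ _) fun x => ?_
    refine Eq.trans ?_ ((A.permArr_id (Λ.ob 1) x).trans (Arrow.mk_id_eq (h.obj 1 x)))
    exact congrArg (fun g => A.permArr (endo g) x) Λ.unit_eq_one
  app_μ {n N} k hk g f := by
    subst hk
    exact PermNatIso.ext_val (Λ.π_μ k rfl g f) fun x => h.permArr_μ k g f x

end Club.Algebra

/-! ### Values of formal composites in a strict monoidal category -/

namespace StrictMonoidalWith

variable {G : SymColl.{u}} {X : Type u} [Category.{u} X] (S : StrictMonoidalWith G X)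

/-- The natural isomorphism of a generator, as an element of the action operad of natural
isomorphisms between permuted tensor products. -/
def permNatIso (f : G.carrier) : PermNatIso S.toStrictMonoidal (G.arity f) where
  perm := G.perm f
  val x := Arrow.mk ((S.iso f).hom.app x)
  val_left _ := rfl
  val_right _ := rfl
  natural u := by
    refine (Arrow.seq_mk _ _ rfl).trans (Eq.trans ?_ (Arrow.seq_mk _ _ rfl).symm)
    exact congrArg Arrow.mk ((S.iso f).hom.naturality (X := fun i => (u i).left)
      (Y := fun i => (u i).right) (fun i => (u i).hom))
  isIso x := inferInstanceAs (IsIso ((S.iso f).hom.app x))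

/-- The generators, as elements of the action operad of natural isomorphisms between permuted
tensor products. -/
noncomputable def homTo : G.HomTo (PermNatIso.operad S.toStrictMonoidal) where
  app := S.permNatIso
  app_π _ := rfl

/-- The value of a formal composite, as an element of the action operad of natural isomorphisms
between permuted tensor products. -/
noncomputable def value {n : ℕ} (t : FormalComposite G n) : PermNatIso S.toStrictMonoidal n :=
  t.eval S.homTo

theorem perm_value {n : ℕ} (t : FormalComposite G n) : (S.value t).perm = t.perm :=
  t.π_eval S.homTo

/-- The interpretation of a formal composite in a strict monoidal category is its value in the
operad of natural isomorphisms between permuted tensor products. -/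
theorem mk_interp {n : ℕ} (t : FormalComposite G n) (x : Fin n → X) :
    Arrow.mk (S.interp t x).hom = (S.value t).val x := by
  induction t with
  | gen f => rfl
  | unit => rfl
  | one n => rfl
  | mul t t' h h' =>
    refine (Arrow.mk_comp_eq_seq (h' x) ((h _).trans (PermNatIso.val_congr _ fun i => ?_)))
    exact congrArg (fun σ : Equiv.Perm (Fin _) => x (σ.symm i)) (S.perm_value t').symm
  | inv t h =>
    refine (Arrow.arrow_mk_eqToHom_comp (S.interp t fun i => x (t.perm i)).inv (congrArg (S.prod _)
      (funext fun i => congrArg x (t.perm.apply_symm_apply i).symm))).trans ?_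
    refine Arrow.inverse_mk_iso _ ((S.value t).val fun i => x ((S.value t).perm i)) ?_
    refine (h _).trans (PermNatIso.val_congr _ fun i => ?_)
    rw [S.perm_value]
  | op k hk t ts h hs =>
    simp only [interp, Iso.trans_hom, eqToIso.hom, Arrow.arrow_mk_eqToHom_comp]
    refine Arrow.mk_comp_eq_seq (S.prodArr_congr fun i => hs i _)
      ((Arrow.arrow_mk_comp_eqToHom _ _).trans ((h _).trans (PermNatIso.val_congr _ fun i => ?_)))
    refine S.prod_congr fun j => ?_
    change _ = x (blk k hk ⟨i, (S.value (ts i)).perm.symm j⟩)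
    rw [S.perm_value]

/-- The two sides of an equation are required to have the same permutation because the permutation
of an element of `PermNatIso` is not determined by its components, for instance on a category with
one morphism. -/
theorem satisfies_iff {E : ∀ {n : ℕ}, FormalComposite G n → FormalComposite G n → Prop}
    (hE : ∀ {n : ℕ} (t₁ t₂ : FormalComposite G n), E t₁ t₂ → t₁.perm = t₂.perm) :
    S.Satisfies E ↔ ∀ {n : ℕ} (t₁ t₂ : FormalComposite G n), E t₁ t₂ → S.value t₁ = S.value t₂ := by
  refine ⟨fun h n t₁ t₂ e => PermNatIso.ext_val ?_ fun x => ?_, fun h n t₁ t₂ e x => ?_⟩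
  · rw [perm_value, perm_value, hE _ _ e]
  · rw [← mk_interp, ← mk_interp, h _ _ e]
  · rw [mk_interp, mk_interp, h _ _ e]

end StrictMonoidalWith

namespace Club.Algebra

open ActionOperad

variable {Λ : ActionOperad.{u}} {G : SymColl.{u}} {p : ActionOperad.free G ⟶ Λ}

/-- The underlying unit and tensor product of an algebra determine the action of all objects of the
club: both the objects and the arrows of `X` form an unbiased monoid under this action. -/
theorem Underlies.actsBy {X : Type w} [Category.{v} X] {A : Λ.club.Algebra X}
    {S : StrictMonoidalWith G X} (h : A.Underlies p S) : A.ActsBy S.toStrictMonoidal where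
  obj n x := A.objMonoid.act_eq_prodFin (fun x => (h.unit x).symm)
    (fun a b => (h.tensor_obj ![a, b]).symm) n x
  arr n u := by
    rw [StrictMonoidal.prodArr_eq_prodFin]
    refine A.arrMonoid.act_eq_prodFin (fun u => ?_) (fun a b => ?_) n u
    · refine (A.actArr_congr (u' := fun i => Arrow.mk (𝟙 (u i).left)) fun i => i.elim0).trans ?_
      exact (A.actArr_id (Λ.ob 0) _).trans (Arrow.mk_id_eq (h.unit _).symm)
    · exact (h.tensor_map (x := fun i => (![a, b] i).left) (y := fun i => (![a, b] i).right)
        fun i => (![a, b] i).hom).symm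

variable {X : Type u} [Category.{u} X] {A : Λ.club.Algebra X} {S : StrictMonoidalWith G X}

/-- An element of `Λ` represented by a formal composite acts by the value of that composite: both
sides are maps out of the free action operad that agree on the generators. -/
theorem Underlies.hom_app (h : A.Underlies p S) {n : ℕ} (t : FormalComposite G n) :
    h.actsBy.hom.app n (p.app n t.toFree) = S.value t := by
  refine FormalComposite.app_toFree (p ≫ h.actsBy.hom) S.homTo (fun f => ?_) t
  refine PermNatIso.ext_val (p.app_π _ _) fun x => ?_
  refine Eq.trans ?_ (h.iso f x).symm
  refine A.map_congr_right fun i j hij => (Fam.mk_ofEnd _ _ _ _).trans (Eq.symm ?_)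
  exact Fam.mk_ofEq _ _ _ _

theorem Underlies.permArr_eq (h : A.Underlies p S) {n : ℕ} (t : FormalComposite G n)
    (x : Fin n → X) : A.permArr (endo (p.app n t.toFree)) x = (S.value t).val x :=
  congrArg (fun f : PermNatIso S.toStrictMonoidal n => f.val x) (h.hom_app t)

theorem Underlies.satisfies (h : A.Underlies p S)
    {E : ∀ {n : ℕ}, FormalComposite G n → FormalComposite G n → Prop} (hp : Presents p E) :
    S.Satisfies E := fun t₁ t₂ e x => by
  rw [S.mk_interp, S.mk_interp, ← h.permArr_eq, ← h.permArr_eq, hp.sound _ _ e]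

/-- The action of an arbitrary morphism of the club and family of morphisms of `X` is the tensor
product of the family followed by the action of the element on identities. -/
theorem mk_map_endo {X : Type w} [Category.{v} X] {A : Λ.club.Algebra X} {S : StrictMonoidal X}
    (h : A.ActsBy S) {n : ℕ} (g : Λ.carrier n) {x y : Fin n → X}
    (φ : Fam (Λ.club.perm (endo g)) x y) (hr) :
    Arrow.mk (A.map (endo g) φ) = Arrow.seq (S.prodArr n fun i => Arrow.mk (φ i _ rfl))
      (A.permArr (endo g) fun i => y (Λ.π n g i)) hr :=
  (A.mk_map (endo g) φ).trans (Arrow.seq_congr (h.arr n _) rfl)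

/-- When every element of `Λ` is represented by a formal composite, an algebra is determined by its
underlying strict monoidal structure. -/
theorem Underlies.eq_algebra {A B : Λ.club.Algebra X} (h : A.Underlies p S) (h' : B.Underlies p S)
    (hp : ∀ {n : ℕ} (g : Λ.carrier n), ∃ t : FormalComposite G n, p.app n t.toFree = g) :
    A = B := by
  refine ext_mk (fun n x => (h.actsBy.obj n x).trans (h'.actsBy.obj n x).symm) ?_
  rintro m _ x y ⟨rfl, g⟩ φ
  obtain ⟨t, rfl⟩ := hp g
  refine (mk_map_endo h.actsBy _ φ (h.actsBy.obj _ _).symm).trans (Eq.trans ?_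
    (mk_map_endo h'.actsBy _ φ (h'.actsBy.obj _ _).symm).symm)
  exact Arrow.seq_congr rfl ((h.permArr_eq t _).trans (h'.permArr_eq t _).symm)

end Club.Algebra

/-! ### The algebra given by natural isomorphisms of tensor products -/

theorem StrictMonoidal.prod_cast {X : Type w} [Category.{v} X] (S : StrictMonoidal X) {m n : ℕ}
    (h : m = n) {x : Fin m → X} {y : Fin n → X} (hx : ∀ i, x i = y (Fin.cast h i)) :
    S.prod m x = S.prod n y := by
  subst h
  exact S.prod_congr hx

namespace PermNatIso

open ActionOperad

variable {Λ : ActionOperad.{u}} {X : Type u} [Category.{u} X] {S : StrictMonoidal X}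
  (q : Λ ⟶ operad S)

/-- The natural isomorphism given by an element of `Λ n`. -/
noncomputable def ofElt {n : ℕ} (g : Λ.carrier n) : PermNatIso S n := q.app n g

theorem perm_ofElt {n : ℕ} (g : Λ.carrier n) : (ofElt q g).perm = Λ.π n g := q.app_π n g

theorem ofElt_one (n : ℕ) : ofElt q (1 : Λ.carrier n) = 1 := map_one (q.app n)

theorem ofElt_mul {n : ℕ} (g g' : Λ.carrier n) : ofElt q (g * g') = ofElt q g * ofElt q g' :=
  map_mul (q.app n) g g'

theorem ofElt_μ {n N : ℕ} (k : Fin n → ℕ) (h : ∑ i, k i = N) (g : Λ.carrier n)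
    (f : ∀ i, Λ.carrier (k i)) :
    ofElt q (Λ.μ k h g f) = μ k h (ofElt q g) (fun i => ofElt q (f i)) := q.app_μ k h g f

/-- The action of a morphism of the club on a family of morphisms: the tensor product of the
family, followed by the natural isomorphism given by the morphism of the club. -/
noncomputable def actionArr {m n : ℕ} (f : Λ.BHom m n) {x : Fin m → X} {y : Fin n → X}
    (g : Fam f.perm x y) : Arrow X :=
  Arrow.seq (S.prodArr m fun i => Arrow.mk (g i _ rfl)) ((ofElt q f.elt).val fun i => y (f.perm i))
    ((ofElt q f.elt).val_left _).symm

theorem actionArr_right {m n : ℕ} (f : Λ.BHom m n) {x : Fin m → X} {y : Fin n → X}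
    (g : Fam f.perm x y) : (actionArr q f g).right = S.prod n y := by
  refine ((ofElt q f.elt).val_right _).trans (S.prod_cast f.eq fun i => congrArg y ?_)
  rw [perm_ofElt]
  exact congrArg (Fin.cast f.eq) ((Λ.π m f.elt).apply_symm_apply i)

/-- The action of a morphism of the club on a family of morphisms. -/
noncomputable def action {m n : ℕ} (f : Λ.BHom m n) {x : Fin m → X} {y : Fin n → X}
    (g : Fam f.perm x y) : S.prod m x ⟶ S.prod n y :=
  (actionArr q f g).hom ≫ eqToHom (actionArr_right q f g)

theorem mk_action {m n : ℕ} (f : Λ.BHom m n) {x : Fin m → X} {y : Fin n → X}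
    (g : Fam f.perm x y) : Arrow.mk (action q f g) = actionArr q f g :=
  Arrow.arrow_mk_comp_eqToHom _ _

theorem actionArr_one {n : ℕ} {x y : Fin n → X} {u : Fin n → Arrow X}
    {g : Fam (BHom.perm (BHom.id Λ n)) x y} (hg : ∀ i j hij, Arrow.mk (g i j hij) = u i) :
    actionArr q (BHom.id Λ n) g = S.prodArr n u := by
  have e : ∀ y : Fin n → X, (ofElt q (1 : Λ.carrier n)).val y = Arrow.mk (𝟙 (S.prod n y)) :=
    fun y => by rw [ofElt_one]; rfl
  refine (Arrow.seq_congr_right _ (e _) _).trans ((Arrow.seq_id _ _ _).trans ?_)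
  exact S.prodArr_congr fun i => hg i _ rfl

/-- Functoriality of the action; the middle square is naturality of the natural isomorphism by which
the element of `f` acts. -/
theorem actionArr_comp {m n k : ℕ} (f : Λ.BHom m n) (f' : Λ.BHom n k) {x : Fin m → X}
    {y : Fin n → X} {z : Fin k → X} (g : Fam f.perm x y) (g' : Fam f'.perm y z)
    (g'' : Fam (f.comp f').perm x z)
    (hg : ∀ i, g'' i _ rfl = g i _ rfl ≫ g' _ _ (by rw [BHom.perm_comp]; rfl)) (h) :
    Arrow.seq (actionArr q f g) (actionArr q f' g') h = actionArr q (f.comp f') g'' := by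
  obtain ⟨rfl, f⟩ := f
  obtain ⟨rfl, f'⟩ := f'
  have hσ : ∀ i, Λ.π m f ((ofElt q f).perm.symm i) = i := fun i => by
    rw [perm_ofElt, Equiv.apply_symm_apply]
  have hc : ∀ i, (BHom.comp ⟨rfl, f⟩ ⟨rfl, f'⟩ : Λ.BHom m m).perm i =
      BHom.perm (n := m) ⟨rfl, f'⟩ (Λ.π m f i) := fun i => by
    rw [BHom.perm_comp]
    rfl
  -- Naturality of the isomorphism of `f` moves the family `g'` past it.
  have e₁ := (ofElt q f).natural fun i => Arrow.mk (g' (Λ.π m f i) _ rfl)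
  have e₂ : (S.prodArr m fun i => Arrow.mk (g' (Λ.π m f ((ofElt q f).perm.symm i)) _ rfl)) =
      S.prodArr m fun i => Arrow.mk (g' i _ rfl) := S.prodArr_congr fun i => by rw [hσ]
  refine (Arrow.seq_seq_exchange ((Arrow.seq_congr_right _ e₂.symm _).trans e₁.symm) _ _).trans ?_
  refine Arrow.seq_congr ?_ ?_
  · refine (S.prodArr_seq _ _ fun i => rfl).symm.trans (S.prodArr_congr fun i => ?_)
    refine (Arrow.seq_mk _ _ rfl).trans (Eq.trans ?_ (congrArg Arrow.mk (hg i).symm))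
    exact Arrow.mk_comp_congr rfl (Fam.mk_eq g' rfl _ _)
  · have e₃ : ∀ z' : Fin m → X, (ofElt q (f' * f)).val z' = _ := fun z' =>
      (congrArg (fun a : PermNatIso S m => a.val z') (ofElt_mul q f' f)).trans (val_mul _ _ z')
    refine Eq.trans (Arrow.seq_congr ?_ ?_) (e₃ _).symm
    · exact val_congr _ fun i => congrArg z (hc i).symm
    · exact val_congr _ fun i => congrArg z ((hc _).trans (congrArg _ (hσ i))).symm

/-- The action is compatible with substitution, since `q` preserves operadic composites. -/
theorem actionArr_subst {m n : ℕ} (f : Λ.BHom m n) {b : Fin m → ℕ} {b' : Fin n → ℕ}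
    (g : ∀ i j, f.perm i = j → Λ.BHom (b i) (b' j)) {x : Fin (∑ i, b i) → X}
    {x' : Fin (∑ i, b' i) → X} (h : Fam (BHom.subst f g).perm x x')
    (h' : ∀ i j e, Fam (g i j e).perm (fun l => x (blk b rfl ⟨i, l⟩))
      (fun l => x' (blk b' rfl ⟨j, l⟩)))
    (hh : ∀ i j, h' i _ rfl j _ rfl = h (blk b rfl ⟨i, j⟩)
      (blk b' rfl ⟨f.perm i, (g i _ rfl).perm j⟩) (BHom.perm_subst f g i j)) :
    actionArr q (BHom.subst f g) h =
      actionArr q f (x := fun i => S.prod (b i) fun j => x (blk b rfl ⟨i, j⟩))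
        (y := fun i => S.prod (b' i) fun j => x' (blk b' rfl ⟨i, j⟩))
        fun i j e => action q (g i j e) (h' i j e) := by
  have e₁ : ∀ x : Fin (∑ i, b i) → X, (ofElt q (Λ.μ b rfl f.elt fun i => (g i _ rfl).elt)).val x =
      _ := fun x => (congrArg (fun a : PermNatIso S (∑ i, b i) => a.val x)
        (ofElt_μ q b rfl f.elt fun i => (g i _ rfl).elt)).trans (val_μ b rfl _ _ x)
  refine (Arrow.seq_congr_right _ (e₁ _) _).trans ?_
  refine (Arrow.seq_assoc _ _ _ _ _).symm.trans (Arrow.seq_congr ?_ ?_)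
  · refine Eq.trans ?_ (S.prodArr_congr fun i => (mk_action q _ _).symm)
    refine Eq.trans (Arrow.seq_congr ?_ ?_) (S.prodArr_seq _ _ _).symm
    · refine (S.prodArr_blk b rfl _).symm.trans ?_
      refine S.prodArr_congr fun i => S.prodArr_congr fun j => ?_
      exact (Fam.mk_eq h rfl _ _).trans (congrArg Arrow.mk (hh i j).symm)
    · refine S.prodArr_congr fun i => val_congr _ fun j => ?_
      exact congrArg x' (BHom.perm_subst f g i j)
  · refine val_congr _ fun i => S.prod_cast (g i _ rfl).eq fun j => congrArg x' ?_
    refine (BHom.perm_subst f g i _).trans ?_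
    refine congrArg (fun j => blk b' rfl ⟨f.perm i, j⟩) ?_
    change Fin.cast (g i _ rfl).eq (Λ.π _ _ ((ofElt q (g i _ rfl).elt).perm.symm j)) = _
    rw [perm_ofElt, Equiv.apply_symm_apply]

/-- The algebra on a strict monoidal category given by an action of `Λ` on its tensor powers. -/
noncomputable def toAlgebra : Λ.club.Algebra X where
  obj n x := S.prod n x
  map f g := action q f g
  map_id n x := by
    apply Arrow.eq_of_mk_eq
    refine (mk_action _ _ _).trans ((actionArr_one q fun i j hij => ?_).trans (S.prodArr_id _ _))
    exact Fam.mk_ofEq _ _ _ _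
  map_comp f f' g g' := by
    apply Arrow.eq_of_mk_eq
    refine (Arrow.mk_comp_eq_seq (mk_action _ _ _) (mk_action _ _ _)).trans ?_
    exact (actionArr_comp q f f' g g' _ (fun i => rfl) _).trans (mk_action _ _ _).symm
  obj_one x := S.prod_one _
  map_one g := by
    refine (mk_action _ _ _).trans ?_
    exact (actionArr_one q (u := fun _ => Arrow.mk g) fun i j hij => rfl).trans (S.prodArr_one _)
  obj_subst n k x := (S.prod_prod _ _ x).symm
  map_subst f g h := by
    refine (mk_action _ _ _).trans ((actionArr_subst q f g h _ ?_).trans (mk_action _ _ _).symm)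
    exact fun i j => rfl

end PermNatIso

namespace Club.Algebra

open ActionOperad PermNatIso

variable {Λ : ActionOperad.{u}} {G : SymColl.{u}} {p : ActionOperad.free G ⟶ Λ} {X : Type u}
  [Category.{u} X]

theorem underlies_toAlgebra {S : StrictMonoidalWith G X}
    (q : Λ ⟶ PermNatIso.operad S.toStrictMonoidal)
    (hq : ∀ f, ofElt q (p.app _ (FormalComposite.gen f).toFree) = S.permNatIso f) :
    (toAlgebra q).Underlies p S where
  unit x := rfl
  tensor_obj x := congrArg (fun b => S.tensor.obj (x 0, b)) (S.prod_one fun _ => x 1).symm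
  tensor_map f := by
    refine Eq.symm ((mk_action _ _ _).trans ?_)
    refine (actionArr_one q (u := fun i => Arrow.mk (f i)) fun i j hij => ?_).trans ?_
    · exact Fam.mk_ofHoms _ _ _ _ _
    · exact congrArg (S.tensArr (Arrow.mk (f 0))) (S.tensArr_unit (Arrow.mk (f 1)))
  iso f x := by
    refine Eq.symm ((mk_action _ _ _).trans ?_)
    have e₁ : ∀ y : Fin (G.arity f) → X, (∀ i, y i = x i) →
        (ofElt q (p.app _ (FormalComposite.gen f).toFree)).val y = (S.permNatIso f).val x :=
      fun y hy => by rw [hq, funext hy]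
    refine (Arrow.seq_congr ?_ (e₁ _ fun i => ?_)).trans (Arrow.id_seq _ _ rfl)
    · refine (S.prodArr_congr fun i => ?_).trans (S.prodArr_id _ x)
      exact Arrow.mk_eqToHom _
    · have := p.app_π (G.arity f) (FormalComposite.gen f).toFree
      refine congrArg x ((Equiv.symm_apply_eq _).2 ?_)
      exact congrArg (fun σ : Equiv.Perm _ => σ i) this

theorem exists_underlies
    {E : ∀ {n : ℕ}, FormalComposite G n → FormalComposite G n → Prop} (hp : Presents p E)
    (S : StrictMonoidalWith G X) (hS : S.Satisfies E) :
    ∃ A : Λ.club.Algebra X, A.Underlies p S := by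
  have hE : ∀ {n : ℕ} (t₁ t₂ : FormalComposite G n), E t₁ t₂ → t₁.perm = t₂.perm := by
    intro n t₁ t₂ e
    rw [← FormalComposite.π_app p, hp.sound _ _ e, FormalComposite.π_app p]
  obtain ⟨q, hq⟩ := hp.exists_hom _ S.homTo ((S.satisfies_iff hE).1 hS)
  exact ⟨toAlgebra q, underlies_toAlgebra q fun f => hq (.gen f)⟩

end Club.Algebra

/-! ### The strict monoidal category that underlies an algebra -/

/-- The components of a natural isomorphism, as isomorphisms. -/
noncomputable def PermNatIso.isoAt {X : Type w} [Category.{v} X] {S : StrictMonoidal X} {n : ℕ}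
    (f : PermNatIso S n) (x : Fin n → X) {y : X} (hy : (f.val x).right = y) : S.prod n x ≅ y :=
  eqToIso (f.val_left x).symm ≪≫ asIso (f.val x).hom ≪≫ eqToIso hy

theorem PermNatIso.mk_isoAt {X : Type w} [Category.{v} X] {S : StrictMonoidal X} {n : ℕ}
    (f : PermNatIso S n) (x : Fin n → X) {y : X} (hy : (f.val x).right = y) :
    Arrow.mk (f.isoAt x hy).hom = f.val x := by
  subst hy
  exact (Arrow.arrow_mk_eqToHom_comp _ (f.val_left x).symm).trans
    (Arrow.arrow_mk_comp_eqToHom _ rfl)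

/-- The isomorphism of functors with the given components. -/
noncomputable def PermNatIso.toIso {X : Type w} [Category.{v} X] {S : StrictMonoidal X} {n : ℕ}
    (f : PermNatIso S n) {σ : Equiv.Perm (Fin n)} (hσ : f.perm = σ) :
    S.pow n ≅ Pi.comap (fun _ : Fin n => X) σ.symm ⋙ S.pow n :=
  NatIso.ofComponents (fun x => f.isoAt x ((f.val_right x).trans (by rw [hσ]; rfl))) (by
    subst hσ
    intro x y u
    apply Arrow.eq_of_mk_eq
    refine (Arrow.mk_comp_eq_seq rfl (f.mk_isoAt y (f.val_right y))).trans ?_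
    refine (f.natural fun i => Arrow.mk (u i)).trans ?_
    exact (Arrow.mk_comp_eq_seq (f.mk_isoAt x (f.val_right x)) rfl).symm)

theorem PermNatIso.mk_toIso_app {X : Type w} [Category.{v} X] {S : StrictMonoidal X} {n : ℕ}
    (f : PermNatIso S n) {σ : Equiv.Perm (Fin n)} (hσ : f.perm = σ) (x : Fin n → X) :
    Arrow.mk ((f.toIso hσ).hom.app x) = f.val x := by
  subst hσ
  exact f.mk_isoAt x (f.val_right x)

namespace Club.Algebra

section

variable {K : Club.{w', v'}} {X : Type w} [Category.{v} X] (A : K.Algebra X)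

/-- The action of an object of the club on morphisms. -/
def actMap (a : K.Obj) {x y : Fin (K.arity a) → X} (f : ∀ i, x i ⟶ y i) :
    A.obj a x ⟶ A.obj a y := A.map (𝟙 a) (Fam.ofHoms (K.perm_id a) f)

theorem actMap_id (a : K.Obj) (x : Fin (K.arity a) → X) :
    A.actMap a (fun i => 𝟙 (x i)) = 𝟙 (A.obj a x) := Arrow.eq_of_mk_eq (A.actArr_id a x)

theorem actMap_comp (a : K.Obj) {x y z : Fin (K.arity a) → X} (f : ∀ i, x i ⟶ y i)
    (f' : ∀ i, y i ⟶ z i) :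
    A.actMap a (fun i => f i ≫ f' i) = A.actMap a f ≫ A.actMap a f' := by
  apply Arrow.eq_of_mk_eq
  refine Eq.symm ((congrArg Arrow.mk (A.map_comp _ _ _ _)).trans ?_)
  refine A.map_congr (congrArg Arrow.mk (Category.id_comp _)) fun i j hij i' j' hij' hi => ?_
  obtain rfl := Fin.ext hi
  have e : K.perm (𝟙 a) i = i := by
    rw [K.perm_id]
    rfl
  refine (Arrow.mk_comp_congr (Fam.mk_ofHoms _ f _ _ _) ((Fam.mk_ofHoms _ f' _ _ _).trans
    (congrArg (fun i => Arrow.mk (f' i)) e))).trans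
      (Fam.mk_ofHoms _ (fun i => f i ≫ f' i) _ _ _).symm

end

open ActionOperad

variable {Λ : ActionOperad.{u}}

section

variable {X : Type w} [Category.{v} X] (A : Λ.club.Algebra X)

/-- A pair of morphisms, as a family. -/
def pairHom {z z' : X × X} (f : z ⟶ z') : ∀ i : Fin 2, ![z.1, z.2] i ⟶ ![z'.1, z'.2] i
  | 0 => f.1
  | 1 => f.2

theorem pairHom_id (z : X × X) : pairHom (𝟙 z) = fun i => 𝟙 (![z.1, z.2] i) := by
  funext i
  match i with
  | 0 => rfl
  | 1 => rfl

theorem pairHom_comp {z z' z'' : X × X} (f : z ⟶ z') (f' : z' ⟶ z'') :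
    pairHom (f ≫ f') = fun i => pairHom f i ≫ pairHom f' i := by
  funext i
  match i with
  | 0 => rfl
  | 1 => rfl

/-- The tensor product given by the action of the object `2` of the club. -/
def tensor : X × X ⥤ X where
  obj z := A.obj (Λ.ob 2) ![z.1, z.2]
  map f := A.actMap (Λ.ob 2) (pairHom f)
  map_id z := (congrArg (A.actMap (Λ.ob 2)) (pairHom_id z)).trans (A.actMap_id _ _)
  map_comp f f' := (congrArg (A.actMap (Λ.ob 2)) (pairHom_comp f f')).trans (A.actMap_comp _ _ _)

theorem mk_tensor_map {z z' : X × X} (f : z ⟶ z') :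
    Arrow.mk (A.tensor.map f) = A.arrMonoid.act 2 ![Arrow.mk f.1, Arrow.mk f.2] :=
  A.actArr_congr (a := Λ.ob 2) (u := fun i => Arrow.mk (pairHom f i))
    (Fin.forall_fin_two.2 ⟨rfl, rfl⟩)

theorem mk_id_unit (x : Fin 0 → X) :
    Arrow.mk (𝟙 (A.obj (Λ.ob 0) x)) = A.arrMonoid.act 0 Fin.elim0 :=
  ((A.actArr_congr fun i => i.elim0).trans (A.actArr_id (Λ.ob 0) x)).symm

/-- The strict monoidal structure given by the actions of the objects `0` and `2` of the club. -/
def monoidal : StrictMonoidal X where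
  unit := A.obj (Λ.ob 0) Fin.elim0
  tensor := A.tensor
  assoc := Arrow.functor_ext fun z z' f => by
    refine (A.mk_tensor_map _).trans (Eq.trans ?_ (A.mk_tensor_map _).symm)
    refine Eq.trans ?_
      ((A.arrMonoid.assoc (Arrow.mk f.1.1) (Arrow.mk f.1.2) (Arrow.mk f.2)).trans ?_)
    · exact congrArg (fun a => A.arrMonoid.act 2 ![a, Arrow.mk f.2]) (A.mk_tensor_map f.1)
    · exact congrArg (fun a => A.arrMonoid.act 2 ![Arrow.mk f.1.1, a])
        (A.mk_tensor_map (z := (z.1.2, z.2)) (z' := (z'.1.2, z'.2)) (f.1.2, f.2)).symm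
  unit_tensor := Arrow.functor_ext fun x y f => by
    refine (A.mk_tensor_map _).trans (Eq.trans ?_ (A.arrMonoid.unit_act Fin.elim0 (Arrow.mk f)))
    exact congrArg (fun a => A.arrMonoid.act 2 ![a, Arrow.mk f]) (A.mk_id_unit _)
  tensor_unit := Arrow.functor_ext fun x y f => by
    refine (A.mk_tensor_map _).trans (Eq.trans ?_ (A.arrMonoid.act_unit Fin.elim0 (Arrow.mk f)))
    exact congrArg (fun a => A.arrMonoid.act 2 ![Arrow.mk f, a]) (A.mk_id_unit _)

theorem actsBy_monoidal : A.ActsBy A.monoidal where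
  obj n x := A.objMonoid.act_eq_prodFin (fun x => congrArg _ (Subsingleton.elim _ _))
    (fun a b => rfl) n x
  arr n u := by
    rw [StrictMonoidal.prodArr_eq_prodFin]
    refine A.arrMonoid.act_eq_prodFin (fun u => ?_) (fun a b => ?_) n u
    swap
    · exact (A.mk_tensor_map (z := (a.left, b.left)) (z' := (a.right, b.right))
        (a.hom, b.hom)).symm
    · exact (A.actArr_congr fun i => i.elim0).trans (A.mk_id_unit _).symm

end

variable {G : SymColl.{u}} (p : ActionOperad.free G ⟶ Λ) {X : Type u} [Category.{u} X]
  (A : Λ.club.Algebra X)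

/-- The strict monoidal structure with the natural isomorphisms given by an algebra. -/
noncomputable def operations : StrictMonoidalWith G X where
  toStrictMonoidal := A.monoidal
  iso f := (A.actsBy_monoidal.permNatIso (p.app _ (FormalComposite.gen f).toFree)).toIso
    (p.app_π _ _)

theorem underlies_operations : A.Underlies p (A.operations p) where
  unit x := congrArg (A.obj (Λ.ob 0)) (Subsingleton.elim (α := Fin 0 → X) _ _)
  tensor_obj x := congrArg (A.obj (Λ.ob 2)) (funext (Fin.forall_fin_two.2 ⟨rfl, rfl⟩))
  tensor_map {x y} f := by
    refine (A.mk_tensor_map _).trans ?_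
    exact A.actArr_congr (a := Λ.ob 2) (u' := fun i => Arrow.mk (f i))
      (Fin.forall_fin_two.2 ⟨rfl, rfl⟩)
  iso f x := by
    refine (PermNatIso.mk_toIso_app (A.actsBy_monoidal.permNatIso
      (p.app _ (FormalComposite.gen f).toFree)) (p.app_π _ _) x).trans
      (A.map_congr_right fun i j hij => ?_)
    refine (Fam.mk_ofEnd _ _ _ _).trans (Eq.symm ?_)
    exact Fam.mk_ofEq _ _ _ _

variable {p A}

theorem Underlies.eq_operations {S T : StrictMonoidalWith G X} (h : A.Underlies p S)
    (h' : A.Underlies p T) : S = T := by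
  obtain ⟨S, i⟩ := S
  obtain ⟨T, j⟩ := T
  obtain rfl : S = T := by
    have e : S.tensor = T.tensor := Arrow.functor_ext fun z z' f =>
      (h.tensor_map (pairHom f)).trans (h'.tensor_map (pairHom f)).symm
    have e' : S.unit = T.unit := (h.unit Fin.elim0).trans (h'.unit Fin.elim0).symm
    obtain ⟨_, _, _, _, _⟩ := S
    obtain ⟨_, _, _, _, _⟩ := T
    obtain rfl := e
    obtain rfl := e'
    rfl
  refine congrArg _ (funext fun f => Iso.ext (NatTrans.ext (funext fun x => ?_)))
  exact Arrow.eq_of_mk_eq ((h.iso f x).trans (h'.iso f x).symm)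

end Club.Algebra

/-! ### Strict functors and monoidal transformations -/

namespace StrictMonoidalWith

variable {G : SymColl.{u}}

namespace IsStrictFunctor

section

variable {X Y : Type w} [Category.{v} X] [Category.{v} Y] {S : StrictMonoidalWith G X}
  {T : StrictMonoidalWith G Y} {F : X ⥤ Y}

theorem mapArrow_prodArr (H : S.IsStrictFunctor T F) (n : ℕ) (u : Fin n → Arrow X) :
    F.mapArrow.obj (S.prodArr n u) = T.prodArr n (fun i => F.mapArrow.obj (u i)) := by
  induction n with
  | zero => exact (congrArg Arrow.mk (F.map_id _)).trans (Arrow.mk_id_eq H.unit)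
  | succ n ih =>
    refine Eq.trans ?_ (congrArg (T.tensArr (F.mapArrow.obj (u 0))) (ih fun i => u i.succ))
    exact Arrow.mk_map_of_functor_eq H.tensor (a := ((u 0).left, S.prod n fun i => (u i.succ).left))
      (b := ((u 0).right, S.prod n fun i => (u i.succ).right)) _

theorem obj_prod (H : S.IsStrictFunctor T F) (n : ℕ) (x : Fin n → X) :
    F.obj (S.prod n x) = T.prod n (fun i => F.obj (x i)) :=
  Arrow.left_eq (H.mapArrow_prodArr n fun i => Arrow.mk (𝟙 (x i)))

end

variable {X Y : Type u} [Category.{u} X] [Category.{u} Y] {S : StrictMonoidalWith G X}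
  {T : StrictMonoidalWith G Y} {F : X ⥤ Y}

/-- A strict functor preserves the values of all formal composites. -/
theorem mapArrow_val (H : S.IsStrictFunctor T F) {n : ℕ} (t : FormalComposite G n)
    (x : Fin n → X) :
    F.mapArrow.obj ((S.value t).val x) = (T.value t).val (fun i => F.obj (x i)) := by
  have hp : ∀ {n : ℕ} (t : FormalComposite G n), (S.value t).perm = (T.value t).perm := fun t =>
    (S.perm_value t).trans (T.perm_value t).symm
  induction t with
  | gen f => exact H.iso f x
  | unit => exact (congrArg Arrow.mk (F.map_id _)).trans (Arrow.mk_id_eq (H.obj_prod 1 x))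
  | one n => exact (congrArg Arrow.mk (F.map_id _)).trans (Arrow.mk_id_eq (H.obj_prod n x))
  | mul t t' h h' =>
    refine (Arrow.mapArrow_seq F _ _ _).trans (Arrow.seq_congr (h' x) ?_)
    refine (h _).trans (PermNatIso.val_congr _ fun i => ?_)
    exact congrArg (fun σ : Equiv.Perm _ => F.obj (x (σ.symm i))) (hp t')
  | inv t h =>
    refine Arrow.mapArrow_inverse F (f := (S.value t).val _) (g := (T.value t).val _)
      ((h _).trans (PermNatIso.val_congr _ fun i => ?_))
    exact congrArg (fun σ : Equiv.Perm _ => F.obj (x (σ i))) (hp t)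
  | op k hk t ts h hs =>
    refine (Arrow.mapArrow_seq F _ _ _).trans (Arrow.seq_congr ?_ ?_)
    · exact (H.mapArrow_prodArr _ _).trans (T.prodArr_congr fun i => hs i _)
    · refine (h _).trans (PermNatIso.val_congr _ fun i => ?_)
      refine (H.obj_prod _ _).trans (T.prod_congr fun j => ?_)
      exact congrArg (fun σ : Equiv.Perm _ => F.obj (x (blk k hk ⟨i, σ.symm j⟩))) (hp (ts i))

end IsStrictFunctor

/-- A monoidal transformation is compatible with the `n`-fold tensor products. -/
theorem IsMonoidalTransformation.mk_app_prod {X Y : Type w} [Category.{v} X] [Category.{v} Y]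
    {S : StrictMonoidalWith G X} {T : StrictMonoidalWith G Y} {F F' : X ⥤ Y} {θ : F ⟶ F'}
    (H : S.IsMonoidalTransformation T θ) (n : ℕ) (x : Fin n → X) :
    Arrow.mk (θ.app (S.prod n x)) = T.prodArr n (fun i => Arrow.mk (θ.app (x i))) := by
  induction n with
  | zero => exact H.unit
  | succ n ih =>
    exact (H.tensor _ _).trans
      (congrArg (T.tensArr (Arrow.mk (θ.app (x 0)))) (ih fun i => x i.succ))

end StrictMonoidalWith

namespace Club.Algebra

open ActionOperad

variable {Λ : ActionOperad.{u}} {G : SymColl.{u}} {p : ActionOperad.free G ⟶ Λ}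

section

variable {X Y : Type w} [Category.{v} X] [Category.{v} Y] {A : Λ.club.Algebra X}
  {B : Λ.club.Algebra Y} {S : StrictMonoidalWith G X} {T : StrictMonoidalWith G Y}

theorem IsStrictMap.isStrictFunctor {F : X ⥤ Y} (H : A.IsStrictMap B F) (h : A.Underlies p S)
    (h' : B.Underlies p T) : S.IsStrictFunctor T F where
  unit := ((congrArg F.obj (h.unit Fin.elim0)).trans (H.obj _ _)).trans (h'.unit _).symm
  tensor := Arrow.functor_ext fun z z' f => by
    refine (Arrow.mk_map_congr F (h.tensor_map (pairHom f))).trans ((H.map _ _).trans ?_)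
    refine Eq.trans (B.map_congr_right fun i j hij => ?_)
      (h'.tensor_map (x := fun i => F.obj (![z.1, z.2] i)) (y := fun i => F.obj (![z'.1, z'.2] i))
        fun i => F.map (pairHom f i)).symm
    refine (Arrow.mk_map_congr F (Fam.mk_ofHoms _ _ _ _ _)).trans (Eq.symm ?_)
    exact Fam.mk_ofHoms _ _ _ _ _
  iso f x := by
    refine (Arrow.mk_map_congr F (h.iso f x)).trans ((H.map _ _).trans ?_)
    refine Eq.trans (B.map_congr_right fun i j hij => ?_) (h'.iso f _).symm
    refine (Arrow.mk_map_congr F (Fam.mk_ofEq _ _ _ _)).trans (Eq.symm ?_)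
    exact (Fam.mk_ofEq _ _ _ _).trans (congrArg Arrow.mk (F.map_id _)).symm

/-- The objects of the club act by iterated tensor products, so that compatibility with the objects
`0` and `2` is compatibility with all of them. -/
theorem isTransformation_iff {F F' : X ⥤ Y} (θ : F ⟶ F') (h : A.Underlies p S)
    (h' : B.Underlies p T) : A.IsTransformation B θ ↔ S.IsMonoidalTransformation T θ := by
  have e : ∀ {x y : X}, x = y → Arrow.mk (θ.app x) = Arrow.mk (θ.app y) := by
    rintro x _ rfl
    rfl
  refine ⟨fun H => ⟨?_, fun x y => ?_⟩, fun H n x => ?_⟩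
  · exact (e (h.unit Fin.elim0)).trans ((H (Λ.ob 0) Fin.elim0).trans (h'.actsBy.arr 0 fun i =>
      Arrow.mk (θ.app (i.elim0 : X))))
  · refine (e (h.tensor_obj ![x, y])).trans ((H (Λ.ob 2) ![x, y]).trans ?_)
    exact (h'.tensor_map (x := fun i => F.obj (![x, y] i)) (y := fun i => F'.obj (![x, y] i))
      fun i => θ.app (![x, y] i)).symm
  · refine (e (h.actsBy.obj n x)).trans ((H.mk_app_prod n x).trans ?_)
    exact (h'.actsBy.arr n _).symm

end

variable {X Y : Type u} [Category.{u} X] [Category.{u} Y] {A : Λ.club.Algebra X}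
  {B : Λ.club.Algebra Y} {S : StrictMonoidalWith G X} {T : StrictMonoidalWith G Y}

/-- A functor that preserves the generating isomorphisms preserves the values of all formal
composites, hence the action of every element of `Λ`. -/
theorem isStrictMap_of_isStrictFunctor {F : X ⥤ Y} (H : S.IsStrictFunctor T F)
    (h : A.Underlies p S) (h' : B.Underlies p T)
    (hp : ∀ {n : ℕ} (g : Λ.carrier n), ∃ t : FormalComposite G n, p.app n t.toFree = g) :
    A.IsStrictMap B F where
  obj n x := (congrArg F.obj (h.actsBy.obj n x)).trans
    ((H.obj_prod n x).trans (h'.actsBy.obj n _).symm)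
  map := by
    rintro m _ x y ⟨rfl, g⟩ φ
    obtain ⟨t, rfl⟩ := hp g
    refine (Arrow.mk_map_congr F (f' := (Arrow.seq _ _ _).hom)
      (mk_map_endo h.actsBy _ φ (h.actsBy.obj _ _).symm)).trans ?_
    refine (Arrow.mapArrow_seq F _ _ _).trans (Eq.trans ?_
      (mk_map_endo h'.actsBy _ _ (h'.actsBy.obj _ _).symm).symm)
    refine Arrow.seq_congr (H.mapArrow_prodArr _ _) ?_
    refine (congrArg F.mapArrow.obj (h.permArr_eq t _)).trans ?_
    exact (H.mapArrow_val t _).trans (h'.permArr_eq t _).symm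

end Club.Algebra

theorem ActionOperad.Presents.algebrasCorrespond {Λ : ActionOperad.{u}} {G : SymColl.{u}}
    {p : ActionOperad.free G ⟶ Λ}
    {E : ∀ {n : ℕ}, FormalComposite G n → FormalComposite G n → Prop} (hp : Presents p E) :
    AlgebrasCorrespond p E where
  toOperations X _ A := ⟨A.operations p,
    ⟨(A.underlies_operations p).satisfies hp, A.underlies_operations p⟩,
    fun S hS => hS.2.eq_operations (A.underlies_operations p)⟩
  toAlgebra X _ S hS := by
    obtain ⟨A, hA⟩ := Club.Algebra.exists_underlies hp S hS
    exact ⟨A, hA, fun B hB => hB.eq_algebra hA hp.surjective⟩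
  strictMap_iff X Y _ _ A B S T h h' F := ⟨fun H => H.isStrictFunctor h h',
    fun H => Club.Algebra.isStrictMap_of_isStrictFunctor H h h' hp.surjective⟩
  transformation_iff X Y _ _ A B S T h h' F F' _ _ θ :=
    Club.Algebra.isTransformation_iff θ h h'

theorem mainTheorem9 :
    -- an action operad with a presentation
    (∀ (Λ : ActionOperad.{u}) (P : Presentation Λ),
      -- the club is generated by the unit, the tensor product and the isomorphisms
      (∀ K : Club.{w, u},
        (∀ F : Club.Hom Λ.club K,
          ∃! S : K.Operations P.gens, S.Satisfies P.Eqn ∧ F.Realizes P.p S) ∧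
        (∀ S : K.Operations P.gens, S.Satisfies P.Eqn →
          ∃! F : Club.Hom Λ.club K, F.Realizes P.p S)) ∧
      -- its algebras
      AlgebrasCorrespond P.p P.Eqn) ∧
    -- strict monoidal categories given by natural isomorphisms and axioms
    (∀ (G : SymColl.{u}) (R : AxiomSet G),
      (∃ (Λ : ActionOperad.{u}) (p : ActionOperad.free G ⟶ Λ) (h : R.s₁ ≫ p = R.s₂ ≫ p),
        Nonempty (IsColimit (Cofork.ofπ p h))) ∧
      ∀ (Λ : ActionOperad.{u}) (p : ActionOperad.free G ⟶ Λ) (h : R.s₁ ≫ p = R.s₂ ≫ p),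
        IsColimit (Cofork.ofπ p h) → AlgebrasCorrespond p R.Eqn) := by
  refine ⟨fun Λ P => ⟨fun K => ⟨fun F => F.existsUnique_operations P.presents, fun S hS =>
    S.existsUnique_hom P.presents hS⟩, P.presents.algebrasCorrespond⟩, fun G R => ⟨?_, ?_⟩⟩
  · exact ⟨_, _, ActionOperad.coeq_condition R.s₁ R.s₂, ⟨ActionOperad.coeqIsColimit R.s₁ R.s₂⟩⟩
  · exact fun Λ p h hp => (R.presents hp).algebrasCorrespond
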